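/- Let $0\le k\le\infty$ and let $M$ be a (Hausdorff) real $n$-dimensional manifold of class $C^{k+2}$. Paths $\gamma:J\to M$ are of class $C^{k+1}$, with $J\subseteq\mathbb R$ any nondegenerate interval; they need be neither regular nor injective unless this is said. A *frame along $\gamma$* is an $n$-tuple of $C^{k+1}$ vector fields along $\gamma$ that form a basis of $T_{\gamma(s)}M$ for every $s\in J$. A *derivation along $\gamma$* is a map $D^\gamma$ from the $C^{k+1}$ tensor fields along $\gamma$ to the $C^k$ tensor fields along $\gamma$ that preserves the type, is $\mathbb R$-linear, equals $d/ds$ on functions, satisfies the Leibniz rule for tensor products and commutes with contractions. Its components in a frame $\{E_i\}$ along $\gamma$ are the functions $\Gamma^i_j$ with $D^\gamma E_j=\sum_i\Gamma^i_jE_i$; the frame is *normal* for $D^\gamma$ if they vanish on $J$. A *derivation along paths* $D$ assigns to every path $\gamma$ a derivation $D^\gamma$ along $\gamma$. 1. (Fixed path.) Every derivation $D^\gamma$ along a fixed path $\gamma$ admits a normal frame along $\gamma$. If $\{E_i\}$ is any frame along $\gamma$, then the components $\Gamma$ of $D^\gamma$ in it exist and are of class $C^k$; for every $s_0\in J$ the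 problem $dY/ds=-\Gamma Y$, $Y(s_0)=\mathbf 1$, has exactly one matrix solution $Y$ on $J$; $Y(s)$ is invertible for all $s\in J$; and the frames along $\gamma$ that are normal for $D^\gamma$ are exactly the $\{E'_j\}$ with $E'_j(s)=\sum_i (Y(s)B)^i_jE_i(s)$ for a constant matrix $B\in GL(n,\mathbb R)$. 2. (Local holonomic extension.) Let $\{E_i\}$ be any frame along a path $\gamma$ and let $s_0\in J$ with $\dot\gamma(s_0)\neq0$. Then there are local coordinates $(x^1,\dots,x^n)$ of class $C^{k+1}$ around $\gamma(s_0)$ such that $\partial/\partial x^i|_{\gamma(s)}=E_i(s)$ for all $i$ and all $s\in J$ in a neighbourhood of $s_0$. 3. (Arbitrary paths.) Let $D$ be a derivation along paths and $U\subseteq M$ any subset. A $C^{k+1}$ frame $\{E_i\}$ on an open neighbourhood of $U$ is called *normal on $U$ for $D$* if, for every path $\gamma$ and every $s$ with $\gamma(s)\in U$, the components of $D^\gamma$ in $\{E_i\circ\gamma\}$ vanish at $s$; it is called *normal on $U$ for a linear connection $\nabla$* if the coefficients of $\nabla$ in it vanish on $U$. Then $D$ admits a frame normal on $U$ if and only if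 there is a linear connection $\nabla$ of class $C^k$ on an open neighbourhood of $U$ that admits a frame normal on $U$ and that induces $D$ on $U$, i.e. $D^\gamma T=\nabla_{\dot\gamma}T$ at $s$ for every path $\gamma$, every $s$ with $\gamma(s)\in U$ and every $C^{k+1}$ tensor field $T$ of any type along $\gamma$. Whenever $D$ is induced on $U$ by a connection $\nabla$ in this way, the frames normal on $U$ for $D$ and for $\nabla$ are the same. (For $U=M$ this is the statement for frames normal on the whole manifold.) 4. The equivalence in 3 remains true if, in both notions involving $D$, only the paths lying entirely in $U$ are considered. When $D$ is induced in this sense by $\nabla$, every frame normal on $U$ for $\nabla$ is normal on $U$ for $D$, and the converse holds if $U$ is open. -/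

import Mathlib

open Set Filter Topology Bundle Module
open scoped Manifold ContDiff

noncomputable section

namespace NormalFrames

/-! ### Paths and fields along paths -/

/-- A path of class `C^(k+1)` in the `n`-dimensional manifold `M`, defined on a nondegenerate
interval `J` of any kind (open, closed, half-open, bounded or not). Only the values of `toFun`
on `J` are meaningful. -/
structure CPath (n : ℕ) (k : ℕ∞) (M : Type*) [TopologicalSpace M]
    [ChartedSpace (EuclideanSpace ℝ (Fin n)) M] where
  /-- the interval on which the path is defined -/
  J : Set ℝ
  ordConnected : J.OrdConnected
  nontrivial : J.Nontrivial
  /-- the path -/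
  toFun : ℝ → M
  contMDiffOn : ContMDiffOn 𝓘(ℝ, ℝ) (𝓡 n) ((k : ℕ∞ω) + 1) toFun J

section

variable {n : ℕ} {k : ℕ∞} {M : Type*} [TopologicalSpace M]
  [ChartedSpace (EuclideanSpace ℝ (Fin n)) M]

/-- The tangent space of `M` at `x`. -/
abbrev Tan (n : ℕ) {M : Type*} [TopologicalSpace M]
    [ChartedSpace (EuclideanSpace ℝ (Fin n)) M] (x : M) : Type :=
  TangentSpace (𝓡 n) x

/-- The cotangent space of `M` at `x`. -/
abbrev Cotan (n : ℕ) {M : Type*} [TopologicalSpace M]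
    [ChartedSpace (EuclideanSpace ℝ (Fin n)) M] (x : M) : Type :=
  Dual ℝ (Tan n x)

/-- Tensors of type `(p, q)` at `x`: multilinear functions of `p` covectors and `q` vectors. -/
abbrev TensorAt (n : ℕ) {M : Type*} [TopologicalSpace M]
    [ChartedSpace (EuclideanSpace ℝ (Fin n)) M] (x : M) (p q : ℕ) : Type :=
  MultilinearMap ℝ (fun _ : Fin p => Cotan n x) (MultilinearMap ℝ (fun _ : Fin q => Tan n x) ℝ)

/-- The velocity vector of the path at the parameter `s`. -/
def CPath.velocity (γ : CPath n k M) (s : ℝ) : Tan n (γ.toFun s) :=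
  mfderivWithin 𝓘(ℝ, ℝ) (𝓡 n) γ.toFun γ.J s (1 : ℝ)

/-- Vector fields along a path (only the values at parameters in `J` are meaningful). -/
abbrev VectorField (γ : CPath n k M) : Type := ∀ s : ℝ, Tan n (γ.toFun s)

/-- Covector fields along a path. -/
abbrev CovectorField (γ : CPath n k M) : Type := ∀ s : ℝ, Cotan n (γ.toFun s)

/-- Tensor fields of type `(p, q)` along a path. -/
abbrev TensorField (γ : CPath n k M) (p q : ℕ) : Type := ∀ s : ℝ, TensorAt n (γ.toFun s) p q

/-! ### Tensor algebra -/

lemma comp_castAdd_update_castAdd {A : Type*} {p p' : ℕ} (α : Fin (p + p') → A) (b : Fin p)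
    (y : A) : (fun a => Function.update α (Fin.castAdd p' b) y (Fin.castAdd p' a)) =
      Function.update (fun a => α (Fin.castAdd p' a)) b y :=
  Function.update_comp_eq_of_injective α (Fin.castAdd_injective p p') b y

lemma comp_natAdd_update_natAdd {A : Type*} {p p' : ℕ} (α : Fin (p + p') → A) (b : Fin p')
    (y : A) : (fun a => Function.update α (Fin.natAdd p b) y (Fin.natAdd p a)) =
      Function.update (fun a => α (Fin.natAdd p a)) b y :=
  Function.update_comp_eq_of_injective α (Fin.natAdd_injective p' p) b y

lemma comp_natAdd_update_castAdd {A : Type*} {p p' : ℕ} (α : Fin (p + p') → A) (b : Fin p)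
    (y : A) : (fun a => Function.update α (Fin.castAdd p' b) y (Fin.natAdd p a)) =
      fun a => α (Fin.natAdd p a) :=
  Function.update_comp_eq_of_forall_ne α y (fun a h => by
    have := congrArg Fin.val h
    simp at this
    omega)

lemma comp_castAdd_update_natAdd {A : Type*} {p p' : ℕ} (α : Fin (p + p') → A) (b : Fin p')
    (y : A) : (fun a => Function.update α (Fin.natAdd p b) y (Fin.castAdd p' a)) =
      fun a => α (Fin.castAdd p' a) :=
  Function.update_comp_eq_of_forall_ne α y (fun a h => by
    have := congrArg Fin.val h
    simp at this
    omega)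

/-- The tensor product of tensors of types `(p, q)` and `(p', q')`: the first tensor takes the
first `p` covectors and the first `q` vectors. -/
def tensorMul {x : M} {p q p' q' : ℕ} (T : TensorAt n x p q) (S : TensorAt n x p' q') :
    TensorAt n x (p + p') (q + q') :=
  MultilinearMap.mk' (fun α =>
    MultilinearMap.mk' (fun v =>
      T (fun a => α (Fin.castAdd p' a)) (fun b => v (Fin.castAdd q' b)) *
        S (fun a => α (Fin.natAdd p a)) (fun b => v (Fin.natAdd q b)))
      (fun v i y z => by
        induction i using Fin.addCases with
        | left b => simp only [comp_castAdd_update_castAdd, comp_natAdd_update_castAdd,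
            MultilinearMap.map_update_add, add_mul]
        | right b => simp only [comp_castAdd_update_natAdd, comp_natAdd_update_natAdd,
            MultilinearMap.map_update_add, mul_add])
      (fun v i c y => by
        induction i using Fin.addCases with
        | left b => simp only [comp_castAdd_update_castAdd, comp_natAdd_update_castAdd,
            MultilinearMap.map_update_smul, smul_mul_assoc]
        | right b => simp only [comp_castAdd_update_natAdd, comp_natAdd_update_natAdd,
            MultilinearMap.map_update_smul, mul_smul_comm]))
    (fun α i y z => by
      ext v
      induction i using Fin.addCases with
      | left b => simp only [MultilinearMap.mk'_apply, add_apply,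
          comp_castAdd_update_castAdd, comp_natAdd_update_castAdd,
          MultilinearMap.map_update_add, add_mul]
      | right b => simp only [MultilinearMap.mk'_apply, add_apply,
          comp_castAdd_update_natAdd, comp_natAdd_update_natAdd,
          MultilinearMap.map_update_add, mul_add])
    (fun α i c y => by
      ext v
      induction i using Fin.addCases with
      | left b => simp only [MultilinearMap.mk'_apply, smul_apply,
          comp_castAdd_update_castAdd, comp_natAdd_update_castAdd,
          MultilinearMap.map_update_smul, smul_mul_assoc]
      | right b => simp only [MultilinearMap.mk'_apply, smul_apply,
          comp_castAdd_update_natAdd, comp_natAdd_update_natAdd,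
          MultilinearMap.map_update_smul, mul_smul_comm])

@[simp] lemma tensorMul_apply {x : M} {p q p' q' : ℕ} (T : TensorAt n x p q)
    (S : TensorAt n x p' q') (α : Fin (p + p') → Cotan n x) (v : Fin (q + q') → Tan n x) :
    tensorMul T S α v =
      T (fun a => α (Fin.castAdd p' a)) (fun b => v (Fin.castAdd q' b)) *
        S (fun a => α (Fin.natAdd p a)) (fun b => v (Fin.natAdd q b)) := rfl

/-- A number as a tensor of type `(0, 0)`. -/
def scalarTensor (x : M) (c : ℝ) : TensorAt n x 0 0 :=
  MultilinearMap.constOfIsEmpty ℝ _ (MultilinearMap.constOfIsEmpty ℝ _ c)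

/-- A vector as a tensor of type `(1, 0)`: `α ↦ α v`. -/
def vectorTensor {x : M} (v : Tan n x) : TensorAt n x 1 0 :=
  MultilinearMap.ofSubsingleton ℝ (Cotan n x) (MultilinearMap ℝ (fun _ : Fin 0 => Tan n x) ℝ) 0
    ((MultilinearMap.constLinearEquivOfIsEmpty (R := ℝ) (S := ℝ) (M₁ := fun _ : Fin 0 => Tan n x)
      (M₂ := ℝ)).toLinearMap.comp (Dual.eval ℝ (Tan n x) v))

@[simp] lemma scalarTensor_apply (x : M) (c : ℝ) (α : Fin 0 → Cotan n x) (v : Fin 0 → Tan n x) :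
    scalarTensor x c α v = c := rfl

@[simp] lemma vectorTensor_apply {x : M} (w : Tan n x) (α : Fin 1 → Cotan n x)
    (v : Fin 0 → Tan n x) : vectorTensor w α v = α 0 w := rfl

end

section

variable {n : ℕ} {k : ℕ∞} {M : Type*} [TopologicalSpace M]
  [ChartedSpace (EuclideanSpace ℝ (Fin n)) M] [IsManifold (𝓡 n) 1 M]

/-- The coordinate basis at `x` of the preferred chart at `x`. -/
def coordBasis (x : M) : Basis (Fin n) ℝ (Tan n x) :=
  (trivializationAt (EuclideanSpace ℝ (Fin n)) (TangentSpace (𝓡 n)) x).basisAt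
    (EuclideanSpace.basisFun (Fin n) ℝ).toBasis (FiberBundle.mem_baseSet_trivializationAt' x)

/-- The contraction of the `i`-th contravariant with the `j`-th covariant slot
(the trace does not depend on the basis in which it is computed). -/
def contraction {x : M} {p q : ℕ} (i : Fin (p + 1)) (j : Fin (q + 1))
    (T : TensorAt n x (p + 1) (q + 1)) : TensorAt n x p q :=
  ∑ a : Fin n,
    ((LinearMap.applyₗ (coordBasis x a)).comp
      (MultilinearMap.curryMidLinearEquiv ℝ (fun _ : Fin (q + 1) => Tan n x) ℝ j).toLinearMap
      ).compMultilinearMap (T.curryMid i ((coordBasis x).coord a))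

lemma contraction_apply {x : M} {p q : ℕ} (i : Fin (p + 1)) (j : Fin (q + 1))
    (T : TensorAt n x (p + 1) (q + 1)) (α : Fin p → Cotan n x) (v : Fin q → Tan n x) :
    contraction i j T α v =
      ∑ a : Fin n, T (i.insertNth (α := fun _ => Cotan n x) ((coordBasis x).coord a) α)
        (j.insertNth (α := fun _ => Tan n x) (coordBasis x a) v) := by
  simp only [contraction, sum_apply]
  rfl

/-! ### Smoothness of fields along a path -/

/-- The vector field `X` along `γ` is of class `C^m`. -/
def IsClassVec {γ : CPath n k M} (m : ℕ∞ω) (X : VectorField γ) : Prop :=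
  ContMDiffOn 𝓘(ℝ, ℝ) (𝓡 n).tangent m
    (fun s => (⟨γ.toFun s, X s⟩ : TangentBundle (𝓡 n) M)) γ.J

/-- The covector field `θ` along `γ` is of class `C^m`. -/
def IsClassCovec {γ : CPath n k M} (m : ℕ∞ω) (θ : CovectorField γ) : Prop :=
  ∀ X : VectorField γ, IsClassVec m X → ContDiffOn ℝ m (fun s => θ s (X s)) γ.J

/-- The tensor field `T` along `γ` is of class `C^m`. -/
def IsClassTensor {γ : CPath n k M} (m : ℕ∞ω) {p q : ℕ} (T : TensorField γ p q) : Prop :=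
  ∀ (θ : Fin p → CovectorField γ) (X : Fin q → VectorField γ),
    (∀ a, IsClassCovec m (θ a)) → (∀ b, IsClassVec m (X b)) →
      ContDiffOn ℝ m (fun s => T s (fun a => θ a s) (fun b => X b s)) γ.J

/-! ### Derivations along paths -/

/-- A derivation along the path `γ` of the tensor algebra over `M`: it sends tensor fields along
`γ` of class `C^(k+1)` to tensor fields along `γ` of the same type and of class `C^k`, is
`ℝ`-linear, coincides on functions with `d/ds`, satisfies the Leibniz rule for tensor products
and commutes with all contractions. -/
structure DerivationAlong (γ : CPath n k M) where
  /-- the action on tensor fields along `γ` -/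
  toFun : ∀ {p q : ℕ}, TensorField γ p q → TensorField γ p q
  /-- a tensor field along `γ` is given by its values at parameters in `J` -/
  congr : ∀ {p q : ℕ} (T S : TensorField γ p q), (∀ s ∈ γ.J, T s = S s) →
    ∀ s ∈ γ.J, toFun T s = toFun S s
  isClass : ∀ {p q : ℕ} (T : TensorField γ p q), IsClassTensor ((k : ℕ∞ω) + 1) T →
    IsClassTensor (k : ℕ∞ω) (toFun T)
  add : ∀ {p q : ℕ} (T S : TensorField γ p q), IsClassTensor ((k : ℕ∞ω) + 1) T →
    IsClassTensor ((k : ℕ∞ω) + 1) S →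
    ∀ s ∈ γ.J, toFun (fun t => T t + S t) s = toFun T s + toFun S s
  smul : ∀ {p q : ℕ} (c : ℝ) (T : TensorField γ p q), IsClassTensor ((k : ℕ∞ω) + 1) T →
    ∀ s ∈ γ.J, toFun (fun t => c • T t) s = c • toFun T s
  scalar : ∀ f : ℝ → ℝ, ContDiffOn ℝ ((k : ℕ∞ω) + 1) f γ.J →
    ∀ s ∈ γ.J, toFun (fun t => scalarTensor (γ.toFun t) (f t)) s =
      scalarTensor (γ.toFun s) (derivWithin f γ.J s)
  leibniz : ∀ {p q p' q' : ℕ} (T : TensorField γ p q) (S : TensorField γ p' q'),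
    IsClassTensor ((k : ℕ∞ω) + 1) T → IsClassTensor ((k : ℕ∞ω) + 1) S →
    ∀ s ∈ γ.J, toFun (fun t => tensorMul (T t) (S t)) s =
      tensorMul (toFun T s) (S s) + tensorMul (T s) (toFun S s)
  contract : ∀ {p q : ℕ} (i : Fin (p + 1)) (j : Fin (q + 1)) (T : TensorField γ (p + 1) (q + 1)),
    IsClassTensor ((k : ℕ∞ω) + 1) T →
    ∀ s ∈ γ.J, toFun (fun t => contraction i j (T t)) s = contraction i j (toFun T s)

variable (n k M) in
/-- A derivation along (arbitrary) paths: a derivation along every path. -/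
abbrev DerivationAlongPaths : Type _ := ∀ γ : CPath n k M, DerivationAlong γ

/-- The value of a derivation along `γ` on a vector field along `γ`, as a `(1, 0)` tensor field. -/
def DerivationAlong.onVec {γ : CPath n k M} (D : DerivationAlong γ) (X : VectorField γ) :
    TensorField γ 1 0 :=
  D.toFun (fun t => vectorTensor (X t))

/-! ### Frames along one path -/

/-- A frame of class `C^(k+1)` along the path `γ`. -/
structure IsFrameAlong (γ : CPath n k M) (e : Fin n → VectorField γ) : Prop where
  isClass : ∀ i, IsClassVec ((k : ℕ∞ω) + 1) (e i)
  linearIndependent : ∀ s ∈ γ.J, LinearIndependent ℝ (fun i => e i s)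
  span_eq_top : ∀ s ∈ γ.J, Submodule.span ℝ (range fun i => e i s) = ⊤

/-- `Γ` is the matrix of components of the derivation `D` along `γ` in the frame `e` along `γ`:
`D e_j = ∑ i, Γ^i_j e_i`. -/
def IsComponents {γ : CPath n k M} (D : DerivationAlong γ) (e : Fin n → VectorField γ)
    (Γ : ℝ → Matrix (Fin n) (Fin n) ℝ) : Prop :=
  ∀ s ∈ γ.J, ∀ j, D.onVec (e j) s = ∑ i, Γ s i j • vectorTensor (e i s)

/-- The frame `e` along `γ` is normal for the derivation `D` along `γ`: the components of `D` in
`e` vanish. -/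
def IsNormalAlong {γ : CPath n k M} (D : DerivationAlong γ) (e : Fin n → VectorField γ) : Prop :=
  IsComponents D e (fun _ => 0)

/-- `Y` solves `dY/ds = -Γ Y` on the interval of `γ`, with `Y(s₀) = 1`. -/
def IsFundamentalSolution (γ : CPath n k M) (Γ : ℝ → Matrix (Fin n) (Fin n) ℝ) (s₀ : ℝ)
    (Y : ℝ → Matrix (Fin n) (Fin n) ℝ) : Prop :=
  Y s₀ = 1 ∧ ∀ s ∈ γ.J, ∀ i j,
    HasDerivWithinAt (fun t => Y t i j) (-(Γ s * Y s) i j) γ.J s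

/-! ### Linear connections -/

/-- `cov` is a linear connection of class `C^k` on the tangent bundle of the open set `V`:
`cov Y x v` is `∇_v Y` at `x`. -/
structure IsConnectionOn (k : ℕ∞)
    (cov : (∀ x : M, Tan n x) → ∀ x : M, Tan n x →L[ℝ] Tan n x) (V : Set M) : Prop where
  isOpen : IsOpen V
  isCovariantDerivativeOn : IsCovariantDerivativeOn (EuclideanSpace ℝ (Fin n)) cov V
  contMDiff : ContMDiffCovariantDerivativeOn (EuclideanSpace ℝ (Fin n)) (k : ℕ∞ω) cov V

/-- The covector field near `x` which extends the covector `α` at `x` and has constant components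
in the preferred chart at `x`. (For vectors, `FiberBundle.extend` is such an extension.) -/
def coextend {x : M} (α : Cotan n x) (y : M) : Cotan n y :=
  let t := trivializationAt (EuclideanSpace ℝ (Fin n)) (TangentSpace (𝓡 n)) x
  (α.comp (t.symmL ℝ x).toLinearMap).comp (t.continuousLinearMapAt ℝ y).toLinearMap

/-- The matrix, as an endomorphism of the tangent space at `γ(s)`, of the connection along `γ`
in the coordinate frame `∂_a` of the preferred chart at `γ(s)`: it sends `∂_a` to
`∇_{γ̇(s)} ∂_a`. -/
def connectionMap (cov : (∀ x : M, Tan n x) → ∀ x : M, Tan n x →L[ℝ] Tan n x)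
    (γ : CPath n k M) (s : ℝ) : Tan n (γ.toFun s) →ₗ[ℝ] Tan n (γ.toFun s) :=
  (coordBasis (γ.toFun s)).constr ℝ (fun a =>
    cov (FiberBundle.extend (EuclideanSpace ℝ (Fin n)) (coordBasis (γ.toFun s) a))
      (γ.toFun s) (γ.velocity s))

/-- The covariant derivative along `γ` at the parameter `s`, induced by the connection `cov`, of
a tensor field `T` along `γ` of type `(p, q)`, evaluated on `p` covectors and `q` vectors at
`γ(s)`. This is the coordinate formula
`dT^{i…}_{j…}/ds + ∑ Γ^i_l T^{…l…}_{j…} - ∑ Γ^l_j T^{i…}_{…l…}`,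
`Γ^i_j` being the components of `connectionMap`. -/
def covariantAlong (cov : (∀ x : M, Tan n x) → ∀ x : M, Tan n x →L[ℝ] Tan n x)
    (γ : CPath n k M) {p q : ℕ} (T : TensorField γ p q) (s : ℝ)
    (α : Fin p → Cotan n (γ.toFun s)) (v : Fin q → Tan n (γ.toFun s)) : ℝ :=
  derivWithin (fun t => T t (fun a => coextend (α a) (γ.toFun t))
      (fun b => FiberBundle.extend (EuclideanSpace ℝ (Fin n)) (v b) (γ.toFun t))) γ.J s
    + ∑ a, T s (Function.update α a ((α a).comp (connectionMap cov γ s))) v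
    - ∑ b, T s α (Function.update v b (connectionMap cov γ s (v b)))

/-! ### Frames on sets and normality -/

/-- A frame of class `C^(k+1)` on an open neighbourhood `W` of the set `U`. -/
structure IsFrameNear (k : ℕ∞) (U W : Set M) (e : Fin n → ∀ x : M, Tan n x) : Prop where
  isOpen : IsOpen W
  subset : U ⊆ W
  isLocalFrameOn :
    IsLocalFrameOn (𝓡 n) (EuclideanSpace ℝ (Fin n)) ((k : ℕ∞ω) + 1) e W

/-- All pairs of a path in `M` and a parameter at which the path is in `U`. -/
def pathsThrough (k : ℕ∞) (U : Set M) : Set (CPath n k M × ℝ) :=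
  {z | z.2 ∈ z.1.J ∧ z.1.toFun z.2 ∈ U}

/-- All pairs of a path lying entirely in `U` and a parameter of this path. -/
def pathsInside (k : ℕ∞) (U : Set M) : Set (CPath n k M × ℝ) :=
  {z | z.2 ∈ z.1.J ∧ ∀ t ∈ z.1.J, z.1.toFun t ∈ U}

/-- The frame `e` is normal for the derivation `D` along paths at all `(γ, s)` in `A`: the
components of `D` along `γ` vanish at `s`, that is, `D (e_i ∘ γ)` vanishes at `s`. Since `e_i` may
be defined only near `γ(s)`, a vector field along `γ` which is equal to `e_i ∘ γ` for parameters
near `s` takes the place of `e_i ∘ γ`; which one does not matter. -/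
def IsNormalFor (D : DerivationAlongPaths n k M) (e : Fin n → ∀ x : M, Tan n x)
    (A : Set (CPath n k M × ℝ)) : Prop :=
  ∀ γ s, (γ, s) ∈ A → ∀ (i : Fin n) (X : VectorField γ), IsClassVec ((k : ℕ∞ω) + 1) X →
    (∀ᶠ t in 𝓝[γ.J] s, X t = e i (γ.toFun t)) → (D γ).onVec X s = 0

/-- The frame `e` is normal on `U` for the connection `cov`: the coefficients of the connection in
this frame vanish on `U`, that is, `∇_{e_i} e_j = 0` at the points of `U`. -/
def IsNormalForConnection (cov : (∀ x : M, Tan n x) → ∀ x : M, Tan n x →L[ℝ] Tan n x)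
    (e : Fin n → ∀ x : M, Tan n x) (U : Set M) : Prop :=
  ∀ x ∈ U, ∀ i j, cov (e j) x (e i x) = 0

/-- The derivation `D` along paths is, at all `(γ, s)` in `A`, the covariant derivative along paths
induced by the connection `cov`. -/
def IsInducedBy (D : DerivationAlongPaths n k M)
    (cov : (∀ x : M, Tan n x) → ∀ x : M, Tan n x →L[ℝ] Tan n x)
    (A : Set (CPath n k M × ℝ)) : Prop :=
  ∀ γ s, (γ, s) ∈ A → ∀ (p q : ℕ) (T : TensorField γ p q), IsClassTensor ((k : ℕ∞ω) + 1) T →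
    ∀ α v, (D γ).toFun T s α v = covariantAlong cov γ T s α v

/-- The derivation `D` along paths admits a frame that is normal at all `(γ, s)` in `A`, the frame
being defined near `U`. -/
def AdmitsNormalFrame (D : DerivationAlongPaths n k M) (U : Set M)
    (A : Set (CPath n k M × ℝ)) : Prop :=
  ∃ W e, IsFrameNear k U W e ∧ IsNormalFor D e A

/-- The connection admits a frame normal on `U`. -/
def ConnectionAdmitsNormalFrame (k : ℕ∞)
    (cov : (∀ x : M, Tan n x) → ∀ x : M, Tan n x →L[ℝ] Tan n x) (U : Set M) : Prop :=
  ∃ W e, IsFrameNear k U W e ∧ IsNormalForConnection cov e U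

end

end NormalFrames

end

/-! A derivation along a path is determined by what it does to functions and vector fields.
Inserting an argument into a tensor is a tensor product followed by a contraction, so the axioms
give a Leibniz rule slot by slot (`toFun_apply`), and covectors are governed by duality
(`covec_apply`).

Fixed path. In a frame, `D Z = 0` for `Z = ∑ xⁱ E_i` is the linear equation `x' = -Γ x` with
coefficients of class `C^k` on the interval. Such equations have exactly one global solution for
each initial value, of class `C^(k+1)`. No frame on the whole of `J` is available beforehand, so the
equation is solved in coordinate frames near each parameter and the solutions are glued
(`exists_of_locally_solvable`). Parallel fields issuing from a basis at one parameter form a normal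
frame. Relative to a given frame, the parallel fields are the columns `Y v` with `v` constant, so
the constant invertible matrix `B` is the only freedom.

Holonomic extension. In a chart, let `x(s)` be the path and `A(s)` the linear map sending the frame
to the standard basis. A map with differential `A(s)` at `x(s)` is `y ↦ c(r(y)) + A(r(y))(y -
x(r(y)))`, where `c' = A x'` and `r` is a local function with `r(x(s)) = s`; it exists since `x'(s₀)
≠ 0`. The inverse function theorem makes it a chart. If `s₀` is an endpoint of `J`, the path and the
frame are first continued across it by Borel's lemma.

Arbitrary paths. If a frame is normal for `D`, the connection making this frame parallel induces
`D`: a derivation and a connection obey the same formula on combinations of frame fields, so they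
agree on all vector fields once they agree on one frame (`onField_eq_of_frame`), and then on all
tensors. Once `D` is induced by a connection, normality of a frame for `D` says that `∇_v e_j = 0`
for all velocities `v` of admissible paths. Paths through a point realise every tangent vector;
paths confined to `U` are sure to do so only when `U` is open, which explains the one-sided last
statement. -/

noncomputable section

namespace NormalFrames

/-! ### Solutions on intervals -/

section Gluing

variable {J : Set ℝ} {F : ℝ → Type*} {L : (∀ s, F s) → ℝ → Prop}

/-- Two fields satisfying a local condition, whose solutions are locally determined by one value,
agree on an interval as soon as they agree at one of its points. -/
theorem eq_of_locally_unique
    (hloc : ∀ t ∈ J, ∃ O ∈ 𝓝 t, O.OrdConnected ∧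
      ∀ I ⊆ O ∩ J, I.OrdConnected → ∀ X X', (∀ r ∈ I, L X r) → (∀ r ∈ I, L X' r) →
        ∀ s ∈ I, ∀ s' ∈ I, X s = X' s → X s' = X' s')
    {I : Set ℝ} (hI : I.OrdConnected) (hIJ : I ⊆ J) {X X' : ∀ s, F s}
    (hX : ∀ r ∈ I, L X r) (hX' : ∀ r ∈ I, L X' r) {s s' : ℝ} (hs : s ∈ I) (hs' : s' ∈ I)
    (h : X s = X' s) : X s' = X' s' := by
  -- An equivalence rather than an implication, so that the relation between two parameters is
  -- symmetric and transitive and connectedness reduces it to nearby parameters.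
  have key : X s = X' s ↔ X s' = X' s' := by
    refine hI.isPreconnected.induction₂ (fun a b => X a = X' a ↔ X b = X' b) ?_
      (fun a b c _ _ _ h1 h2 => h1.trans h2) (fun a b _ _ h1 => h1.symm) hs hs'
    intro t ht
    obtain ⟨O, hO, hOc, hu⟩ := hloc t (hIJ ht)
    have hu' := hu (O ∩ I) (inter_subset_inter_right _ hIJ) (hOc.inter hI) X X'
      (fun r hr => hX r hr.2) (fun r hr => hX' r hr.2)
    filter_upwards [mem_nhdsWithin_of_mem_nhds hO, self_mem_nhdsWithin] with b hb hbI
    have htO : t ∈ O ∩ I := ⟨mem_of_mem_nhds hO, ht⟩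
    exact ⟨hu' t htO b ⟨hb, hbI⟩, hu' b ⟨hb, hbI⟩ t htO⟩
  exact key.1 h

open Classical in
/-- A field satisfying a local condition, which can locally be solved uniquely with any prescribed
value, exists on a whole interval. -/
theorem exists_of_locally_solvable (hJ : J.OrdConnected)
    (hL : ∀ X X' s, s ∈ J → (∀ᶠ t in 𝓝[J] s, X t = X' t) → L X s → L X' s)
    (hloc : ∀ t ∈ J, ∃ O ∈ 𝓝 t, O.OrdConnected ∧
      (∀ s ∈ O ∩ J, ∀ v : F s, ∃ X, X s = v ∧ ∀ r ∈ O ∩ J, L X r) ∧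
      ∀ I ⊆ O ∩ J, I.OrdConnected → ∀ X X', (∀ r ∈ I, L X r) → (∀ r ∈ I, L X' r) →
        ∀ s ∈ I, ∀ s' ∈ I, X s = X' s → X s' = X' s')
    {s₀ : ℝ} (hs₀ : s₀ ∈ J) (v : F s₀) : ∃ X, X s₀ = v ∧ ∀ r ∈ J, L X r := by
  have huniq : ∀ t ∈ J, ∃ O ∈ 𝓝 t, O.OrdConnected ∧
      ∀ I ⊆ O ∩ J, I.OrdConnected → ∀ X X', (∀ r ∈ I, L X r) → (∀ r ∈ I, L X' r) →
        ∀ s ∈ I, ∀ s' ∈ I, X s = X' s → X s' = X' s' := fun t ht => by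
    obtain ⟨O, h1, h2, -, h3⟩ := hloc t ht
    exact ⟨O, h1, h2, h3⟩
  -- Relative openness in `J` is what lets the locality of `L` survive the case distinction used to
  -- glue two solutions. The prescribed value may sit at any point of the set.
  let Good : Set ℝ → Prop := fun I => I.OrdConnected ∧ I ⊆ J ∧ (∀ r ∈ I, I ∈ 𝓝[J] r) ∧
    ∀ r ∈ I, ∀ v : F r, ∃ X, X r = v ∧ ∀ r ∈ I, L X r
  have half : ∀ I₁ I₂ s, Good I₁ → Good I₂ → s ∈ I₁ → s ∈ I₂ →
      ∀ r ∈ I₁, ∀ v : F r, ∃ X, X r = v ∧ ∀ r ∈ I₁ ∪ I₂, L X r := by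
    intro I₁ I₂ s h₁ h₂ hs₁ hs₂ r hr v
    obtain ⟨X₁, hX₁, hL₁⟩ := h₁.2.2.2 r hr v
    obtain ⟨X₂, hX₂, hL₂⟩ := h₂.2.2.2 s hs₂ (X₁ s)
    -- The overlap of two intervals is again an interval, so agreement at `s` spreads over all of
    -- it.
    have heq : ∀ t ∈ I₁ ∩ I₂, X₂ t = X₁ t := fun t ht =>
      eq_of_locally_unique huniq (h₁.1.inter h₂.1) (inter_subset_left.trans h₁.2.1)
        (fun r hr => hL₂ r hr.2) (fun r hr => hL₁ r hr.1) ⟨hs₁, hs₂⟩ ht hX₂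
    let X : ∀ t, F t := fun t => if t ∈ I₁ then X₁ t else X₂ t
    refine ⟨X, by simp [X, hr, hX₁], ?_⟩
    rintro t (ht | ht)
    · refine hL X₁ X t (h₁.2.1 ht) ?_ (hL₁ t ht)
      filter_upwards [h₁.2.2.1 t ht] with u hu
      simp [X, hu]
    · refine hL X₂ X t (h₂.2.1 ht) ?_ (hL₂ t ht)
      filter_upwards [h₂.2.2.1 t ht] with u hu
      by_cases hu1 : u ∈ I₁
      · simp [X, hu1, heq u ⟨hu1, hu⟩]
      · simp [X, hu1]
  have glue : ∀ I₁ I₂ s, Good I₁ → Good I₂ → s ∈ I₁ → s ∈ I₂ → Good (I₁ ∪ I₂) := by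
    intro I₁ I₂ s h₁ h₂ hs₁ hs₂
    refine ⟨?_, union_subset h₁.2.1 h₂.2.1, ?_, ?_⟩
    · exact (IsPreconnected.union s hs₁ hs₂ h₁.1.isPreconnected h₂.1.isPreconnected).ordConnected
    · rintro r (hr | hr)
      · exact mem_of_superset (h₁.2.2.1 r hr) subset_union_left
      · exact mem_of_superset (h₂.2.2.1 r hr) subset_union_right
    · rintro r (hr | hr) v
      · exact half I₁ I₂ s h₁ h₂ hs₁ hs₂ r hr v
      · rw [union_comm]
        exact half I₂ I₁ s h₂ h₁ hs₂ hs₁ r hr v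
  have conn : ∀ t ∈ J, ∃ I, Good I ∧ s₀ ∈ I ∧ t ∈ I := by
    intro t ht
    refine hJ.isPreconnected.induction₂ (fun a b => ∃ I, Good I ∧ a ∈ I ∧ b ∈ I) ?_ ?_ ?_ hs₀ ht
    · intro t ht
      obtain ⟨O, hO, hOc, he, -⟩ := hloc t ht
      obtain ⟨ε, hε, hεO⟩ := Metric.mem_nhds_iff.1 hO
      have hb : (Metric.ball t ε).OrdConnected := by
        rw [Real.ball_eq_Ioo]; exact ordConnected_Ioo
      have hsub : Metric.ball t ε ∩ J ⊆ O ∩ J := inter_subset_inter_left _ hεO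
      have hgood : Good (Metric.ball t ε ∩ J) := by
        refine ⟨hb.inter hJ, inter_subset_right, ?_, ?_⟩
        · intro r hr
          rw [inter_comm]
          exact inter_mem_nhdsWithin _ (Metric.isOpen_ball.mem_nhds hr.1)
        · intro r hr v
          obtain ⟨X, h1, h2⟩ := he r (hsub hr) v
          exact ⟨X, h1, fun r hr => h2 r (hsub hr)⟩
      filter_upwards [mem_nhdsWithin_of_mem_nhds (Metric.ball_mem_nhds t hε),
        self_mem_nhdsWithin] with b hb hbJ
      exact ⟨_, hgood, ⟨Metric.mem_ball_self hε, ht⟩, ⟨hb, hbJ⟩⟩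
    · rintro a b c _ _ _ ⟨I₁, h₁, ha, hb⟩ ⟨I₂, h₂, hb', hc⟩
      exact ⟨I₁ ∪ I₂, glue I₁ I₂ b h₁ h₂ hb hb', Or.inl ha, Or.inr hc⟩
    · rintro a b _ _ ⟨I, h, ha, hb⟩
      exact ⟨I, h, hb, ha⟩
  -- Stated for every real `t`, with arbitrary data off `J`, so that the choices are total
  -- functions.
  have sol : ∀ t, ∃ I X, t ∈ J → Good I ∧ s₀ ∈ I ∧ t ∈ I ∧ X s₀ = v ∧ ∀ r ∈ I, L X r := by
    intro t
    by_cases ht : t ∈ J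
    · obtain ⟨I, hI, h0, h1⟩ := conn t ht
      obtain ⟨X, hX, hLX⟩ := hI.2.2.2 s₀ h0 v
      exact ⟨I, X, fun _ => ⟨hI, h0, h1, hX, hLX⟩⟩
    · obtain ⟨I, hI, h0, -⟩ := conn s₀ hs₀
      obtain ⟨X, -⟩ := hI.2.2.2 s₀ h0 v
      exact ⟨∅, X, fun h => absurd h ht⟩
  choose I X h using sol
  -- The diagonal is a solution: near `r` it coincides with the single solution `X r`, by uniqueness
  -- on the intersection of the two good sets, which contains `s₀`.
  refine ⟨fun t => X t t, (h s₀ hs₀).2.2.2.1, fun r hr => ?_⟩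
  obtain ⟨hI, h0, h1, hv, hLr⟩ := h r hr
  refine hL (X r) _ r hr ?_ (hLr r h1)
  filter_upwards [hI.2.2.1 r h1] with t ht
  obtain ⟨hI', h0', h1', hv', hLt⟩ := h t (hI.2.1 ht)
  exact eq_of_locally_unique huniq (hI.1.inter hI'.1) (inter_subset_left.trans hI.2.1)
    (fun r hr => hLr r hr.1) (fun r hr => hLt r hr.2) ⟨h0, h0'⟩ ⟨ht, h1'⟩ (hv.trans hv'.symm)

end Gluing

/-! ### Linear differential equations -/

section LinearODE

variable {E : Type*} [NormedAddCommGroup E] [NormedSpace ℝ E] {J : Set ℝ} {A : ℝ → E →L[ℝ] E}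

/-- Grönwall's inequality on the compact interval between `s₀` and `s`, where `A` is bounded and the
equation therefore uniformly Lipschitz. One-sided derivatives suffice, so endpoints of `J` cause no
trouble; the two cases run forwards and backwards in time. -/
theorem linearODE_unique (hJ : J.OrdConnected) (hA : ContinuousOn A J) {x y : ℝ → E}
    (hx : ∀ s ∈ J, HasDerivWithinAt x (A s (x s)) J s)
    (hy : ∀ s ∈ J, HasDerivWithinAt y (A s (y s)) J s) {s₀ s : ℝ} (hs₀ : s₀ ∈ J) (hs : s ∈ J)
    (h : x s₀ = y s₀) : x s = y s := by
  have hlip : ∀ a b, Icc a b ⊆ J → ∃ K : NNReal, ∀ t ∈ Icc a b,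
      LipschitzOnWith K (fun v => A t v) univ := by
    intro a b hab
    obtain ⟨C, hC⟩ := isCompact_Icc.exists_bound_of_continuousOn (hA.mono hab)
    refine ⟨C.toNNReal, fun t ht => ?_⟩
    exact ((A t).lipschitz.weaken (NNReal.coe_le_coe.1 ((hC t ht).trans
      (Real.le_coe_toNNReal C)))).lipschitzOnWith
  rcases le_total s₀ s with hle | hle
  · have hsub : Icc s₀ s ⊆ J := hJ.out hs₀ hs
    obtain ⟨K, hK⟩ := hlip _ _ hsub
    have hd : ∀ z : ℝ → E, (∀ s ∈ J, HasDerivWithinAt z (A s (z s)) J s) →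
        ∀ t ∈ Ico s₀ s, HasDerivWithinAt z (A t (z t)) (Ici t) t := fun z hz t ht =>
      ((hz t (hsub (Ico_subset_Icc_self ht))).mono hsub).mono_of_mem_nhdsWithin
        (mem_of_superset (Icc_mem_nhdsGE ht.2) (Icc_subset_Icc_left ht.1))
    exact ODE_solution_unique_of_mem_Icc_right (v := fun t v => A t v) (s := fun _ => univ)
      (fun t ht => hK t (Ico_subset_Icc_self ht))
      (fun t ht => ((hx t (hsub ht)).mono hsub).continuousWithinAt) (hd x hx) (fun _ _ => mem_univ _)
      (fun t ht => ((hy t (hsub ht)).mono hsub).continuousWithinAt) (hd y hy) (fun _ _ => mem_univ _)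
      h (right_mem_Icc.2 hle)
  · have hsub : Icc s s₀ ⊆ J := hJ.out hs hs₀
    obtain ⟨K, hK⟩ := hlip _ _ hsub
    have hd : ∀ z : ℝ → E, (∀ s ∈ J, HasDerivWithinAt z (A s (z s)) J s) →
        ∀ t ∈ Ioc s s₀, HasDerivWithinAt z (A t (z t)) (Iic t) t := fun z hz t ht =>
      ((hz t (hsub (Ioc_subset_Icc_self ht))).mono hsub).mono_of_mem_nhdsWithin
        (mem_of_superset (Icc_mem_nhdsLE ht.1) (Icc_subset_Icc_right ht.2))
    exact ODE_solution_unique_of_mem_Icc_left (v := fun t v => A t v) (s := fun _ => univ)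
      (fun t ht => hK t (Ioc_subset_Icc_self ht))
      (fun t ht => ((hx t (hsub ht)).mono hsub).continuousWithinAt) (hd x hx) (fun _ _ => mem_univ _)
      (fun t ht => ((hy t (hsub ht)).mono hsub).continuousWithinAt) (hd y hy) (fun _ _ => mem_univ _)
      h (left_mem_Icc.2 hle)

/-- Solutions of a bounded linear differential equation exist on intervals of a uniform length. -/
theorem exists_linearODE_ball [CompleteSpace E] (hA : Continuous A) {K : NNReal}
    (hK : ∀ t, ‖A t‖ ≤ K) {δ : ℝ} (hδ : 0 ≤ δ) (hKδ : 2 * K * δ ≤ 1) (s₀ : ℝ) (x₀ : E) :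
    ∃ x : ℝ → E, x s₀ = x₀ ∧
      ∀ t ∈ Ioo (s₀ - δ) (s₀ + δ), HasDerivAt x (A t (x t)) t := by
  have hmem : s₀ ∈ Icc (s₀ - δ) (s₀ + δ) := ⟨by linarith, by linarith⟩
  -- On the ball of radius `‖x₀‖` about `x₀` the field is bounded by `2 K ‖x₀‖`. The condition that
  -- solutions stay in this ball is `2 K ‖x₀‖ δ ≤ ‖x₀‖`, which follows from `hKδ` whatever `x₀` is.
  have hpl : IsPicardLindelof (fun t v => A t v) (⟨s₀, hmem⟩ : Icc (s₀ - δ) (s₀ + δ)) x₀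
      ‖x₀‖₊ 0 (2 * K * ‖x₀‖₊) K := by
    refine ⟨fun t _ => ?_, fun v _ => ?_, fun t _ v hv => ?_, ?_⟩
    · exact ((A t).lipschitz.weaken (NNReal.coe_le_coe.1 (hK t))).lipschitzOnWith
    · exact (hA.clm_apply continuous_const).continuousOn
    · have hv' : ‖v‖ ≤ 2 * ‖x₀‖ := by
        have h1 : ‖v - x₀‖ ≤ ‖x₀‖ := by simpa [dist_eq_norm] using hv
        have h2 := norm_le_norm_add_norm_sub' v x₀
        linarith
      calc ‖A t v‖ ≤ ‖A t‖ * ‖v‖ := (A t).le_opNorm v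
        _ ≤ K * (2 * ‖x₀‖) := mul_le_mul (hK t) hv' (norm_nonneg _) K.2
        _ = ((2 * K * ‖x₀‖₊ : NNReal) : ℝ) := by push_cast; ring
    · have : max (s₀ + δ - s₀) (s₀ - (s₀ - δ)) = δ := by simp
      simp only [this]
      push_cast
      nlinarith [norm_nonneg x₀]
  obtain ⟨x, hx0, hx⟩ := hpl.exists_eq_forall_mem_Icc_hasDerivWithinAt
    (x := x₀) (Metric.mem_closedBall_self (by simp))
  exact ⟨x, hx0, fun t ht => (hx t (Ioo_subset_Icc_self ht)).hasDerivAt (Icc_mem_nhds ht.1 ht.2)⟩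

/-- Gives compactness near `t` without leaving `J`: on a side where `J` stops at `t`, the point `t`
itself serves as endpoint. -/
theorem exists_Icc_mem_nhdsWithin (hJ : J.OrdConnected) {t : ℝ} (ht : t ∈ J) :
    ∃ a b, a ≤ b ∧ Icc a b ⊆ J ∧ Icc a b ∈ 𝓝[J] t := by
  obtain ⟨a, ha, hat, hla⟩ : ∃ a ∈ J, a ≤ t ∧ ∀ᶠ s in 𝓝[J] t, a ≤ s := by
    by_cases h : ∃ a ∈ J, a < t
    · obtain ⟨a, ha, hat⟩ := h
      exact ⟨a, ha, hat.le, mem_nhdsWithin_of_mem_nhds (Ici_mem_nhds hat)⟩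
    · push Not at h
      exact ⟨t, ht, le_rfl, eventually_nhdsWithin_of_forall h⟩
  obtain ⟨b, hb, hbt, hlb⟩ : ∃ b ∈ J, t ≤ b ∧ ∀ᶠ s in 𝓝[J] t, s ≤ b := by
    by_cases h : ∃ b ∈ J, t < b
    · obtain ⟨b, hb, hbt⟩ := h
      exact ⟨b, hb, hbt.le, mem_nhdsWithin_of_mem_nhds (Iic_mem_nhds hbt)⟩
    · push Not at h
      exact ⟨t, ht, le_rfl, eventually_nhdsWithin_of_forall h⟩
  exact ⟨a, b, hat.trans hbt, hJ.out ha hb, hla.and hlb⟩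

/-- Linearity makes the local existence time independent of the initial value and uniform near each
parameter. This is the local solvability at every nearby point that the gluing principle requires.
-/
theorem exists_linearODE [CompleteSpace E] (hJ : J.OrdConnected) (hA : ContinuousOn A J)
    {s₀ : ℝ} (hs₀ : s₀ ∈ J) (x₀ : E) :
    ∃ x : ℝ → E, x s₀ = x₀ ∧ ∀ s ∈ J, HasDerivWithinAt x (A s (x s)) J s := by
  refine exists_of_locally_solvable (F := fun _ => E)
    (L := fun x s => HasDerivWithinAt x (A s (x s)) J s) hJ ?_ ?_ hs₀ x₀
  · intro X X' s hs h hX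
    have hs' : X s = X' s := h.self_of_nhdsWithin hs
    rw [← hs']
    exact hX.congr_of_eventuallyEq (h.mono fun _ h => h.symm) hs'.symm
  · intro t ht
    obtain ⟨a, b, hab, hsub, hmem⟩ := exists_Icc_mem_nhdsWithin hJ ht
    -- Constant continuation beyond `a` and `b` yields a bounded continuous coefficient on the whole
    -- line, so no endpoint of `J` interferes with the existence theorem.
    let A' : ℝ → E →L[ℝ] E := IccExtend hab (fun r => A r)
    have hA' : Continuous A' := by
      refine Continuous.Icc_extend' ?_
      exact continuousOn_iff_continuous_domRestrict.1 (hA.mono hsub)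
    have hAA : ∀ r ∈ Icc a b, A' r = A r := fun r hr => IccExtend_of_mem hab _ hr
    obtain ⟨C, hC⟩ := isCompact_Icc.exists_bound_of_continuousOn (hA.mono hsub)
    have hK : ∀ r, ‖A' r‖ ≤ C.toNNReal := by
      intro r
      refine (hC _ (projIcc a b hab r).2).trans (Real.le_coe_toNNReal C)
    obtain ⟨U, hU, hUJ⟩ := mem_nhdsWithin_iff_exists_mem_nhds_inter.1 hmem
    obtain ⟨ε, hε, hεU⟩ := Metric.mem_nhds_iff.1 hU
    -- The factor `2 * δ` is the diameter of the ball used below: a solution started anywhere in it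
    -- has to reach every other of its points.
    obtain ⟨δ, hδ, hδK⟩ : ∃ δ : ℝ, 0 < δ ∧ 2 * (C.toNNReal : ℝ) * (2 * δ) ≤ 1 := by
      have hc : (0 : ℝ) ≤ C.toNNReal := C.toNNReal.2
      refine ⟨1 / (4 * C.toNNReal + 1), by positivity, ?_⟩
      rw [show 2 * (C.toNNReal : ℝ) * (2 * (1 / (4 * C.toNNReal + 1)))
        = 4 * C.toNNReal / (4 * C.toNNReal + 1) by ring, div_le_one (by positivity)]
      linarith
    set η := min ε δ
    have hη : 0 < η := lt_min hε hδ
    refine ⟨Metric.ball t η, Metric.ball_mem_nhds t hη, ?_, ?_, ?_⟩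
    · rw [Real.ball_eq_Ioo]; exact ordConnected_Ioo
    · intro s hs v
      obtain ⟨x, hx0, hx⟩ := exists_linearODE_ball hA' hK (by positivity : 0 ≤ 2 * δ) hδK s v
      refine ⟨x, hx0, fun r hr => ?_⟩
      have hr1 := abs_lt.1 (Real.dist_eq r t ▸ Metric.mem_ball.1 hr.1)
      have hs1 := abs_lt.1 (Real.dist_eq s t ▸ Metric.mem_ball.1 hs.1)
      have hηδ : η ≤ δ := min_le_right _ _
      have hrab : r ∈ Icc a b :=
        hUJ ⟨hεU (Metric.ball_subset_ball (min_le_left _ _) hr.1), hr.2⟩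
      rw [← hAA r hrab]
      exact (hx r ⟨by linarith, by linarith⟩).hasDerivWithinAt
    · intro I hI hIc X X' hX hX' s hs s' hs' h
      have hIJ : I ⊆ J := hI.trans inter_subset_right
      exact linearODE_unique hIc (hA.mono hIJ) (fun r hr => (hX r hr).mono hIJ)
        (fun r hr => (hX' r hr).mono hIJ) hs hs' h

theorem uniqueDiffOn_of_ordConnected (hJ : J.OrdConnected) (hJ' : J.Nontrivial) :
    UniqueDiffOn ℝ J := by
  refine uniqueDiffOn_convex hJ.convex ?_
  obtain ⟨a, ha, b, hb, hab⟩ := hJ'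
  rcases lt_or_gt_of_ne hab with h | h
  · exact (nonempty_Ioo.2 h).mono
      (interior_maximal (Ioo_subset_Icc_self.trans (hJ.out ha hb)) isOpen_Ioo)
  · exact (nonempty_Ioo.2 h).mono
      (interior_maximal (Ioo_subset_Icc_self.trans (hJ.out hb ha)) isOpen_Ioo)

theorem contDiffOn_succ_of_hasDerivWithinAt (hJ : UniqueDiffOn ℝ J) {m : ℕ∞} {x x' : ℝ → E}
    (hx : ∀ s ∈ J, HasDerivWithinAt x (x' s) J s) (hx' : ContDiffOn ℝ (m : ℕ∞ω) x' J) :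
    ContDiffOn ℝ ((m : ℕ∞ω) + 1) x J := by
  rw [contDiffOn_succ_iff_derivWithin hJ]
  refine ⟨fun s hs => (hx s hs).differentiableWithinAt, by simp, ?_⟩
  exact hx'.congr fun s hs => (hx s hs).derivWithin (hJ s hs)

/-- Bootstrapping: if `x` is of class `C^j` with `j ≤ m`, then so is `x' = A x`, and `x` gains one
order. The infinite case follows from all the finite ones. -/
theorem linearODE_contDiffOn (hJ : UniqueDiffOn ℝ J) {m : ℕ∞}
    (hA : ContDiffOn ℝ (m : ℕ∞ω) A J) {x : ℝ → E}
    (hx : ∀ s ∈ J, HasDerivWithinAt x (A s (x s)) J s) :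
    ContDiffOn ℝ ((m : ℕ∞ω) + 1) x J := by
  have hnat : ∀ j : ℕ, (j : ℕ∞) ≤ m → ContDiffOn ℝ (((j : ℕ∞) : ℕ∞ω) + 1) x J := by
    intro j
    induction j with
    | zero =>
      intro _
      refine contDiffOn_succ_of_hasDerivWithinAt hJ hx ?_
      have hc : ContinuousOn x J := fun s hs => (hx s hs).continuousWithinAt
      simpa using hA.continuousOn.clm_apply hc
    | succ j ih =>
      intro hj
      have hj' : (j : ℕ∞) ≤ m := le_trans (by exact_mod_cast Nat.le_succ j) hj
      refine contDiffOn_succ_of_hasDerivWithinAt hJ hx ?_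
      refine (hA.of_le (by exact_mod_cast hj)).clm_apply ?_
      simpa using ih hj'
  induction m using ENat.recTopCoe with
  | top =>
    have : ContDiffOn ℝ ((⊤ : ℕ∞) : ℕ∞ω) x J := by
      rw [contDiffOn_infty]
      intro j
      exact (hnat j le_top).of_le (by simp)
    exact this.of_le (by simp)
  | coe j => exact hnat j le_rfl

end LinearODE

/-! ### Extension of differentiable functions across the end of an interval -/

section Borel

variable {E : Type*} [NormedAddCommGroup E] [NormedSpace ℝ E]

theorem iteratedDeriv_pow_smul_zero (m j : ℕ) (a : E) :
    iteratedDeriv m (fun y : ℝ => (y ^ j / (j.factorial : ℝ)) • a) 0 = if j = m then a else 0 := by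
  have h1 : ContDiffAt ℝ m (fun y : ℝ => y ^ j / (j.factorial : ℝ)) 0 := by fun_prop
  rw [iteratedDeriv_smul_const h1]
  have h2 : (fun y : ℝ => y ^ j / (j.factorial : ℝ)) =
      fun y => ((j.factorial : ℝ))⁻¹ * y ^ j := by
    ext y; ring
  rw [h2, iteratedDeriv_const_mul_field, iteratedDeriv_pow]
  split_ifs with h
  · subst h
    simp [Nat.descFactorial_self, Nat.factorial_ne_zero]
  · rcases lt_or_gt_of_ne h with h | h
    · simp [Nat.descFactorial_of_lt h]
    · simp [Nat.sub_ne_zero_of_lt h]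

theorem iteratedDeriv_scale {h : ℝ → E} (hh : ContDiff ℝ ∞ h) (l : ℝ) (c : ℝ) (m : ℕ) (x : ℝ) :
    iteratedDeriv m (fun x => c • h (l * x)) x = (c * l ^ m) • iteratedDeriv m h (l * x) := by
  have h1 : ContDiff ℝ m h := hh.of_le (by exact_mod_cast le_top)
  rw [iteratedDeriv_fun_const_smul_field, iteratedDeriv_comp_const_smul h1 l, smul_smul]

/-- **Borel's lemma**: every sequence is the sequence of derivatives at a point of a smooth
function. -/
theorem exists_contDiff_iteratedDeriv_eq [CompleteSpace E] (a : ℕ → E) :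
    ∃ g : ℝ → E, ContDiff ℝ ∞ g ∧ ∀ m, iteratedDeriv m g 0 = a m := by
  let χ : ContDiffBump (0 : ℝ) := ⟨1, 2, one_pos, one_lt_two⟩
  -- Cut-off Taylor monomials: the only nonzero derivative at `0` is the `j`-th, equal to `a j`,
  -- while compact support bounds every derivative.
  let h : ℕ → ℝ → E := fun j y => χ y • ((y ^ j / (j.factorial : ℝ)) • a j)
  have hsm : ∀ j, ContDiff ℝ ∞ (h j) := fun j =>
    χ.contDiff.smul (((contDiff_id.pow j).div_const _).smul contDiff_const)
  have hsupp : ∀ j, HasCompactSupport (h j) := fun j => χ.hasCompactSupport.smul_right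
  have hzero : ∀ m j, iteratedDeriv m (h j) 0 = if j = m then a j else 0 := by
    intro m j
    rw [← iteratedDeriv_pow_smul_zero]
    refine Filter.EventuallyEq.iteratedDeriv_eq m ?_
    filter_upwards [χ.eventuallyEq_one] with y hy
    simp [h, hy]
  have hbd : ∀ m j, ∃ C : ℝ, 0 ≤ C ∧ ∀ x, ‖iteratedDeriv m (h j) x‖ ≤ C := by
    intro m j
    have hc : Continuous (iteratedFDeriv ℝ m (h j)) :=
      (hsm j).continuous_iteratedFDeriv (by exact_mod_cast le_top)
    obtain ⟨C, hC⟩ := ((hsupp j).iteratedFDeriv m).exists_bound_of_continuous hc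
    refine ⟨C, (norm_nonneg _).trans (hC 0), fun x => ?_⟩
    rw [← norm_iteratedFDeriv_eq_norm_iteratedDeriv]
    exact hC x
  choose C hC0 hC using hbd
  -- Large enough that the shrunken `j`-th term below has all derivatives of order less than `j`
  -- bounded by `2^(-j)`.
  let l : ℕ → ℝ := fun j => 1 + 2 ^ j * ∑ m ∈ Finset.range j, C m j
  have hl1 : ∀ j, 1 ≤ l j := fun j => by
    have : 0 ≤ ∑ m ∈ Finset.range j, C m j := Finset.sum_nonneg fun m _ => hC0 m j
    simp only [l, le_add_iff_nonneg_right]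
    positivity
  have hl0 : ∀ j, 0 < l j := fun j => zero_lt_one.trans_le (hl1 j)
  -- Rescaling multiplies the `m`-th derivative by `l^(m-j)`: the jet at `0` is unchanged, and
  -- orders below `j` become small.
  let g : ℕ → ℝ → E := fun j x => ((l j)⁻¹ ^ j) • h j (l j * x)
  have hg : ∀ j, ContDiff ℝ ∞ (g j) := fun j =>
    contDiff_const.smul ((hsm j).comp (contDiff_const.mul contDiff_id))
  have hgd : ∀ m j x, iteratedDeriv m (g j) x =
      ((l j)⁻¹ ^ j * l j ^ m) • iteratedDeriv m (h j) (l j * x) := fun m j x =>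
    iteratedDeriv_scale (hsm j) _ _ m x
  -- For a fixed order `m`, the finitely many terms with `j ≤ m` get their crude bound; all the
  -- others are dominated by a geometric series.
  let v : ℕ → ℕ → ℝ := fun m j =>
    (if j ∈ Finset.range (m + 1) then (l j)⁻¹ ^ j * l j ^ m * C m j else 0) + (1 / 2) ^ j
  have hv : ∀ m, Summable (v m) := fun m => by
    refine Summable.add ?_ summable_geometric_two
    refine summable_of_ne_finset_zero (s := Finset.range (m + 1)) fun j hj => ?_
    simp only [if_neg hj]
  have hgv : ∀ m j x, ‖iteratedFDeriv ℝ m (g j) x‖ ≤ v m j := by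
    intro m j x
    rw [norm_iteratedFDeriv_eq_norm_iteratedDeriv, hgd, norm_smul, Real.norm_of_nonneg
      (by have := hl0 j; positivity)]
    have hp := hl0 j
    have h1 : (l j)⁻¹ ^ j * l j ^ m * ‖iteratedDeriv m (h j) (l j * x)‖ ≤
        (l j)⁻¹ ^ j * l j ^ m * C m j :=
      mul_le_mul_of_nonneg_left (hC m j _) (by positivity)
    refine h1.trans ?_
    simp only [v]
    split_ifs with hj
    · have : (0 : ℝ) ≤ (1 / 2) ^ j := by positivity
      linarith
    · have hmj : m < j := by simpa [Nat.lt_succ_iff] using hj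
      rw [zero_add]
      have h2 : (l j)⁻¹ ^ j * l j ^ m ≤ (l j)⁻¹ := by
        obtain ⟨d, rfl⟩ := Nat.exists_eq_add_of_lt hmj
        rw [show m + d + 1 = m + (d + 1) by ring, pow_add, mul_right_comm, ← mul_pow,
          inv_mul_cancel₀ (by rw [← show m + d + 1 = m + (d + 1) by ring]; exact hp.ne'),
          one_pow, one_mul, pow_succ]
        refine mul_le_of_le_one_left (inv_nonneg.2 ?_) (pow_le_one₀ (inv_nonneg.2 ?_)
          (inv_le_one_of_one_le₀ ?_))
        · exact hp.le
        · exact hp.le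
        · exact hl1 _
      have h3 : 2 ^ j * C m j ≤ l j := by
        have : C m j ≤ ∑ m ∈ Finset.range j, C m j :=
          Finset.single_le_sum (f := fun m => C m j) (fun m _ => hC0 m j)
            (Finset.mem_range.2 hmj)
        have h4 : (2 : ℝ) ^ j * C m j ≤ 2 ^ j * ∑ m ∈ Finset.range j, C m j :=
          mul_le_mul_of_nonneg_left this (by positivity)
        simp only [l]
        linarith
      calc (l j)⁻¹ ^ j * l j ^ m * C m j ≤ (l j)⁻¹ * C m j :=
            mul_le_mul_of_nonneg_right h2 (hC0 m j)
        _ ≤ (1 / 2) ^ j := by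
            rw [inv_mul_le_iff₀ hp, one_div, inv_pow, mul_comm, ← div_eq_inv_mul,
              le_div_iff₀ (by positivity)]
            linarith
  refine ⟨fun x => ∑' j, g j x, ?_, fun m => ?_⟩
  · exact contDiff_tsum (N := ⊤) hg (fun m _ => hv m) (fun m j x _ => hgv m j x)
  · rw [iteratedDeriv_eq_iteratedFDeriv, iteratedFDeriv_tsum_apply (N := ⊤) hg (fun m _ => hv m)
      (fun m j x _ => hgv m j x) le_top]
    have hsum : Summable fun j => iteratedFDeriv ℝ m (g j) 0 :=
      .of_norm_bounded (hv m) fun j => hgv m j 0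
    have : (∑' j, iteratedFDeriv ℝ m (g j) 0) (fun _ => (1 : ℝ)) =
        ∑' j, iteratedFDeriv ℝ m (g j) 0 (fun _ => (1 : ℝ)) :=
      (ContinuousMultilinearMap.apply ℝ (fun _ : Fin m => ℝ) E (fun _ => (1 : ℝ))).map_tsum hsum
    rw [this]
    have hterm : ∀ j, iteratedFDeriv ℝ m (g j) 0 (fun _ => (1 : ℝ)) =
        if j = m then a j else 0 := by
      intro j
      rw [← iteratedDeriv_eq_iteratedFDeriv, hgd, mul_zero, hzero]
      split_ifs with hj
      · subst hj
        rw [← mul_pow, inv_mul_cancel₀ (hl0 j).ne', one_pow, one_smul]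
      · simp
    simp_rw [hterm]
    simp

/-- Only the joint `a` needs an argument: there the left derivative comes from `g` and the right one
from `f`, and the matching of values and derivatives makes them one two-sided derivative. -/
theorem hasDerivWithinAt_piecewise {a b : ℝ} (hab : a < b) {f g f' g' : ℝ → E}
    (hf : ∀ s ∈ Ico a b, HasDerivWithinAt f (f' s) (Ico a b) s)
    (hg : ∀ s, HasDerivAt g (g' s) s) (h0 : f a = g a) (h1 : f' a = g' a) {s : ℝ} (hs : s < b) :
    HasDerivAt (fun t => if t < a then g t else f t) (if s < a then g' s else f' s) s := by
  rcases lt_trichotomy s a with h | h | h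
  · rw [if_pos h]
    refine (hg s).congr_of_eventuallyEq ?_
    filter_upwards [Iio_mem_nhds h] with t ht
    exact if_pos ht
  · subst h
    rw [if_neg (lt_irrefl _)]
    have hl : HasDerivWithinAt (fun t => if t < s then g t else f t) (f' s) (Iic s) s := by
      rw [h1]
      refine (hg s).hasDerivWithinAt.congr (fun t ht => ?_) (by simp [h0])
      rcases lt_or_eq_of_le (show t ≤ s from ht) with h | h
      · exact if_pos h
      · simp [h, h0]
    have hr : HasDerivWithinAt (fun t => if t < s then g t else f t) (f' s) (Ico s b) s := by
      refine (hf s ⟨le_rfl, hs⟩).congr (fun t ht => if_neg ht.1.not_gt) (by simp)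
    have := hl.union hr
    refine this.hasDerivAt ?_
    filter_upwards [Iio_mem_nhds hs] with t ht
    rcases le_total t s with h | h
    · exact Or.inl h
    · exact Or.inr ⟨h, ht⟩
  · rw [if_neg h.not_gt]
    refine ((hf s ⟨h.le, hs⟩).hasDerivAt (Ico_mem_nhds h hs)).congr_of_eventuallyEq ?_
    filter_upwards [Ioi_mem_nhds h] with t ht
    exact if_neg (not_lt.2 (le_of_lt ht))

/-- Induction on the order: the derivative of the pieced function is the pieced function of the
derivatives, whose jets at `a` match to one order less. -/
theorem contDiffOn_piecewise_nat {a b : ℝ} (hab : a < b) (m : ℕ) {f g : ℝ → E}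
    (hf : ContDiffOn ℝ m f (Ico a b)) (hg : ContDiff ℝ ∞ g)
    (h : ∀ j ≤ m, iteratedDeriv j g a = iteratedDerivWithin j f (Ico a b) a) :
    ContDiffOn ℝ m (fun t => if t < a then g t else f t) (Iio b) := by
  have hu : UniqueDiffOn ℝ (Ico a b) := uniqueDiffOn_Ico a b
  induction m generalizing f g with
  | zero =>
    have h0 : g a = f a := by simpa using h 0 le_rfl
    simp only [Nat.cast_zero, contDiffOn_zero] at hf ⊢
    have hcl : ContinuousOn (fun t => if t < a then g t else f t) (Iic a) := by
      refine hg.continuous.continuousOn.congr fun t ht => ?_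
      rcases lt_or_eq_of_le (show t ≤ a from ht) with h | h
      · exact if_pos h
      · simp [h, h0]
    have hcr : ContinuousOn (fun t => if t < a then g t else f t) (Ico a b) :=
      hf.congr fun t ht => if_neg ht.1.not_gt
    intro t ht
    have hmem : Iio b ∈ 𝓝 t := Iio_mem_nhds ht
    refine ContinuousAt.continuousWithinAt ?_
    rcases lt_trichotomy t a with h | h | h
    · exact hcl.continuousAt (Iic_mem_nhds h)
    · subst h
      have := (hcl t self_mem_Iic).union (hcr t ⟨le_rfl, ht⟩)
      refine this.continuousAt ?_
      filter_upwards [hmem] with s hs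
      rcases le_total s t with h | h
      · exact Or.inl h
      · exact Or.inr ⟨h, hs⟩
    · exact hcr.continuousAt (Ico_mem_nhds h ht)
  | succ m ih =>
    have h0 : g a = f a := by simpa using h 0 (Nat.zero_le _)
    have hd := (contDiffOn_succ_iff_derivWithin (n := m) (f := f) hu).1 (by exact_mod_cast hf)
    have hgd : ContDiff ℝ ∞ (deriv g) := ((contDiff_infty_iff_deriv).1 hg).2
    have hder : ∀ j ≤ m, iteratedDeriv j (deriv g) a =
        iteratedDerivWithin j (derivWithin f (Ico a b)) (Ico a b) a := by
      intro j hj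
      rw [← iteratedDeriv_succ', ← iteratedDerivWithin_succ']
      exact h (j + 1) (by omega)
    have hP : ∀ s ∈ Iio b, HasDerivAt (fun t => if t < a then g t else f t)
        (if s < a then deriv g s else derivWithin f (Ico a b) s) s := fun s hs => by
      refine hasDerivWithinAt_piecewise hab (fun s hs => (hd.1 s hs).hasDerivWithinAt)
        (fun s => (hg.differentiable (by simp) s).hasDerivAt) h0.symm ?_ hs
      simpa using (hder 0 (Nat.zero_le _)).symm
    have := (contDiffOn_succ_iff_deriv_of_isOpen (n := m) (𝕜 := ℝ)
      (f := fun t => if t < a then g t else f t) (isOpen_Iio (a := b))).2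
      ⟨fun s hs => (hP s hs).differentiableAt.differentiableWithinAt, by simp, ?_⟩
    · exact_mod_cast this
    · exact (ih hd.2.2 hgd hder).congr fun s hs => (hP s hs).deriv

/-- Borel's lemma supplies a smooth function with the one-sided jet of `f` at `a`. The same function
works for every finite order up to `m`, hence also for `m = ∞`. -/
theorem exists_contDiffOn_extension_left [CompleteSpace E] {a b : ℝ} (hab : a < b) {m : ℕ∞}
    {f : ℝ → E} (hf : ContDiffOn ℝ (m : ℕ∞ω) f (Ico a b)) :
    ∃ F : ℝ → E, ContDiffOn ℝ (m : ℕ∞ω) F (Iio b) ∧ ∀ t ∈ Ico a b, F t = f t := by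
  obtain ⟨g₀, hg₀, hg₀'⟩ := exists_contDiff_iteratedDeriv_eq
    (fun j => iteratedDerivWithin j f (Ico a b) a)
  let g : ℝ → E := fun t => g₀ (t - a)
  have hg : ContDiff ℝ ∞ g := hg₀.comp (contDiff_id.sub contDiff_const)
  have hj : ∀ j, iteratedDeriv j g a = iteratedDerivWithin j f (Ico a b) a := by
    intro j
    have := congrFun (iteratedDeriv_comp_sub_const j g₀ a) a
    rw [show g = fun t => g₀ (t - a) from rfl, this, sub_self, hg₀']
  refine ⟨fun t => if t < a then g t else f t, ?_, fun t ht => if_neg ht.1.not_gt⟩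
  rw [contDiffOn_iff_forall_nat_le]
  intro j hjm
  exact contDiffOn_piecewise_nat hab j (hf.of_le (by exact_mod_cast hjm)) hg fun i _ => hj i

/-- A function of class `C^m` on an interval is, near each point of the interval, the restriction
of a function which is of class `C^m` near this point. -/
theorem exists_contDiffAt_extension [CompleteSpace E] {J : Set ℝ} (hJ : J.OrdConnected)
    (hJ' : J.Nontrivial) {s₀ : ℝ} (hs₀ : s₀ ∈ J) {m : ℕ∞} {f : ℝ → E}
    (hf : ContDiffOn ℝ (m : ℕ∞ω) f J) :
    ∃ F : ℝ → E, (∃ U ∈ 𝓝 s₀, IsOpen U ∧ ContDiffOn ℝ (m : ℕ∞ω) F U) ∧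
      ∀ᶠ t in 𝓝[J] s₀, F t = f t := by
  by_cases hl : ∃ a ∈ J, a < s₀
  · obtain ⟨a, ha, has⟩ := hl
    by_cases hr : ∃ b ∈ J, s₀ < b
    · obtain ⟨b, hb, hbs⟩ := hr
      exact ⟨f, ⟨Ioo a b, Ioo_mem_nhds has hbs, isOpen_Ioo,
        hf.mono (Ioo_subset_Icc_self.trans (hJ.out ha hb))⟩, Eventually.of_forall fun _ => rfl⟩
    · push Not at hr
      have hsub : Ioc a s₀ ⊆ J := Ioc_subset_Icc_self.trans (hJ.out ha hs₀)
      -- A right endpoint is reduced to a left one by the reflection `t ↦ -t`.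
      have hneg : ContDiffOn ℝ (m : ℕ∞ω) (fun t => f (-t)) (Ico (-s₀) (-a)) :=
        hf.comp contDiff_neg.contDiffOn fun t ht =>
          hsub ⟨by linarith [ht.2], by linarith [ht.1]⟩
      obtain ⟨F, hF, hFf⟩ := exists_contDiffOn_extension_left (neg_lt_neg has) hneg
      refine ⟨fun t => F (-t), ⟨Ioi a, Ioi_mem_nhds has, isOpen_Ioi, ?_⟩, ?_⟩
      · exact hF.comp contDiff_neg.contDiffOn fun t ht => mem_Iio.2 (neg_lt_neg ht)
      · filter_upwards [self_mem_nhdsWithin, mem_nhdsWithin_of_mem_nhds (Ioi_mem_nhds has)]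
          with t ht hta
        have hta' : a < t := hta
        rw [hFf _ ⟨neg_le_neg (hr t ht), neg_lt_neg hta'⟩, neg_neg]
  · push Not at hl
    obtain ⟨b, hb, hbs⟩ : ∃ b ∈ J, s₀ < b := by
      obtain ⟨b, hb, hne⟩ := hJ'.exists_ne s₀
      exact ⟨b, hb, lt_of_le_of_ne (hl b hb) hne.symm⟩
    obtain ⟨F, hF, hFf⟩ := exists_contDiffOn_extension_left hbs
      (hf.mono (Ico_subset_Icc_self.trans (hJ.out hs₀ hb)))
    refine ⟨F, ⟨Iio b, Iio_mem_nhds hbs, isOpen_Iio, hF⟩, ?_⟩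
    filter_upwards [self_mem_nhdsWithin, mem_nhdsWithin_of_mem_nhds (Iio_mem_nhds hbs)]
      with t ht htb
    exact hFf t ⟨hl t ht, htb⟩

end Borel

/-! ### Differentiability of fields along a path -/

section Paths

variable {n : ℕ} {k : ℕ∞} {M : Type*} [TopologicalSpace M]
  [ChartedSpace (EuclideanSpace ℝ (Fin n)) M]

theorem CPath.uniqueDiffOn (γ : CPath n k M) : UniqueDiffOn ℝ γ.J :=
  uniqueDiffOn_of_ordConnected γ.ordConnected γ.nontrivial

theorem CPath.eventually_mem (γ : CPath n k M) {s : ℝ} (hs : s ∈ γ.J) {U : Set M}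
    (hU : U ∈ 𝓝 (γ.toFun s)) : ∀ᶠ t in 𝓝[γ.J] s, γ.toFun t ∈ U :=
  (γ.contMDiffOn.continuousOn s hs) hU

theorem CPath.eventually_mem_source (γ : CPath n k M) {s : ℝ} (hs : s ∈ γ.J) {x₀ : M}
    (h : γ.toFun s ∈ (chartAt (EuclideanSpace ℝ (Fin n)) x₀).source) :
    ∀ᶠ t in 𝓝[γ.J] s, γ.toFun t ∈ (chartAt (EuclideanSpace ℝ (Fin n)) x₀).source :=
  γ.eventually_mem hs ((chartAt _ x₀).open_source.mem_nhds h)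

theorem finrank_tan (x : M) : Module.finrank ℝ (Tan n x) = n :=
  finrank_euclideanSpace_fin (𝕜 := ℝ) (n := n)

end Paths

section Fields

variable {n : ℕ} {k : ℕ∞} {M : Type*} [TopologicalSpace M]
  [ChartedSpace (EuclideanSpace ℝ (Fin n)) M] [IsManifold (𝓡 n) 1 M]

/-- The components of tangent vectors at `y` in the preferred chart at `x₀`. -/
def toModel (x₀ y : M) : Tan n y →L[ℝ] EuclideanSpace ℝ (Fin n) :=
  (trivializationAt (EuclideanSpace ℝ (Fin n)) (TangentSpace (𝓡 n)) x₀).continuousLinearMapAt ℝ y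

/-- The tangent vector at `y` with given components in the preferred chart at `x₀`. -/
def ofModel (x₀ y : M) : EuclideanSpace ℝ (Fin n) →L[ℝ] Tan n y :=
  (trivializationAt (EuclideanSpace ℝ (Fin n)) (TangentSpace (𝓡 n)) x₀).symmL ℝ y

theorem toModel_ofModel {x₀ y : M} (hy : y ∈ (chartAt (EuclideanSpace ℝ (Fin n)) x₀).source)
    (c : EuclideanSpace ℝ (Fin n)) : toModel x₀ y (ofModel x₀ y c) = c :=
  Trivialization.continuousLinearMapAt_symmL _ hy c

theorem ofModel_toModel {x₀ y : M} (hy : y ∈ (chartAt (EuclideanSpace ℝ (Fin n)) x₀).source)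
    (v : Tan n y) : ofModel x₀ y (toModel x₀ y v) = v :=
  Trivialization.symmL_continuousLinearMapAt _ hy v

theorem toModel_eq_snd {x₀ y : M} (hy : y ∈ (chartAt (EuclideanSpace ℝ (Fin n)) x₀).source)
    (v : Tan n y) : toModel x₀ y v =
      (trivializationAt (EuclideanSpace ℝ (Fin n)) (TangentSpace (𝓡 n)) x₀ ⟨y, v⟩).2 :=
  Trivialization.continuousLinearMapAt_apply_of_mem ℝ
    (trivializationAt (EuclideanSpace ℝ (Fin n)) (TangentSpace (𝓡 n)) x₀) hy v

theorem contMDiffVectorBundle_tangent [IsManifold (𝓡 n) ((k : ℕ∞ω) + 2) M] {m : ℕ∞ω}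
    (hm : m ≤ (k : ℕ∞ω) + 1) :
    ContMDiffVectorBundle m (EuclideanSpace ℝ (Fin n)) (TangentSpace (𝓡 n) : M → Type _) (𝓡 n) := by
  have h2 : (k : ℕ∞ω) + 2 = ((k : ℕ∞ω) + 1) + 1 := by rw [add_assoc]; norm_num
  have : IsManifold (𝓡 n) (((k : ℕ∞ω) + 1) + 1) M := h2 ▸ inferInstance
  have := TangentBundle.contMDiffVectorBundle (n := (k : ℕ∞ω) + 1) (I := 𝓡 n) (M := M)
  exact ContMDiffVectorBundle.of_le hm

/-- The vector field `X` along `γ` is of class `C^m` at the parameter `s`. -/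
def IsClassVecAt {γ : CPath n k M} (m : ℕ∞ω) (X : VectorField γ) (s : ℝ) : Prop :=
  ContMDiffWithinAt 𝓘(ℝ, ℝ) (𝓡 n).tangent m
    (fun s => (⟨γ.toFun s, X s⟩ : TangentBundle (𝓡 n) M)) γ.J s

variable {γ : CPath n k M} {m : ℕ∞ω}

theorem IsClassVecAt.congr {X Y : VectorField γ} {s : ℝ} (hX : IsClassVecAt m X s)
    (hs : s ∈ γ.J) (h : ∀ᶠ t in 𝓝[γ.J] s, Y t = X t) : IsClassVecAt m Y s := by
  refine ContMDiffWithinAt.congr_of_eventuallyEq hX ?_ ?_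
  · filter_upwards [h] with t ht
    rw [ht]
  · simp only [h.self_of_nhdsWithin hs]

theorem IsClassVec.at {X : VectorField γ} (hX : IsClassVec m X) {s : ℝ} (hs : s ∈ γ.J) :
    IsClassVecAt m X s := hX s hs

theorem IsClassVec.of_le {m' : ℕ∞ω} {X : VectorField γ} (hX : IsClassVec m X) (h : m' ≤ m) :
    IsClassVec m' X := ContMDiffOn.of_le hX h

section

variable [IsManifold (𝓡 n) ((k : ℕ∞ω) + 2) M]

/-- The base component of the map into the tangent bundle is the path, already of class `C^(k+1)`,
so only the fibre components matter. The bound on `m` is the class of the tangent bundle of a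
`C^(k+2)` manifold. -/
theorem isClassVecAt_iff (hm : m ≤ (k : ℕ∞ω) + 1) {X : VectorField γ} {s : ℝ} (hs : s ∈ γ.J)
    {x₀ : M} (h : γ.toFun s ∈ (chartAt (EuclideanSpace ℝ (Fin n)) x₀).source) :
    IsClassVecAt m X s ↔
      ContDiffWithinAt ℝ m (fun t => toModel x₀ (γ.toFun t) (X t)) γ.J s := by
  have := contMDiffVectorBundle_tangent (M := M) (n := n) hm
  have h1 : ContMDiffWithinAt 𝓘(ℝ, ℝ) (𝓡 n) m γ.toFun γ.J s := (γ.contMDiffOn s hs).of_le hm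
  unfold IsClassVecAt
  rw [Trivialization.contMDiffWithinAt_iff (IB := 𝓡 n)
    (e := trivializationAt (EuclideanSpace ℝ (Fin n)) (TangentSpace (𝓡 n)) x₀)
    (f := fun t => (⟨γ.toFun t, X t⟩ : TangentBundle (𝓡 n) M))
    ((Trivialization.mem_source _).2 h), ← contMDiffWithinAt_iff_contDiffWithinAt]
  have heq : ∀ᶠ t in 𝓝[γ.J] s, toModel x₀ (γ.toFun t) (X t) =
      (trivializationAt (EuclideanSpace ℝ (Fin n)) (TangentSpace (𝓡 n)) x₀ ⟨γ.toFun t, X t⟩).2 := by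
    filter_upwards [γ.eventually_mem_source hs h] with t ht
    exact toModel_eq_snd ht _
  constructor
  · rintro ⟨-, h2⟩
    exact h2.congr_of_eventuallyEq heq (heq.self_of_nhdsWithin hs)
  · intro h2
    exact ⟨h1, h2.congr_of_eventuallyEq (heq.mono fun _ h => h.symm)
      (heq.self_of_nhdsWithin hs).symm⟩

theorem IsClassVecAt.smul (hm : m ≤ (k : ℕ∞ω) + 1) {f : ℝ → ℝ} {X : VectorField γ} {s : ℝ}
    (hs : s ∈ γ.J) (hf : ContDiffWithinAt ℝ m f γ.J s) (hX : IsClassVecAt m X s) :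
    IsClassVecAt m (fun t => f t • X t) s := by
  rw [isClassVecAt_iff hm hs (mem_chart_source _ (γ.toFun s))] at hX ⊢
  simpa using! hf.smul hX

theorem isClassVecAt_zero (hm : m ≤ (k : ℕ∞ω) + 1) {s : ℝ} (hs : s ∈ γ.J) :
    IsClassVecAt (γ := γ) m (fun _ => 0) s := by
  rw [isClassVecAt_iff hm hs (mem_chart_source _ (γ.toFun s))]
  simpa using contDiffWithinAt_const

theorem IsClassVecAt.sum (hm : m ≤ (k : ℕ∞ω) + 1) {ι : Type*} (S : Finset ι)
    {X : ι → VectorField γ} {s : ℝ} (hs : s ∈ γ.J) (hX : ∀ i ∈ S, IsClassVecAt m (X i) s) :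
    IsClassVecAt m (fun t => ∑ i ∈ S, X i t) s := by
  have h := fun i hi => (isClassVecAt_iff hm hs (mem_chart_source _ (γ.toFun s))).1 (hX i hi)
  rw [isClassVecAt_iff hm hs (mem_chart_source _ (γ.toFun s))]
  simpa using ContDiffWithinAt.sum h

theorem IsClassVec.smul (hm : m ≤ (k : ℕ∞ω) + 1) {f : ℝ → ℝ} {X : VectorField γ}
    (hf : ContDiffOn ℝ m f γ.J) (hX : IsClassVec m X) : IsClassVec m (fun t => f t • X t) :=
  fun s hs => (hX.at hs).smul hm hs (hf s hs)

theorem IsClassVec.const_smul (hm : m ≤ (k : ℕ∞ω) + 1) (c : ℝ) {X : VectorField γ}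
    (hX : IsClassVec m X) : IsClassVec m (fun t => c • X t) :=
  hX.smul hm contDiffOn_const

theorem IsClassVec.sum (hm : m ≤ (k : ℕ∞ω) + 1) {ι : Type*} (S : Finset ι)
    {X : ι → VectorField γ} (hX : ∀ i ∈ S, IsClassVec m (X i)) :
    IsClassVec m (fun t => ∑ i ∈ S, X i t) :=
  fun _ hs => IsClassVecAt.sum hm S hs fun i hi => (hX i hi).at hs

end

/-- A smooth cut-off function. -/
theorem exists_bump {s : ℝ} {O : Set ℝ} (hO : O ∈ 𝓝 s) :
    ∃ f : ℝ → ℝ, ContDiff ℝ ∞ f ∧ (∀ᶠ t in 𝓝 s, f t = 1) ∧ tsupport f ⊆ O := by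
  obtain ⟨ε, hε, hεO⟩ := Metric.nhds_basis_closedBall.mem_iff.1 hO
  let χ : ContDiffBump s := ⟨ε / 2, ε, by positivity, by linarith⟩
  refine ⟨χ, χ.contDiff, χ.eventuallyEq_one, ?_⟩
  rw [χ.tsupport_eq]
  exact hεO

theorem exists_bump_nhdsWithin {J : Set ℝ} {s : ℝ} {p : ℝ → Prop} (h : ∀ᶠ t in 𝓝[J] s, p t) :
    ∃ f : ℝ → ℝ, ContDiff ℝ ∞ f ∧ (∀ᶠ t in 𝓝 s, f t = 1) ∧ ∀ t ∈ J, t ∈ tsupport f → p t := by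
  obtain ⟨O, hO, hOJ⟩ := mem_nhdsWithin_iff_exists_mem_nhds_inter.1 h
  obtain ⟨f, h1, h2, h3⟩ := exists_bump hO
  exact ⟨f, h1, h2, fun t ht htf => hOJ ⟨h3 htf, ht⟩⟩

theorem add_one_le_infty (k : ℕ∞) : (k : ℕ∞ω) + 1 ≤ ∞ := by
  have : ((k + 1 : ℕ∞) : ℕ∞ω) ≤ ((⊤ : ℕ∞) : ℕ∞ω) := by exact_mod_cast le_top
  simpa using this

/-- Off the support of the cut-off the product vanishes locally, so nothing is asked of `g` there.
-/
theorem contDiffOn_mul_of_tsupport {J : Set ℝ} (hm : m ≤ ∞) {f g : ℝ → ℝ}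
    (hf : ContDiff ℝ ∞ f) (hg : ∀ t ∈ J, t ∈ tsupport f → ContDiffWithinAt ℝ m g J t) :
    ContDiffOn ℝ m (fun t => f t * g t) J := by
  intro t ht
  by_cases h : t ∈ tsupport f
  · exact (hf.of_le hm).contDiffWithinAt.mul (hg t ht h)
  · have h0 := notMem_tsupport_iff_eventuallyEq.1 h
    refine (contDiffWithinAt_const (c := (0 : ℝ))).congr_of_eventuallyEq ?_ ?_
    · filter_upwards [mem_nhdsWithin_of_mem_nhds h0] with u hu
      simp [show f u = 0 from hu]
    · simp [show f t = 0 from h0.self_of_nhds]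

variable [IsManifold (𝓡 n) ((k : ℕ∞ω) + 2) M]

theorem isClassVec_smul_of_tsupport (hm : m ≤ (k : ℕ∞ω) + 1) {f : ℝ → ℝ} {X : VectorField γ}
    (hf : ContDiff ℝ ∞ f) (hX : ∀ t ∈ γ.J, t ∈ tsupport f → IsClassVecAt m X t) :
    IsClassVec m (fun t => f t • X t) := by
  have hm' : m ≤ ∞ := hm.trans (add_one_le_infty k)
  intro t ht
  by_cases h : t ∈ tsupport f
  · exact IsClassVecAt.smul hm ht (hf.of_le hm').contDiffWithinAt (hX t ht h)
  · have h0 := notMem_tsupport_iff_eventuallyEq.1 h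
    refine IsClassVecAt.congr (isClassVecAt_zero hm ht) ht ?_
    filter_upwards [mem_nhdsWithin_of_mem_nhds h0] with u hu
    simp [show f u = 0 from hu]

/-- A vector field along a path which is of class `C^m` near a parameter coincides there with one
of class `C^m` on the whole interval. -/
theorem exists_isClassVec_eventuallyEq (hm : m ≤ (k : ℕ∞ω) + 1) {X : VectorField γ} {s : ℝ}
    (hX : ∀ᶠ t in 𝓝[γ.J] s, IsClassVecAt m X t) :
    ∃ Y : VectorField γ, IsClassVec m Y ∧ ∀ᶠ t in 𝓝[γ.J] s, Y t = X t := by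
  obtain ⟨f, hf, hf1, hfX⟩ := exists_bump_nhdsWithin hX
  refine ⟨fun t => f t • X t, isClassVec_smul_of_tsupport hm hf hfX, ?_⟩
  filter_upwards [mem_nhdsWithin_of_mem_nhds hf1] with t ht
  simp [ht]

/-- Vector and covector fields along a path which, near the parameter `s₀`, are the coordinate
frame and coframe of the preferred chart at `γ(s₀)`. -/
theorem exists_local_frame (γ : CPath n k M) {s₀ : ℝ} (hs₀ : s₀ ∈ γ.J) :
    ∃ (E : Fin n → VectorField γ) (θ : Fin n → CovectorField γ),
      (∀ i, IsClassVec ((k : ℕ∞ω) + 1) (E i)) ∧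
      (∀ m ≤ (k : ℕ∞ω) + 1, ∀ i, IsClassCovec m (θ i)) ∧
      ∃ O ∈ 𝓝 s₀, O.OrdConnected ∧
        (∀ t ∈ O ∩ γ.J, γ.toFun t ∈ (chartAt (EuclideanSpace ℝ (Fin n)) (γ.toFun s₀)).source) ∧
        (∀ t ∈ O ∩ γ.J, ∀ i,
          E i t = ofModel (γ.toFun s₀) (γ.toFun t) (EuclideanSpace.single i 1)) ∧
        (∀ t ∈ O ∩ γ.J, ∀ i v, θ i t v = toModel (γ.toFun s₀) (γ.toFun t) v i) := by
  set x₀ := γ.toFun s₀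
  obtain ⟨f, hf, hf1, hfs⟩ := exists_bump_nhdsWithin
    (γ.eventually_mem_source hs₀ (mem_chart_source _ x₀))
  let X : Fin n → VectorField γ := fun i t =>
    ofModel x₀ (γ.toFun t) (EuclideanSpace.single i 1)
  let θ : Fin n → CovectorField γ := fun i t =>
    f t • ((EuclideanSpace.proj i).comp (toModel x₀ (γ.toFun t))).toLinearMap
  have hX : ∀ i, ∀ t ∈ γ.J, t ∈ tsupport f → IsClassVecAt ((k : ℕ∞ω) + 1) (X i) t := by
    intro i t ht htf
    rw [isClassVecAt_iff le_rfl ht (hfs t ht htf)]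
    refine (contDiffWithinAt_const (c := EuclideanSpace.single i (1 : ℝ))).congr_of_eventuallyEq
      ?_ (toModel_ofModel (hfs t ht htf) _)
    filter_upwards [γ.eventually_mem_source ht (hfs t ht htf)] with u hu
    exact toModel_ofModel hu _
  obtain ⟨ε, hε, hfε⟩ := Metric.eventually_nhds_iff_ball.1 hf1
  have hO : (Metric.ball s₀ ε).OrdConnected := by
    rw [Real.ball_eq_Ioo]; exact ordConnected_Ioo
  refine ⟨fun i t => f t • X i t, θ, fun i => isClassVec_smul_of_tsupport le_rfl hf (hX i), ?_,
    Metric.ball s₀ ε, Metric.ball_mem_nhds _ hε, hO, ?_, ?_, ?_⟩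
  -- All `m` are treated at once: a covector field is tested on vector fields of its own class, so
  -- class `C^(k+1)` does not contain class `C^k` by definition, and both are needed later.
  · intro m hm i Z hZ
    refine contDiffOn_mul_of_tsupport (g := fun t => toModel x₀ (γ.toFun t) (Z t) i)
      (hm.trans (add_one_le_infty k)) hf fun t ht htf => ?_
    have := (isClassVecAt_iff hm ht (hfs t ht htf)).1 (hZ.at ht)
    exact (EuclideanSpace.proj (𝕜 := ℝ) i : EuclideanSpace ℝ (Fin n) →L[ℝ] ℝ).contDiff.comp_contDiffWithinAt
      this
  · intro t ht
    exact hfs t ht.2 (subset_tsupport f (by simp [hfε t ht.1]))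
  · intro t ht i
    simp [hfε t ht.1, X]
  · intro t ht i v
    simp [hfε t ht.1, θ]

end Fields

/-! ### Tensors of low type and insertion of arguments -/

section TensorAlgebra

variable {n : ℕ} {M : Type*} [TopologicalSpace M] [ChartedSpace (EuclideanSpace ℝ (Fin n)) M]

instance finiteDimensional_tan (x : M) : FiniteDimensional ℝ (Tan n x) :=
  inferInstanceAs (FiniteDimensional ℝ (EuclideanSpace ℝ (Fin n)))

variable {x : M}

theorem vectorTensor_injective : Function.Injective (vectorTensor : Tan n x → TensorAt n x 1 0) := by
  intro v w h
  refine (Module.forall_dual_apply_eq_zero_iff ℝ (v - w)).1 (fun α => ?_) |> sub_eq_zero.1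
  have := DFunLike.congr_fun (DFunLike.congr_fun h fun _ => α) ![]
  rw [map_sub, sub_eq_zero]
  exact this

/-- Such a tensor is an element of the bidual, and finite-dimensional spaces are reflexive. This
turns the derivative of a vector field back into a vector field. -/
theorem exists_vectorTensor_eq (T : TensorAt n x 1 0) : ∃ v, vectorTensor v = T := by
  let L : Dual ℝ (Cotan n x) :=
    (MultilinearMap.constLinearEquivOfIsEmpty (R := ℝ) (S := ℝ) (M₁ := fun _ : Fin 0 => Tan n x)
      (M₂ := ℝ)).symm.toLinearMap.comp ((MultilinearMap.ofSubsingleton ℝ (Cotan n x)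
        (MultilinearMap ℝ (fun _ : Fin 0 => Tan n x) ℝ) (0 : Fin 1)).symm T)
  refine ⟨(evalEquiv ℝ (Tan n x)).symm L, ?_⟩
  ext α v
  have h1 : α = fun _ => α 0 := funext fun i => by rw [Subsingleton.elim i 0]
  rw [vectorTensor_apply, apply_evalEquiv_symm_apply, Subsingleton.elim v 0]
  change T (fun _ => α 0) 0 = T α 0
  rw [← h1]

theorem vectorTensor_add (v w : Tan n x) :
    vectorTensor (v + w) = vectorTensor v + vectorTensor w := by
  ext α u
  simp

theorem vectorTensor_smul (c : ℝ) (v : Tan n x) : vectorTensor (c • v) = c • vectorTensor v := by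
  ext α u
  simp

theorem vectorTensor_sum {ι : Type*} (S : Finset ι) (v : ι → Tan n x) :
    vectorTensor (∑ i ∈ S, v i) = ∑ i ∈ S, vectorTensor (v i) := by
  ext α u
  simp [sum_apply]

/-- A covector as a tensor of type `(0, 1)`. -/
def covectorTensor (θ : Cotan n x) : TensorAt n x 0 1 :=
  MultilinearMap.constOfIsEmpty ℝ _ (MultilinearMap.ofSubsingleton ℝ (Tan n x) ℝ 0 θ)

@[simp] theorem covectorTensor_apply (θ : Cotan n x) (α : Fin 0 → Cotan n x)
    (v : Fin 1 → Tan n x) : covectorTensor θ α v = θ (v 0) := rfl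

/-- A tensor of type `(0, 1)` as a covector. -/
def tensorCovector (T : TensorAt n x 0 1) : Cotan n x :=
  (MultilinearMap.ofSubsingleton ℝ (Tan n x) ℝ (0 : Fin 1)).symm (T 0)

theorem covectorTensor_tensorCovector (T : TensorAt n x 0 1) :
    covectorTensor (tensorCovector T) = T := by
  ext α v
  have h1 : v = fun _ => v 0 := funext fun i => by rw [Subsingleton.elim i 0]
  rw [covectorTensor_apply, Subsingleton.elim α 0]
  change T 0 (fun _ => v 0) = T 0 v
  rw [← h1]

/-- Insertion of a covector in the first contravariant slot of a tensor. -/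
def insertCovec {p q : ℕ} (T : TensorAt n x (p + 1) q) (θ : Cotan n x) : TensorAt n x p q :=
  T.curryLeft θ

@[simp] theorem insertCovec_apply {p q : ℕ} (T : TensorAt n x (p + 1) q) (θ : Cotan n x)
    (α : Fin p → Cotan n x) (v : Fin q → Tan n x) :
    insertCovec T θ α v = T (Fin.cons θ α : Fin (p + 1) → Cotan n x) v := rfl

/-- Insertion of a vector in the first covariant slot of a tensor. -/
def insertVec {p q : ℕ} (T : TensorAt n x p (q + 1)) (w : Tan n x) : TensorAt n x p q :=
  ((LinearMap.applyₗ w).comp (multilinearCurryLeftEquiv ℝ (fun _ : Fin (q + 1) => Tan n x)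
    ℝ).toLinearMap).compMultilinearMap T

@[simp] theorem insertVec_apply {p q : ℕ} (T : TensorAt n x p (q + 1)) (w : Tan n x)
    (α : Fin p → Cotan n x) (v : Fin q → Tan n x) :
    insertVec T w α v = T α (Fin.cons w v : Fin (q + 1) → Tan n x) := rfl

variable [IsManifold (𝓡 n) 1 M]

theorem contraction_add {p q : ℕ} (i : Fin (p + 1)) (j : Fin (q + 1))
    (T S : TensorAt n x (p + 1) (q + 1)) :
    contraction i j (T + S) = contraction i j T + contraction i j S := by
  ext α v
  simp only [contraction_apply, add_apply, Finset.sum_add_distrib]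

/-- Expanding `θ` in the dual basis gives the sum that defines the contraction. Insertion of an
argument is thereby expressed through the two operations that a derivation respects. -/
theorem contraction_tensorMul_covectorTensor {p q : ℕ} (T : TensorAt n x (p + 1) q)
    (θ : Cotan n x) :
    contraction (p := p) (q := q) 0 (Fin.last q)
      (tensorMul (p := p + 1) (q := q) (p' := 0) (q' := 1) T (covectorTensor θ)) =
        insertCovec T θ := by
  ext α v
  rw [contraction_apply]
  have h : ∀ a, tensorMul (p := p + 1) (q := q) (p' := 0) (q' := 1) T (covectorTensor θ)
      (Fin.insertNth (n := p) (α := fun _ => Cotan n x) 0 ((coordBasis x).coord a) α)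
      (Fin.insertNth (α := fun _ => Tan n x) (Fin.last q) (coordBasis x a) v) =
      insertCovec T (θ (coordBasis x a) • (coordBasis x).coord a) α v := by
    intro a
    have h1 : (Fin.natAdd q (0 : Fin 1)) = Fin.last q := rfl
    have h2 : (fun b : Fin q => Fin.insertNth (α := fun _ => Tan n x) (Fin.last q)
        (coordBasis x a) v (Fin.castAdd 1 b)) = v := by
      funext b
      exact (Fin.insertNth_last' (coordBasis x a) v) ▸ Fin.snoc_castSucc (α := fun _ => Tan n x)
        (coordBasis x a) v b
    have h3 : (fun b : Fin (p + 1) => Fin.insertNth (n := p) (α := fun _ => Cotan n x) 0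
        ((coordBasis x).coord a) α (Fin.castAdd 0 b)) =
          (Fin.cons ((coordBasis x).coord a) α : Fin (p + 1) → Cotan n x) := by
      funext b
      rw [Fin.insertNth_zero']
      rfl
    rw [tensorMul_apply, covectorTensor_apply, h1, Fin.insertNth_apply_same, h2, h3, insertCovec,
      map_smul, mul_comm]
    rfl
  simp_rw [h, ← sum_apply]
  rw [insertCovec, ← Module.Basis.sum_dual_apply_smul_coord (coordBasis x) θ, map_sum]
  simp only [insertCovec, Module.Basis.sum_dual_apply_smul_coord]

theorem contraction_tensorMul_vectorTensor {p q : ℕ} (T : TensorAt n x p (q + 1))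
    (w : Tan n x) :
    contraction (p := p) (q := q) (Fin.last p) 0
      (tensorMul (p := p) (q := q + 1) (p' := 1) (q' := 0) T (vectorTensor w)) =
        insertVec T w := by
  ext α v
  rw [contraction_apply]
  have h : ∀ a, tensorMul (p := p) (q := q + 1) (p' := 1) (q' := 0) T (vectorTensor w)
      (Fin.insertNth (α := fun _ => Cotan n x) (Fin.last p) ((coordBasis x).coord a) α)
      (Fin.insertNth (n := q) (α := fun _ => Tan n x) 0 (coordBasis x a) v) =
      (T α).curryLeft ((coordBasis x).coord a w • coordBasis x a) v := by
    intro a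
    have h1 : (Fin.natAdd p (0 : Fin 1)) = Fin.last p := rfl
    have h2 : (fun b : Fin p => Fin.insertNth (α := fun _ => Cotan n x) (Fin.last p)
        ((coordBasis x).coord a) α (Fin.castAdd 1 b)) = α := by
      funext b
      exact (Fin.insertNth_last' ((coordBasis x).coord a) α) ▸
        Fin.snoc_castSucc (α := fun _ => Cotan n x) ((coordBasis x).coord a) α b
    have h3 : (fun b : Fin (q + 1) => Fin.insertNth (n := q) (α := fun _ => Tan n x) 0
        (coordBasis x a) v (Fin.castAdd 0 b)) =
          (Fin.cons (coordBasis x a) v : Fin (q + 1) → Tan n x) := by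
      funext b
      rw [Fin.insertNth_zero']
      rfl
    rw [tensorMul_apply, vectorTensor_apply, h1, Fin.insertNth_apply_same, h2, h3, map_smul,
      mul_comm]
    rfl
  simp_rw [h, ← sum_apply]
  rw [← map_sum]
  simp only [Module.Basis.coord_apply, Module.Basis.sum_repr]
  rfl

end TensorAlgebra

/-! ### Calculus of derivations along a path -/

section Derivation

variable {n : ℕ} {k : ℕ∞} {M : Type*} [TopologicalSpace M]
  [ChartedSpace (EuclideanSpace ℝ (Fin n)) M] [IsManifold (𝓡 n) 1 M]
  {γ : CPath n k M} {m : ℕ∞ω} {p q : ℕ}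

theorem IsClassVec.tensor {X : VectorField γ} (hX : IsClassVec m X) :
    IsClassTensor m (fun t => vectorTensor (X t) : TensorField γ 1 0) :=
  fun _ _ hθ _ => hθ 0 X hX

theorem IsClassCovec.tensor {θ : CovectorField γ} (hθ : IsClassCovec m θ) :
    IsClassTensor m (fun t => covectorTensor (θ t) : TensorField γ 0 1) :=
  fun _ X _ hX => hθ (X 0) (hX 0)

theorem isClassTensor_scalar {f : ℝ → ℝ} (hf : ContDiffOn ℝ m f γ.J) :
    IsClassTensor m (fun t => scalarTensor (γ.toFun t) (f t) : TensorField γ 0 0) :=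
  fun _ _ _ _ => hf

theorem IsClassTensor.mul {p' q' : ℕ} {T : TensorField γ p q} {S : TensorField γ p' q'}
    (hT : IsClassTensor m T) (hS : IsClassTensor m S) :
    IsClassTensor m (fun t => tensorMul (T t) (S t)) :=
  fun _ _ hθ hX => (hT _ _ (fun _ => hθ _) (fun _ => hX _)).mul
    (hS _ _ (fun _ => hθ _) (fun _ => hX _))

theorem IsClassTensor.insertCovec {T : TensorField γ (p + 1) q} {θ : CovectorField γ}
    (hT : IsClassTensor m T) (hθ : IsClassCovec m θ) :
    IsClassTensor m (fun t => insertCovec (T t) (θ t)) := by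
  intro α X hα hX
  refine (hT (Fin.cons θ α : Fin (p + 1) → CovectorField γ) X (Fin.cases hθ hα) hX).congr ?_
  intro s _
  rw [insertCovec_apply]
  congr 2
  funext a
  induction a using Fin.cases <;> rfl

theorem IsClassTensor.insertVec {T : TensorField γ p (q + 1)} {Y : VectorField γ}
    (hT : IsClassTensor m T) (hY : IsClassVec m Y) :
    IsClassTensor m (fun t => insertVec (T t) (Y t)) := by
  intro α X hα hX
  refine (hT α (Fin.cons Y X : Fin (q + 1) → VectorField γ) hα (Fin.cases hY hX)).congr ?_
  intro s _
  rw [insertVec_apply]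
  congr 1
  funext a
  induction a using Fin.cases <;> rfl

namespace DerivationAlong

variable (D : DerivationAlong γ)

/-- The value of a derivation along a path on a vector field, as a vector field. -/
def vec (X : VectorField γ) : VectorField γ := fun s =>
  (exists_vectorTensor_eq (D.onVec X s)).choose

theorem vectorTensor_vec (X : VectorField γ) (s : ℝ) :
    vectorTensor (D.vec X s) = D.onVec X s :=
  (exists_vectorTensor_eq (D.onVec X s)).choose_spec

theorem vec_eq_iff {X : VectorField γ} {s : ℝ} {v : Tan n (γ.toFun s)} :
    D.vec X s = v ↔ D.onVec X s = vectorTensor v := by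
  rw [← D.vectorTensor_vec, vectorTensor_injective.eq_iff]

/-- The value of a derivation along a path on a covector field, as a covector field. -/
def covec (θ : CovectorField γ) : CovectorField γ := fun s =>
  tensorCovector (D.toFun (fun t => covectorTensor (θ t)) s)

theorem covectorTensor_covec (θ : CovectorField γ) (s : ℝ) :
    covectorTensor (D.covec θ s) = D.toFun (fun t => covectorTensor (θ t)) s :=
  covectorTensor_tensorCovector _

theorem toFun_fun_smul {f : ℝ → ℝ} (hf : ContDiffOn ℝ ((k : ℕ∞ω) + 1) f γ.J)
    {T : TensorField γ p q} (hT : IsClassTensor ((k : ℕ∞ω) + 1) T) {s : ℝ} (hs : s ∈ γ.J) :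
    D.toFun (fun t => f t • T t) s = derivWithin f γ.J s • T s + f s • D.toFun T s := by
  -- The scalar is the right factor because `p + 0` reduces to `p`, so the product has the type of
  -- `T` without a cast.
  have h : ∀ (x : M) (T : TensorAt n x p q) (c : ℝ),
      (tensorMul (p' := 0) (q' := 0) T (scalarTensor x c) : TensorAt n x p q) = c • T := by
    intro x T c
    ext α v
    exact mul_comm _ _
  have h1 := D.leibniz T (fun t => scalarTensor (γ.toFun t) (f t)) hT
    (isClassTensor_scalar hf) s hs
  rw [D.scalar f hf s hs] at h1
  have h2 : (fun t => f t • T t) =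
      fun t => (tensorMul (p' := 0) (q' := 0) (T t) (scalarTensor (γ.toFun t) (f t)) :
        TensorAt n (γ.toFun t) p q) := funext fun t => (h _ _ _).symm
  rw [h2, ← h _ (T s) (derivWithin f γ.J s), ← h _ (D.toFun T s), add_comm]
  exact h1

/-- A derivation along a path is local. -/
theorem toFun_congr_of_eventuallyEq {T S : TensorField γ p q}
    (hT : IsClassTensor ((k : ℕ∞ω) + 1) T) (hS : IsClassTensor ((k : ℕ∞ω) + 1) S)
    {s : ℝ} (hs : s ∈ γ.J) (h : ∀ᶠ t in 𝓝[γ.J] s, T t = S t) : D.toFun T s = D.toFun S s := by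
  obtain ⟨f, hf, hf1, hfs⟩ := exists_bump_nhdsWithin h
  have hfk : ContDiffOn ℝ ((k : ℕ∞ω) + 1) f γ.J := (hf.of_le (add_one_le_infty k)).contDiffOn
  have hd : derivWithin f γ.J s = 0 := by
    have : HasDerivAt f 0 s := (hasDerivAt_const s (1 : ℝ)).congr_of_eventuallyEq hf1
    exact this.hasDerivWithinAt.derivWithin (γ.uniqueDiffOn s hs)
  -- Multiplying by a cut-off equal to `1` near `s` does not change the derivative at `s`, whereas
  -- `f T` and `f S` agree on all of `J`.
  have key : ∀ T : TensorField γ p q, IsClassTensor ((k : ℕ∞ω) + 1) T →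
      D.toFun (fun t => f t • T t) s = D.toFun T s := by
    intro T hT
    rw [D.toFun_fun_smul hfk hT hs, hd, hf1.self_of_nhds, zero_smul, zero_add, one_smul]
  rw [← key T hT, ← key S hS]
  refine D.congr _ _ (fun t ht => ?_) s hs
  by_cases htf : t ∈ tsupport f
  · rw [hfs t ht htf]
  · rw [image_eq_zero_of_notMem_tsupport htf, zero_smul, zero_smul]

theorem vec_congr {X Y : VectorField γ} (hX : IsClassVec ((k : ℕ∞ω) + 1) X)
    (hY : IsClassVec ((k : ℕ∞ω) + 1) Y) {s : ℝ} (hs : s ∈ γ.J)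
    (h : ∀ᶠ t in 𝓝[γ.J] s, X t = Y t) : D.vec X s = D.vec Y s := by
  rw [vec_eq_iff, vectorTensor_vec]
  refine D.toFun_congr_of_eventuallyEq hX.tensor hY.tensor hs ?_
  filter_upwards [h] with t ht
  rw [ht]

theorem vec_add {X Y : VectorField γ} (hX : IsClassVec ((k : ℕ∞ω) + 1) X)
    (hY : IsClassVec ((k : ℕ∞ω) + 1) Y) {s : ℝ} (hs : s ∈ γ.J) :
    D.vec (fun t => X t + Y t) s = D.vec X s + D.vec Y s := by
  rw [vec_eq_iff, vectorTensor_add, vectorTensor_vec, vectorTensor_vec]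
  simp only [onVec, vectorTensor_add]
  exact D.add _ _ hX.tensor hY.tensor s hs

theorem vec_fun_smul {f : ℝ → ℝ} (hf : ContDiffOn ℝ ((k : ℕ∞ω) + 1) f γ.J) {X : VectorField γ}
    (hX : IsClassVec ((k : ℕ∞ω) + 1) X) {s : ℝ} (hs : s ∈ γ.J) :
    D.vec (fun t => f t • X t) s = derivWithin f γ.J s • X s + f s • D.vec X s := by
  rw [vec_eq_iff, vectorTensor_add, vectorTensor_smul, vectorTensor_smul, vectorTensor_vec]
  simp only [onVec, vectorTensor_smul]
  exact D.toFun_fun_smul hf hX.tensor hs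

/-- The product rule for `T ⊗ θ`, followed by the contraction that performs the insertion. -/
theorem toFun_insertCovec {T : TensorField γ (p + 1) q} {θ : CovectorField γ}
    (hT : IsClassTensor ((k : ℕ∞ω) + 1) T) (hθ : IsClassCovec ((k : ℕ∞ω) + 1) θ) {s : ℝ}
    (hs : s ∈ γ.J) :
    D.toFun (fun t => insertCovec (T t) (θ t)) s =
      insertCovec (D.toFun T s) (θ s) + insertCovec (T s) (D.covec θ s) := by
  simp only [← contraction_tensorMul_covectorTensor]
  rw [D.contract (p := p) (q := q) 0 (Fin.last q) _ (hT.mul hθ.tensor) s hs,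
    covectorTensor_covec, ← contraction_add]
  congr 1
  exact D.leibniz T _ hT hθ.tensor s hs

theorem toFun_insertVec {T : TensorField γ p (q + 1)} {X : VectorField γ}
    (hT : IsClassTensor ((k : ℕ∞ω) + 1) T) (hX : IsClassVec ((k : ℕ∞ω) + 1) X) {s : ℝ}
    (hs : s ∈ γ.J) :
    D.toFun (fun t => insertVec (T t) (X t)) s =
      insertVec (D.toFun T s) (X s) + insertVec (T s) (D.vec X s) := by
  simp only [← contraction_tensorMul_vectorTensor]
  rw [D.contract (p := p) (q := q) (Fin.last p) 0 _ (hT.mul hX.tensor) s hs,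
    vectorTensor_vec, ← contraction_add]
  congr 1
  exact D.leibniz T _ hT hX.tensor s hs

/-- Inserting the vector fields one by one, starting from the first slot, leaves a function, on
which the derivation is `d/ds`; each insertion contributes one correction term. -/
theorem toFun_apply_of_zero {q : ℕ} {T : TensorField γ 0 q} (hT : IsClassTensor ((k : ℕ∞ω) + 1) T)
    {X : Fin q → VectorField γ} (hX : ∀ b, IsClassVec ((k : ℕ∞ω) + 1) (X b)) {s : ℝ}
    (hs : s ∈ γ.J) (θ : ∀ t, Fin 0 → Cotan n (γ.toFun t)) :
    D.toFun T s (θ s) (fun b => X b s) =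
      derivWithin (fun t => T t (θ t) (fun b => X b t)) γ.J s
        - ∑ b, T s (θ s) (Function.update (fun b => X b s) b (D.vec (X b) s)) := by
  induction q with
  | zero =>
    have h0 : T = fun t => scalarTensor (γ.toFun t) (T t 0 0) := by
      funext t
      ext α v
      rw [scalarTensor_apply, Subsingleton.elim α 0, Subsingleton.elim v 0]
    have h1 : ContDiffOn ℝ ((k : ℕ∞ω) + 1) (fun t => T t 0 0) γ.J := by
      refine (hT Fin.elim0 Fin.elim0 (fun a => a.elim0) (fun a => a.elim0)).congr fun t _ => ?_
      congr 2 <;> exact Subsingleton.elim _ _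
    have h2 : (fun t => T t (θ t) (fun b => X b t)) = fun t => T t 0 0 := by
      funext t
      congr 2 <;> exact Subsingleton.elim _ _
    rw [h2]
    conv_lhs => rw [h0]
    rw [D.scalar _ h1 s hs]
    simp
  | succ q ih =>
    have h1 := ih (hT.insertVec (hX 0)) (fun b => hX b.succ)
    rw [D.toFun_insertVec hT (hX 0) hs] at h1
    have hcons : ∀ t, (Fin.cons (X 0 t) fun b => X (Fin.succ b) t : Fin (q + 1) → _) =
        fun b => X b t := fun t => Fin.cons_self_tail (fun b => X b t)
    simp only [add_apply, insertVec_apply, hcons] at h1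
    rw [Fin.sum_univ_succ]
    have e0 : Function.update (fun b => X b s) 0 (D.vec (X 0) s) =
        (Fin.cons (D.vec (X 0) s) fun b => X (Fin.succ b) s : Fin (q + 1) → _) := by
      rw [← hcons s, Fin.update_cons_zero]
    have e1 : ∀ b : Fin q, Function.update (fun b => X b s) b.succ (D.vec (X b.succ) s) =
        (Fin.cons (X 0 s) (Function.update (fun b => X (Fin.succ b) s) b (D.vec (X b.succ) s)) :
          Fin (q + 1) → _) := fun b => by
      rw [Fin.cons_update, hcons]
    simp only [e0, e1]
    linarith

/-- A derivation along a path is determined by its values on functions, vectors and covectors. -/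
theorem toFun_apply {p q : ℕ} {T : TensorField γ p q} (hT : IsClassTensor ((k : ℕ∞ω) + 1) T)
    {θ : Fin p → CovectorField γ} (hθ : ∀ a, IsClassCovec ((k : ℕ∞ω) + 1) (θ a))
    {X : Fin q → VectorField γ} (hX : ∀ b, IsClassVec ((k : ℕ∞ω) + 1) (X b)) {s : ℝ}
    (hs : s ∈ γ.J) :
    D.toFun T s (fun a => θ a s) (fun b => X b s) =
      derivWithin (fun t => T t (fun a => θ a t) (fun b => X b t)) γ.J s
        - ∑ a, T s (Function.update (fun a => θ a s) a (D.covec (θ a) s)) (fun b => X b s)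
        - ∑ b, T s (fun a => θ a s) (Function.update (fun b => X b s) b (D.vec (X b) s)) := by
  induction p with
  | zero => simpa using D.toFun_apply_of_zero hT hX hs (fun t a => θ a t)
  | succ p ih =>
    have h1 := ih (hT.insertCovec (hθ 0)) (fun a => hθ a.succ)
    rw [D.toFun_insertCovec hT (hθ 0) hs] at h1
    have hcons : ∀ t, (Fin.cons (θ 0 t) fun a => θ (Fin.succ a) t : Fin (p + 1) → _) =
        fun a => θ a t := fun t => Fin.cons_self_tail (fun a => θ a t)
    simp only [add_apply, insertCovec_apply, hcons] at h1
    rw [Fin.sum_univ_succ]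
    have e0 : Function.update (fun a => θ a s) 0 (D.covec (θ 0) s) =
        (Fin.cons (D.covec (θ 0) s) fun a => θ (Fin.succ a) s : Fin (p + 1) → _) := by
      rw [← hcons s, Fin.update_cons_zero]
    have e1 : ∀ a : Fin p, Function.update (fun a => θ a s) a.succ (D.covec (θ a.succ) s) =
        (Fin.cons (θ 0 s) (Function.update (fun a => θ (Fin.succ a) s) a (D.covec (θ a.succ) s)) :
          Fin (p + 1) → _) := fun a => by
      rw [Fin.cons_update, hcons]
    simp only [e0, e1]
    linarith

/-- The Leibniz rule for the pairing of a covector field and a vector field along a path. -/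
theorem covec_apply {θ : CovectorField γ} (hθ : IsClassCovec ((k : ℕ∞ω) + 1) θ)
    {X : VectorField γ} (hX : IsClassVec ((k : ℕ∞ω) + 1) X) {s : ℝ} (hs : s ∈ γ.J) :
    D.covec θ s (X s) = derivWithin (fun t => θ t (X t)) γ.J s - θ s (D.vec X s) := by
  have := D.toFun_apply_of_zero hθ.tensor (X := fun _ => X) (fun _ => hX) hs (fun _ => ![])
  rw [← D.covectorTensor_covec] at this
  simpa using this

variable [IsManifold (𝓡 n) ((k : ℕ∞ω) + 2) M]

theorem vec_zero {s : ℝ} (hs : s ∈ γ.J) : D.vec (fun _ => 0) s = 0 := by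
  have h0 : IsClassVec ((k : ℕ∞ω) + 1) (fun _ => 0 : VectorField γ) :=
    fun t ht => isClassVecAt_zero le_rfl ht
  simpa using D.vec_add h0 h0 hs

theorem vec_sum {ι : Type*} (S : Finset ι) {X : ι → VectorField γ}
    (hX : ∀ i ∈ S, IsClassVec ((k : ℕ∞ω) + 1) (X i)) {s : ℝ} (hs : s ∈ γ.J) :
    D.vec (fun t => ∑ i ∈ S, X i t) s = ∑ i ∈ S, D.vec (X i) s := by
  classical
  induction S using Finset.induction_on with
  | empty => simpa using D.vec_zero hs
  | insert i S hi ih =>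
    simp only [Finset.sum_insert hi]
    rw [D.vec_add (hX i (by simp)) (IsClassVec.sum le_rfl S fun j hj => hX j (by simp [hj])) hs,
      ih fun j hj => hX j (by simp [hj])]

/-- The Leibniz rule for linear combinations of vector fields along a path. -/
theorem vec_sum_smul {ι : Type*} [Fintype ι] {f : ι → ℝ → ℝ} {X : ι → VectorField γ}
    (hf : ∀ i, ContDiffOn ℝ ((k : ℕ∞ω) + 1) (f i) γ.J)
    (hX : ∀ i, IsClassVec ((k : ℕ∞ω) + 1) (X i)) {s : ℝ} (hs : s ∈ γ.J) :
    D.vec (fun t => ∑ i, f i t • X i t) s =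
      ∑ i, (derivWithin (f i) γ.J s • X i s + f i s • D.vec (X i) s) := by
  rw [D.vec_sum Finset.univ (X := fun i t => f i t • X i t)
    (fun i _ => (hX i).smul le_rfl (hf i)) hs]
  exact Finset.sum_congr rfl fun i _ => D.vec_fun_smul (hf i) (hX i) hs

end DerivationAlong

end Derivation

/-! ### Coefficients with respect to moving bases -/

section Coefficients

variable {n : ℕ}

/-- The linear combinations of `n` vectors, as a linear function of the coefficients. -/
def combination (w : Fin n → EuclideanSpace ℝ (Fin n)) :
    EuclideanSpace ℝ (Fin n) →L[ℝ] EuclideanSpace ℝ (Fin n) :=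
  ∑ i, (EuclideanSpace.proj i : EuclideanSpace ℝ (Fin n) →L[ℝ] ℝ).smulRight (w i)

theorem combination_apply (w : Fin n → EuclideanSpace ℝ (Fin n)) (c : EuclideanSpace ℝ (Fin n)) :
    combination w c = ∑ i, c i • w i := by
  simp [combination, sum_apply]

theorem exists_equiv_combination {w : Fin n → EuclideanSpace ℝ (Fin n)}
    (hw : LinearIndependent ℝ w) :
    ∃ e : EuclideanSpace ℝ (Fin n) ≃L[ℝ] EuclideanSpace ℝ (Fin n),
      (e : EuclideanSpace ℝ (Fin n) →L[ℝ] EuclideanSpace ℝ (Fin n)) = combination w := by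
  have hinj : Function.Injective (combination w).toLinearMap := by
    rw [← LinearMap.ker_eq_bot, LinearMap.ker_eq_bot']
    intro c hc
    ext i
    have h : ∑ i, c i • w i = 0 := by rw [← combination_apply]; exact hc
    exact Fintype.linearIndependent_iff.1 hw c h i
  refine ⟨(LinearEquiv.ofBijective _
    ⟨hinj, LinearMap.injective_iff_surjective.1 hinj⟩).toContinuousLinearEquiv, ?_⟩
  ext1 c
  rfl

theorem contDiff_combination {m : ℕ∞ω} : ContDiff ℝ m (combination (n := n)) := by
  refine ContDiff.sum fun i _ => ?_
  exact (ContinuousLinearMap.smulRightL ℝ (EuclideanSpace ℝ (Fin n)) (EuclideanSpace ℝ (Fin n))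
    (EuclideanSpace.proj i)).contDiff.comp (contDiff_apply ℝ (EuclideanSpace ℝ (Fin n)) i)

variable {E H N : Type*} [NormedAddCommGroup E] [NormedSpace ℝ E] [TopologicalSpace H]
  {I : ModelWithCorners ℝ E H} [TopologicalSpace N] [ChartedSpace H N] {m : ℕ∞ω}
  {w : N → Fin n → EuclideanSpace ℝ (Fin n)} {v c : N → EuclideanSpace ℝ (Fin n)}
  {S : Set N} {x : N}

/-- Invertible operators form an open set, so near `x` the total function `inverse` is the true
inverse. The filter `l` covers both the one-sided and the full-neighbourhood use. -/
theorem eventually_eq_inverse_combination {l : Filter N} (hl : l ≤ 𝓝[insert x S] x)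
    (hw : ContinuousWithinAt w S x) (hli : LinearIndependent ℝ (w x))
    (hc : ∀ᶠ y in l, v y = ∑ i, c y i • w y i) :
    ∀ᶠ y in l, c y = (combination (w y)).inverse (v y) := by
  obtain ⟨e, he⟩ := exists_equiv_combination hli
  have h1 : ContinuousWithinAt (fun y => combination (w y)) (insert x S) x :=
    (contDiff_combination (m := 0)).continuous.continuousAt.comp_continuousWithinAt
      (continuousWithinAt_insert_self.2 hw)
  have h2 : ∀ᶠ y in l, combination (w y) ∈
      range ((↑) : (EuclideanSpace ℝ (Fin n) ≃L[ℝ] EuclideanSpace ℝ (Fin n)) → _) :=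
    hl (h1 (by beta_reduce; rw [← he]; exact ContinuousLinearEquiv.nhds e))
  filter_upwards [h2, hc] with y hy hyc
  obtain ⟨e', he'⟩ := hy
  rw [hyc, ← combination_apply, ← he', ContinuousLinearMap.inverse_equiv]
  simp

/-- Smoothness of operator inversion plays the part of Cramer's rule. -/
theorem contMDiffWithinAt_coefficients
    (hw : ∀ i, ContMDiffWithinAt I 𝓘(ℝ, EuclideanSpace ℝ (Fin n)) m (fun y => w y i) S x)
    (hv : ContMDiffWithinAt I 𝓘(ℝ, EuclideanSpace ℝ (Fin n)) m v S x) (hx : x ∈ S)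
    (hli : LinearIndependent ℝ (w x)) (hc : ∀ᶠ y in 𝓝[S] x, v y = ∑ i, c y i • w y i) :
    ContMDiffWithinAt I 𝓘(ℝ, EuclideanSpace ℝ (Fin n)) m c S x := by
  have hw' : ContMDiffWithinAt I 𝓘(ℝ, Fin n → EuclideanSpace ℝ (Fin n)) m w S x :=
    contMDiffWithinAt_pi_space.2 hw
  have heq := eventually_eq_inverse_combination (S := S) (by rw [insert_eq_of_mem hx])
    hw'.continuousWithinAt hli hc
  obtain ⟨e, he⟩ := exists_equiv_combination hli
  have h1 : ContMDiffWithinAt I 𝓘(ℝ, EuclideanSpace ℝ (Fin n) →L[ℝ] EuclideanSpace ℝ (Fin n)) m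
      (fun y => (combination (w y)).inverse) S x := by
    have h2 : ContDiffAt ℝ m (fun u => (combination (n := n) u).inverse) (w x) :=
      ContDiffAt.comp (w x) (he ▸ contDiffAt_map_inverse e) contDiff_combination.contDiffAt
    exact h2.contMDiffAt.comp_contMDiffWithinAt x hw'
  exact (h1.clm_apply hv).congr_of_eventuallyEq heq (heq.self_of_nhdsWithin hx)

/-- Differentiability at a single point is what the axioms of a covariant derivative assume of
sections, so the `C^m` version would not serve for the flat connection. -/
theorem mdifferentiableAt_coefficients
    (hw : ∀ i, MDifferentiableAt I 𝓘(ℝ, EuclideanSpace ℝ (Fin n)) (fun y => w y i) x)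
    (hv : MDifferentiableAt I 𝓘(ℝ, EuclideanSpace ℝ (Fin n)) v x)
    (hli : LinearIndependent ℝ (w x)) (hc : ∀ᶠ y in 𝓝 x, v y = ∑ i, c y i • w y i) :
    MDifferentiableAt I 𝓘(ℝ, EuclideanSpace ℝ (Fin n)) c x := by
  have hw' : MDifferentiableAt I 𝓘(ℝ, Fin n → EuclideanSpace ℝ (Fin n)) w x :=
    (mdifferentiableAt_iff _ _).2 ⟨continuousAt_pi.2 fun i => (hw i).continuousAt,
      differentiableWithinAt_pi.2 fun i => ((mdifferentiableAt_iff _ _).1 (hw i)).2⟩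
  have heq := eventually_eq_inverse_combination (S := univ) (l := 𝓝 x) (by simp)
    hw'.continuousAt.continuousWithinAt hli hc
  obtain ⟨e, he⟩ := exists_equiv_combination hli
  have h1 : MDifferentiableAt I 𝓘(ℝ, EuclideanSpace ℝ (Fin n) →L[ℝ] EuclideanSpace ℝ (Fin n))
      (fun y => (combination (w y)).inverse) x := by
    have h2 : ContDiffAt ℝ 1 (fun u => (combination (n := n) u).inverse) (w x) :=
      ContDiffAt.comp (w x) (he ▸ contDiffAt_map_inverse e) contDiff_combination.contDiffAt
    exact (h2.differentiableAt (by simp)).mdifferentiableAt.comp x hw'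
  exact (h1.clm_apply hv).congr_of_eventuallyEq heq

end Coefficients

/-! ### Frames along a path -/

section Frames

variable {n : ℕ} {k : ℕ∞} {M : Type*} [TopologicalSpace M]
  [ChartedSpace (EuclideanSpace ℝ (Fin n)) M] [IsManifold (𝓡 n) 1 M]
  {γ : CPath n k M} {m : ℕ∞ω}

namespace IsFrameAlong

variable {e : Fin n → VectorField γ} (he : IsFrameAlong γ e)

/-- The basis of the tangent space given by a frame along a path. -/
def basis {s : ℝ} (hs : s ∈ γ.J) : Basis (Fin n) ℝ (Tan n (γ.toFun s)) :=
  Basis.mk (he.linearIndependent s hs) (he.span_eq_top s hs).ge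

theorem basis_apply {s : ℝ} (hs : s ∈ γ.J) (i : Fin n) : he.basis hs i = e i s := by
  simp [basis]

open Classical in
/-- The coframe along a path which is dual to a frame. -/
def coframe (i : Fin n) : CovectorField γ := fun s =>
  if hs : s ∈ γ.J then (he.basis hs).coord i else 0

theorem sum_coframe_smul {s : ℝ} (hs : s ∈ γ.J) (v : Tan n (γ.toFun s)) :
    ∑ i, he.coframe i s v • e i s = v := by
  simp only [coframe, hs, dif_pos, Basis.coord_apply, ← he.basis_apply hs]
  exact (he.basis hs).sum_repr v

theorem coframe_sum_smul {s : ℝ} (hs : s ∈ γ.J) (c : Fin n → ℝ) (i : Fin n) :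
    he.coframe i s (∑ j, c j • e j s) = c i := by
  simp only [coframe, hs, dif_pos, Basis.coord_apply, ← he.basis_apply hs]
  simpa using congrFun ((he.basis hs).repr_sum_self c) i

variable [IsManifold (𝓡 n) ((k : ℕ∞ω) + 2) M]

theorem isClassCovec_coframe (hm : m ≤ (k : ℕ∞ω) + 1) (i : Fin n) :
    IsClassCovec m (he.coframe i) := by
  intro X hX s hs
  have hsrc := mem_chart_source (EuclideanSpace ℝ (Fin n)) (γ.toFun s)
  have h1 := fun j => (isClassVecAt_iff hm hs hsrc).1 (((he.isClass j).of_le hm).at hs)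
  have h2 := (isClassVecAt_iff hm hs hsrc).1 (hX.at hs)
  have hli : LinearIndependent ℝ fun j => toModel (γ.toFun s) (γ.toFun s) (e j s) := by
    refine (he.linearIndependent s hs).map' (toModel (γ.toFun s) (γ.toFun s)).toLinearMap ?_
    exact LinearMap.ker_eq_bot.2 (Function.LeftInverse.injective (ofModel_toModel hsrc))
  have h3 := contMDiffWithinAt_coefficients (I := 𝓘(ℝ, ℝ))
    (w := fun t j => toModel (γ.toFun s) (γ.toFun t) (e j t))
    (c := fun t => WithLp.toLp 2 fun i => he.coframe i t (X t))
    (fun j => (h1 j).contMDiffWithinAt) h2.contMDiffWithinAt hs hli (by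
      filter_upwards [self_mem_nhdsWithin] with t ht
      conv_lhs => rw [← he.sum_coframe_smul ht (X t)]
      simp)
  exact (EuclideanSpace.proj (𝕜 := ℝ) i : EuclideanSpace ℝ (Fin n) →L[ℝ] ℝ).contDiff
    |>.comp_contDiffWithinAt (contMDiffWithinAt_iff_contDiffWithinAt.1 h3)

end IsFrameAlong
end Frames

/-! ### The matrix equation `dY/ds = -Γ Y` -/

section MatrixEquation

variable {n : ℕ}

/-- The linear function `x ↦ -Γ x` of coordinate columns. -/
def negMulVec (Γ : Matrix (Fin n) (Fin n) ℝ) : (Fin n → ℝ) →L[ℝ] (Fin n → ℝ) :=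
  ∑ i, ∑ j, (-Γ i j) • (ContinuousLinearMap.proj (R := ℝ) (φ := fun _ : Fin n => ℝ) j).smulRight
    (Pi.single i (1 : ℝ) : Fin n → ℝ)

theorem negMulVec_apply (Γ : Matrix (Fin n) (Fin n) ℝ) (x : Fin n → ℝ) (i : Fin n) :
    negMulVec Γ x i = -∑ j, Γ i j * x j := by
  simp [negMulVec, sum_apply, Finset.sum_apply, Pi.single_apply]

theorem contDiffOn_negMulVec {J : Set ℝ} {m : ℕ∞ω} {Γ : ℝ → Matrix (Fin n) (Fin n) ℝ}
    (hΓ : ∀ i j, ContDiffOn ℝ m (fun s => Γ s i j) J) :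
    ContDiffOn ℝ m (fun s => negMulVec (Γ s)) J :=
  ContDiffOn.sum fun i _ => ContDiffOn.sum fun j _ => (hΓ i j).neg.smul contDiffOn_const

variable {k : ℕ∞} {M : Type*} [TopologicalSpace M] [ChartedSpace (EuclideanSpace ℝ (Fin n)) M]
  {γ : CPath n k M} {Γ : ℝ → Matrix (Fin n) (Fin n) ℝ} {s₀ : ℝ}
  {Y : ℝ → Matrix (Fin n) (Fin n) ℝ}

theorem exists_isFundamentalSolution
    (hΓ : ∀ i j, ContDiffOn ℝ (k : ℕ∞ω) (fun s => Γ s i j) γ.J) (hs₀ : s₀ ∈ γ.J) :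
    ∃ Y, IsFundamentalSolution γ Γ s₀ Y := by
  choose y hy0 hy using fun j : Fin n => exists_linearODE γ.ordConnected
    (contDiffOn_negMulVec hΓ).continuousOn hs₀ (Pi.single j (1 : ℝ) : Fin n → ℝ)
  refine ⟨fun s => Matrix.of fun i j => y j s i, ?_, fun s hs i j => ?_⟩
  · ext i j
    simp [hy0, Matrix.one_apply, Pi.single_apply]
  · have := hasDerivWithinAt_pi.1 (hy j s hs) i
    rw [negMulVec_apply] at this
    simpa [Matrix.mul_apply] using this

namespace IsFundamentalSolution

theorem mulVec_hasDerivWithinAt (hY : IsFundamentalSolution γ Γ s₀ Y) (v : Fin n → ℝ) {s : ℝ}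
    (hs : s ∈ γ.J) : HasDerivWithinAt (fun t => (Y t).mulVec v)
      (negMulVec (Γ s) ((Y s).mulVec v)) γ.J s := by
  refine hasDerivWithinAt_pi.2 fun i => ?_
  have h := HasDerivWithinAt.fun_sum (u := Finset.univ)
    (fun j _ => (hY.2 s hs i j).mul_const (v j))
  convert! h using 1
  rw [negMulVec_apply]
  have : ∑ j, Γ s i j * (Y s).mulVec v j = (Γ s * Y s).mulVec v i := by
    rw [← Matrix.mulVec_mulVec]
    rfl
  rw [this, Matrix.mulVec, dotProduct, ← Finset.sum_neg_distrib]
  simp [neg_mul]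

theorem contDiffOn (hΓ : ∀ i j, ContDiffOn ℝ (k : ℕ∞ω) (fun s => Γ s i j) γ.J)
    (hY : IsFundamentalSolution γ Γ s₀ Y) (v : Fin n → ℝ) (i : Fin n) :
    ContDiffOn ℝ ((k : ℕ∞ω) + 1) (fun s => (Y s).mulVec v i) γ.J :=
  contDiffOn_pi.1 (linearODE_contDiffOn γ.uniqueDiffOn (contDiffOn_negMulVec hΓ)
    fun _ hs => hY.mulVec_hasDerivWithinAt v hs) i

theorem eq_mulVec (hΓ : ∀ i j, ContDiffOn ℝ (k : ℕ∞ω) (fun s => Γ s i j) γ.J) (hs₀ : s₀ ∈ γ.J)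
    (hY : IsFundamentalSolution γ Γ s₀ Y) {x : ℝ → Fin n → ℝ}
    (hx : ∀ s ∈ γ.J, HasDerivWithinAt x (negMulVec (Γ s) (x s)) γ.J s) {s : ℝ} (hs : s ∈ γ.J) :
    x s = (Y s).mulVec (x s₀) :=
  linearODE_unique γ.ordConnected (contDiffOn_negMulVec hΓ).continuousOn hx
    (fun _ hs => hY.mulVec_hasDerivWithinAt (x s₀) hs) hs₀ hs (by rw [hY.1, Matrix.one_mulVec])

theorem unique (hΓ : ∀ i j, ContDiffOn ℝ (k : ℕ∞ω) (fun s => Γ s i j) γ.J) (hs₀ : s₀ ∈ γ.J)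
    (hY : IsFundamentalSolution γ Γ s₀ Y) {Y' : ℝ → Matrix (Fin n) (Fin n) ℝ}
    (hY' : IsFundamentalSolution γ Γ s₀ Y') {s : ℝ} (hs : s ∈ γ.J) : Y' s = Y s := by
  refine Matrix.ext_of_mulVec_single fun j => ?_
  have := hY.eq_mulVec hΓ hs₀ (fun s hs => hY'.mulVec_hasDerivWithinAt (Pi.single j 1) hs) hs
  rwa [hY'.1, Matrix.one_mulVec] at this

/-- Uniqueness run from `s` back to `s₀`: the solutions `Y v` and `Y w` that meet at `s` also meet
at `s₀`, where `Y = 1`. -/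
theorem isUnit (hΓ : ∀ i j, ContDiffOn ℝ (k : ℕ∞ω) (fun s => Γ s i j) γ.J) (hs₀ : s₀ ∈ γ.J)
    (hY : IsFundamentalSolution γ Γ s₀ Y) {s : ℝ} (hs : s ∈ γ.J) : IsUnit (Y s) := by
  rw [← Matrix.mulVec_injective_iff_isUnit]
  intro v w hvw
  have := linearODE_unique γ.ordConnected (contDiffOn_negMulVec hΓ).continuousOn
    (fun _ hs => hY.mulVec_hasDerivWithinAt v hs) (fun _ hs => hY.mulVec_hasDerivWithinAt w hs)
    hs hs₀ hvw
  simpa [hY.1] using this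

end IsFundamentalSolution
end MatrixEquation

/-! ### Frames normal for a derivation along a fixed path -/

section FixedPath

variable {n : ℕ} {k : ℕ∞} {M : Type*} [TopologicalSpace M]
  [ChartedSpace (EuclideanSpace ℝ (Fin n)) M] [IsManifold (𝓡 n) 1 M]
  {γ : CPath n k M} (D : DerivationAlong γ)

theorem isComponents_iff {e : Fin n → VectorField γ} {Γ : ℝ → Matrix (Fin n) (Fin n) ℝ} :
    IsComponents D e Γ ↔ ∀ s ∈ γ.J, ∀ j, D.vec (e j) s = ∑ i, Γ s i j • e i s := by
  simp only [IsComponents, D.vec_eq_iff, vectorTensor_sum, vectorTensor_smul]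

theorem isNormalAlong_iff {e : Fin n → VectorField γ} :
    IsNormalAlong D e ↔ ∀ s ∈ γ.J, ∀ j, D.vec (e j) s = 0 := by
  simp [IsNormalAlong, isComponents_iff]

theorem DerivationAlong.contDiffOn_apply_vec {X : VectorField γ}
    (hX : IsClassVec ((k : ℕ∞ω) + 1) X) {θ : CovectorField γ}
    (hθ : IsClassCovec (k : ℕ∞ω) θ) :
    ContDiffOn ℝ (k : ℕ∞ω) (fun s => θ s (D.vec X s)) γ.J := by
  refine (D.isClass _ hX.tensor (fun _ => θ) Fin.elim0 (fun _ => hθ) (fun a => a.elim0)).congr ?_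
  intro s _
  change _ = D.onVec X s _ _
  rw [← D.vectorTensor_vec, vectorTensor_apply]

theorem isFrameAlong_of_linearIndependent {e : Fin n → VectorField γ}
    (he : ∀ i, IsClassVec ((k : ℕ∞ω) + 1) (e i))
    (hli : ∀ s ∈ γ.J, LinearIndependent ℝ (fun i => e i s)) : IsFrameAlong γ e :=
  ⟨he, hli, fun s hs => (hli s hs).span_eq_top_of_card_eq_finrank' (by
    rw [finrank_tan, Fintype.card_fin])⟩

/-- The components of a derivation along a path in a frame. -/
def DerivationAlong.components {e : Fin n → VectorField γ} (he : IsFrameAlong γ e) (s : ℝ) :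
    Matrix (Fin n) (Fin n) ℝ :=
  Matrix.of fun i j => he.coframe i s (D.vec (e j) s)

theorem DerivationAlong.isComponents_components {e : Fin n → VectorField γ}
    (he : IsFrameAlong γ e) : IsComponents D e (D.components he) :=
  (isComponents_iff D).2 fun _ hs _ => (he.sum_coframe_smul hs _).symm

variable [IsManifold (𝓡 n) ((k : ℕ∞ω) + 2) M]

/-- The components of the derivative of a vector field along a path in a frame. -/
theorem DerivationAlong.coframe_vec {E : Fin n → VectorField γ} {θ : Fin n → CovectorField γ}
    (hE : ∀ i, IsClassVec ((k : ℕ∞ω) + 1) (E i)) (hθ : ∀ i, IsClassCovec ((k : ℕ∞ω) + 1) (θ i))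
    {s : ℝ} (hs : s ∈ γ.J) (hsum : ∀ᶠ t in 𝓝[γ.J] s, ∀ v, ∑ i, θ i t v • E i t = v)
    (hdual : ∀ i (c : Fin n → ℝ), θ i s (∑ j, c j • E j s) = c i)
    {Z : VectorField γ} (hZ : IsClassVec ((k : ℕ∞ω) + 1) Z) (i : Fin n) :
    θ i s (D.vec Z s) = derivWithin (fun t => θ i t (Z t)) γ.J s +
      ∑ j, θ i s (D.vec (E j) s) * θ j s (Z s) := by
  have hf : ∀ j, ContDiffOn ℝ ((k : ℕ∞ω) + 1) (fun t => θ j t (Z t)) γ.J := fun j => hθ j Z hZ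
  have h1 : D.vec Z s = D.vec (fun t => ∑ j, θ j t (Z t) • E j t) s := by
    refine D.vec_congr hZ (IsClassVec.sum le_rfl _ fun j _ => (hE j).smul le_rfl (hf j)) hs ?_
    filter_upwards [hsum] with t ht
    exact (ht _).symm
  rw [h1, D.vec_sum_smul hf hE hs, Finset.sum_add_distrib, map_add, hdual, map_sum]
  simp [mul_comm]

/-- The vector field `X` along a path coincides near the parameter `s` with a field of class
`C^(k+1)` whose derivative vanishes at `s`. -/
def DerivationAlong.IsParallelAt (D : DerivationAlong γ) (X : VectorField γ) (s : ℝ) : Prop :=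
  ∃ Z : VectorField γ,
    IsClassVec ((k : ℕ∞ω) + 1) Z ∧ (∀ᶠ t in 𝓝[γ.J] s, X t = Z t) ∧ D.vec Z s = 0

/-- In the coordinate frame near `t₀` being parallel is the linear equation `x' = -Γ x`. These are
the hypotheses of the gluing principle, which replaces a frame on all of `J`. -/
theorem DerivationAlong.exists_parallel_local {t₀ : ℝ} (ht₀ : t₀ ∈ γ.J) :
    ∃ O ∈ 𝓝 t₀, O.OrdConnected ∧
      (∀ s ∈ O ∩ γ.J, ∀ v, ∃ X, X s = v ∧ ∀ r ∈ O ∩ γ.J, D.IsParallelAt X r) ∧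
      ∀ I ⊆ O ∩ γ.J, I.OrdConnected → ∀ X X', (∀ r ∈ I, D.IsParallelAt X r) →
        (∀ r ∈ I, D.IsParallelAt X' r) → ∀ s ∈ I, ∀ s' ∈ I, X s = X' s → X s' = X' s' := by
  obtain ⟨E, θ, hE, hθ, O, hO, hOc, hsrc, hEo, hθo⟩ := exists_local_frame γ ht₀
  have hsum : ∀ t ∈ O ∩ γ.J, ∀ v, ∑ i, θ i t v • E i t = v := by
    intro t ht v
    simp only [hEo t ht, hθo t ht, ← map_smul, ← map_sum]
    conv_rhs => rw [← ofModel_toModel (hsrc t ht) v]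
    congr 1
    exact (EuclideanSpace.basisFun (Fin n) ℝ).toBasis.sum_repr _ |> fun h => by simpa using h
  have hdual : ∀ t ∈ O ∩ γ.J, ∀ i (c : Fin n → ℝ), θ i t (∑ j, c j • E j t) = c i := by
    intro t ht i c
    simp only [hEo t ht, hθo t ht, ← map_smul, ← map_sum]
    rw [toModel_ofModel (hsrc t ht)]
    simp [Pi.single_apply]
  have hθ1 : ∀ i, IsClassCovec ((k : ℕ∞ω) + 1) (θ i) := hθ _ le_rfl
  let Γ : ℝ → Matrix (Fin n) (Fin n) ℝ := fun s => Matrix.of fun i j => θ i s (D.vec (E j) s)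
  have hΓ : ∀ i j, ContDiffOn ℝ (k : ℕ∞ω) (fun s => Γ s i j) γ.J := fun i j =>
    D.contDiffOn_apply_vec (hE j) (hθ _ le_self_add i)
  obtain ⟨U, hUO, hUopen, htU⟩ := mem_nhds_iff.1 hO
  obtain ⟨ε, hε, hεU⟩ := Metric.isOpen_iff.1 hUopen t₀ htU
  -- An open ball inside `O`, so that the coordinate frame is valid in a whole relative
  -- neighbourhood of each parameter of `B` and derivatives may be computed in it.
  set B := Metric.ball t₀ ε
  have hBc : B.OrdConnected := by
    simp only [B, Real.ball_eq_Ioo]; exact ordConnected_Ioo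
  have hBO : B ⊆ O := hεU.trans hUO
  have hBmem : ∀ s ∈ B, ∀ᶠ t in 𝓝[γ.J] s, t ∈ O ∩ γ.J := fun s hs => by
    filter_upwards [mem_nhdsWithin_of_mem_nhds (Metric.isOpen_ball.mem_nhds hs),
      self_mem_nhdsWithin] with t h1 h2
    exact ⟨hBO h1, h2⟩
  have hvec : ∀ s ∈ B ∩ γ.J, ∀ Z : VectorField γ, IsClassVec ((k : ℕ∞ω) + 1) Z → ∀ i,
      θ i s (D.vec Z s) = derivWithin (fun t => θ i t (Z t)) γ.J s -
        negMulVec (Γ s) (fun j => θ j s (Z s)) i := by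
    intro s hs Z hZ i
    rw [D.coframe_vec hE hθ1 hs.2 ((hBmem s hs.1).mono hsum) (hdual s ⟨hBO hs.1, hs.2⟩) hZ,
      negMulVec_apply, sub_neg_eq_add]
    rfl
  refine ⟨B, Metric.ball_mem_nhds _ hε, hBc, ?_, ?_⟩
  · intro s hs v
    obtain ⟨x, hx0, hx⟩ := exists_linearODE γ.ordConnected
      (contDiffOn_negMulVec hΓ).continuousOn hs.2 (fun i => θ i s v)
    have hxk := contDiffOn_pi.1
      (linearODE_contDiffOn γ.uniqueDiffOn (contDiffOn_negMulVec hΓ) hx)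
    have hZ : IsClassVec ((k : ℕ∞ω) + 1) (fun t => ∑ i, x t i • E i t : VectorField γ) :=
      IsClassVec.sum le_rfl _ fun i _ => (hE i).smul le_rfl (hxk i)
    refine ⟨fun t => ∑ i, x t i • E i t, ?_, fun r hr => ⟨_, hZ, Eventually.of_forall
      fun _ => rfl, ?_⟩⟩
    · simp only [hx0]
      exact hsum s ⟨hBO hs.1, hs.2⟩ v
    · have hrO : r ∈ O ∩ γ.J := ⟨hBO hr.1, hr.2⟩
      rw [← hsum r hrO (D.vec _ r)]
      refine Finset.sum_eq_zero fun i _ => ?_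
      rw [hvec r hr _ hZ]
      simp only [hdual r hrO]
      have : derivWithin (fun t => θ i t (∑ j, x t j • E j t)) γ.J r =
          negMulVec (Γ r) (x r) i := by
        have h1 := (hasDerivWithinAt_pi.1 (hx r hr.2) i)
        rw [← h1.derivWithin (γ.uniqueDiffOn r hr.2)]
        refine Filter.EventuallyEq.derivWithin_eq ?_ (hdual r hrO i _)
        filter_upwards [hBmem r hr.1] with t ht
        exact hdual t ht i _
      rw [this]
      simp
  · intro I hI hIc X X' hX hX' s hs s' hs' h
    have hIJ : I ⊆ γ.J := hI.trans inter_subset_right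
    have hode : ∀ X : VectorField γ, (∀ r ∈ I, D.IsParallelAt X r) → ∀ r ∈ I,
        HasDerivWithinAt (fun t i => θ i t (X t))
          (negMulVec (Γ r) (fun i => θ i r (X r))) I r := by
      intro X hX r hr
      obtain ⟨Z, hZ, hXZ, hZ0⟩ := hX r hr
      refine HasDerivWithinAt.mono ?_ hIJ
      refine hasDerivWithinAt_pi.2 fun i => ?_
      have h1 := hvec r (hI hr) Z hZ i
      have hXr := hXZ.self_of_nhdsWithin (hIJ hr)
      rw [hZ0, map_zero, eq_comm, sub_eq_zero] at h1
      rw [hXr, ← h1]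
      have h2 : HasDerivWithinAt (fun t => θ i t (Z t)) (derivWithin (fun t => θ i t (Z t)) γ.J r)
          γ.J r :=
        ((hθ1 i Z hZ).differentiableOn (by simp) r (hIJ hr)).hasDerivWithinAt
      refine h2.congr_of_eventuallyEq ?_ (by rw [hXr])
      filter_upwards [hXZ] with t ht
      rw [ht]
    have h3 := linearODE_unique hIc ((contDiffOn_negMulVec hΓ).continuousOn.mono hIJ)
      (hode X hX) (hode X' hX') hs hs' (by simp only [h])
    have hmem : s' ∈ O ∩ γ.J := ⟨hBO (hI hs').1, hIJ hs'⟩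
    rw [← hsum s' hmem (X s'), ← hsum s' hmem (X' s')]
    exact Finset.sum_congr rfl fun i _ => by rw [congrFun h3 i]

/-- Every vector at one point of a path extends to a vector field along the path whose derivative
vanishes. -/
theorem DerivationAlong.exists_parallel {s₀ : ℝ} (hs₀ : s₀ ∈ γ.J) (v : Tan n (γ.toFun s₀)) :
    ∃ X : VectorField γ, X s₀ = v ∧ IsClassVec ((k : ℕ∞ω) + 1) X ∧
      ∀ s ∈ γ.J, D.vec X s = 0 := by
  obtain ⟨X, hX0, hX⟩ := exists_of_locally_solvable (F := fun s => Tan n (γ.toFun s))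
    (L := D.IsParallelAt) γ.ordConnected (by
      rintro X X' s hs h ⟨Z, hZ, hXZ, hZ0⟩
      refine ⟨Z, hZ, ?_, hZ0⟩
      filter_upwards [h, hXZ] with t h1 h2
      rw [← h1, h2]) (fun t ht => D.exists_parallel_local ht) hs₀ v
  have hXc : IsClassVec ((k : ℕ∞ω) + 1) X := fun s hs => by
    obtain ⟨Z, hZ, hXZ, -⟩ := hX s hs
    exact (hZ.at hs).congr hs hXZ
  refine ⟨X, hX0, hXc, fun s hs => ?_⟩
  obtain ⟨Z, hZ, hXZ, hZ0⟩ := hX s hs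
  rw [D.vec_congr hXc hZ hs hXZ, hZ0]

/-- A vector field with vanishing derivative which vanishes at one parameter is zero. -/
theorem DerivationAlong.parallel_eq_zero {X : VectorField γ}
    (hX : IsClassVec ((k : ℕ∞ω) + 1) X) (h : ∀ s ∈ γ.J, D.vec X s = 0) {s s' : ℝ}
    (hs : s ∈ γ.J) (hs' : s' ∈ γ.J) (h0 : X s = 0) : X s' = 0 := by
  refine eq_of_locally_unique (F := fun s => Tan n (γ.toFun s)) (L := D.IsParallelAt) (J := γ.J)
    (fun t ht => ?_) γ.ordConnected subset_rfl (X' := fun _ => 0)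
    (fun r hr => ⟨X, hX, Eventually.of_forall fun _ => rfl, h r hr⟩)
    (fun r hr => ⟨fun _ => 0, fun t ht => isClassVecAt_zero le_rfl ht,
      Eventually.of_forall fun _ => rfl, D.vec_zero hr⟩) hs hs' h0
  obtain ⟨O, h1, h2, -, h3⟩ := D.exists_parallel_local ht
  exact ⟨O, h1, h2, h3⟩

/-- Every derivation along a path admits a normal frame. -/
theorem DerivationAlong.exists_isNormalAlong : ∃ e, IsFrameAlong γ e ∧ IsNormalAlong D e := by
  obtain ⟨s₀, hs₀⟩ := γ.nontrivial.nonempty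
  choose e he0 hec hep using fun i => D.exists_parallel hs₀ (coordBasis (γ.toFun s₀) i)
  refine ⟨e, isFrameAlong_of_linearIndependent hec fun s hs => ?_,
    (isNormalAlong_iff D).2 fun s hs j => hep j s hs⟩
  rw [Fintype.linearIndependent_iff]
  intro c hc
  -- A constant combination of parallel fields is parallel. A linear relation at `s` thus persists
  -- at `s₀`, where the fields form a basis.
  have hX : IsClassVec ((k : ℕ∞ω) + 1) (fun t => ∑ i, c i • e i t : VectorField γ) :=
    IsClassVec.sum le_rfl _ fun i _ => (hec i).const_smul le_rfl (c i)
  have hX0 : ∀ t ∈ γ.J, D.vec (fun t => ∑ i, c i • e i t) t = 0 := by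
    intro t ht
    rw [D.vec_sum_smul (f := fun i _ => c i) (fun _ => contDiffOn_const) hec ht]
    simp [hep _ t ht]
  have h0 := D.parallel_eq_zero hX hX0 hs hs₀ hc
  simp only [he0] at h0
  exact Fintype.linearIndependent_iff.1 (coordBasis (γ.toFun s₀)).linearIndependent c h0

section

variable {e : Fin n → VectorField γ} (he : IsFrameAlong γ e)

theorem DerivationAlong.contDiffOn_components (i j : Fin n) :
    ContDiffOn ℝ (k : ℕ∞ω) (fun s => D.components he s i j) γ.J :=
  D.contDiffOn_apply_vec (he.isClass j) (he.isClassCovec_coframe le_self_add i)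

/-- The components in a frame of the derivative of a vector field along a path. -/
theorem DerivationAlong.coframe_vec_eq {Z : VectorField γ}
    (hZ : IsClassVec ((k : ℕ∞ω) + 1) Z) {s : ℝ} (hs : s ∈ γ.J) (i : Fin n) :
    he.coframe i s (D.vec Z s) = derivWithin (fun t => he.coframe i t (Z t)) γ.J s -
      negMulVec (D.components he s) (fun j => he.coframe j s (Z s)) i := by
  rw [D.coframe_vec he.isClass (he.isClassCovec_coframe le_rfl) hs ?_
    (fun i c => he.coframe_sum_smul hs c i) hZ, negMulVec_apply, sub_neg_eq_add]
  · rfl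
  · filter_upwards [self_mem_nhdsWithin] with t ht v
    exact he.sum_coframe_smul ht v

theorem DerivationAlong.vec_eq_zero_iff {Z : VectorField γ}
    (hZ : IsClassVec ((k : ℕ∞ω) + 1) Z) {s : ℝ} (hs : s ∈ γ.J) :
    D.vec Z s = 0 ↔ HasDerivWithinAt (fun t i => he.coframe i t (Z t))
      (negMulVec (D.components he s) (fun j => he.coframe j s (Z s))) γ.J s := by
  have h2 : ∀ i, HasDerivWithinAt (fun t => he.coframe i t (Z t))
      (derivWithin (fun t => he.coframe i t (Z t)) γ.J s) γ.J s := fun i =>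
    ((he.isClassCovec_coframe le_rfl i Z hZ).differentiableOn (by simp) s hs).hasDerivWithinAt
  rw [hasDerivWithinAt_pi]
  constructor
  · intro h i
    have h1 := D.coframe_vec_eq he hZ hs i
    rw [h, map_zero, eq_comm, sub_eq_zero] at h1
    rw [← h1]
    exact h2 i
  · intro h
    rw [← he.sum_coframe_smul hs (D.vec Z s)]
    refine Finset.sum_eq_zero fun i _ => ?_
    rw [D.coframe_vec_eq he hZ hs, (h i).derivWithin (γ.uniqueDiffOn s hs), sub_self, zero_smul]

/-- The general form of the frames normal for a derivation along a fixed path. -/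
theorem DerivationAlong.isNormalAlong_iff_exists {s₀ : ℝ} (hs₀ : s₀ ∈ γ.J)
    {Y : ℝ → Matrix (Fin n) (Fin n) ℝ} (hY : IsFundamentalSolution γ (D.components he) s₀ Y)
    (e' : Fin n → VectorField γ) :
    (IsFrameAlong γ e' ∧ IsNormalAlong D e') ↔
      ∃ B : GL (Fin n) ℝ, ∀ s ∈ γ.J, ∀ j,
        e' j s = ∑ i, (Y s * (B : Matrix (Fin n) (Fin n) ℝ)) i j • e i s := by
  have hΓ := D.contDiffOn_components he
  rw [isNormalAlong_iff]
  constructor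
  · rintro ⟨he', hn⟩
    -- Since `Y s₀ = 1`, the only candidate is the matrix of the frame `e'` relative to `e` at `s₀`.
    let B : Matrix (Fin n) (Fin n) ℝ := Matrix.of fun i j => he.coframe i s₀ (e' j s₀)
    have hB : IsUnit B := by
      rw [← Matrix.mulVec_injective_iff_isUnit, ← Matrix.coe_mulVecLin, ← LinearMap.ker_eq_bot,
        LinearMap.ker_eq_bot']
      intro v hv
      have h0 : ∑ j, v j • e' j s₀ = 0 := by
        rw [← he.sum_coframe_smul hs₀ (∑ j, v j • e' j s₀)]
        refine Finset.sum_eq_zero fun i _ => ?_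
        have := congrFun hv i
        simp only [Matrix.mulVecLin_apply, Matrix.mulVec, dotProduct, B, Matrix.of_apply,
          Pi.zero_apply] at this
        rw [map_sum]
        simp only [map_smul, smul_eq_mul]
        simp_rw [mul_comm (v _)]
        rw [this, zero_smul]
      funext j
      exact Fintype.linearIndependent_iff.1 (he'.linearIndependent s₀ hs₀) v h0 j
    refine ⟨hB.unit, fun s hs j => ?_⟩
    have h1 := hY.eq_mulVec hΓ hs₀ (x := fun t i => he.coframe i t (e' j t))
      (fun r hr => (D.vec_eq_zero_iff he (he'.isClass j) hr).1 (hn r hr j)) hs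
    rw [← he.sum_coframe_smul hs (e' j s)]
    refine Finset.sum_congr rfl fun i _ => ?_
    rw [congrFun h1 i]
    rfl
  · rintro ⟨B, hB⟩
    have hcoef : ∀ s ∈ γ.J, ∀ j, (fun i => he.coframe i s (e' j s)) =
        (Y s).mulVec (fun i => (B : Matrix (Fin n) (Fin n) ℝ) i j) := by
      intro s hs j
      funext i
      rw [hB s hs j, he.coframe_sum_smul hs]
      rfl
    have hcl : ∀ j, IsClassVec ((k : ℕ∞ω) + 1) (e' j) := by
      intro j
      have h1 : IsClassVec ((k : ℕ∞ω) + 1) (fun t => ∑ i, (Y t).mulVec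
          (fun i => (B : Matrix (Fin n) (Fin n) ℝ) i j) i • e i t : VectorField γ) :=
        IsClassVec.sum le_rfl _ fun i _ => (he.isClass i).smul le_rfl (hY.contDiffOn hΓ _ i)
      intro s hs
      refine (h1.at hs).congr hs ?_
      filter_upwards [self_mem_nhdsWithin] with t ht
      rw [hB t ht j]
      rfl
    refine ⟨isFrameAlong_of_linearIndependent hcl fun s hs => ?_, fun s hs j => ?_⟩
    · rw [Fintype.linearIndependent_iff]
      intro c hc
      have hu : IsUnit (Y s * (B : Matrix (Fin n) (Fin n) ℝ)) :=
        (hY.isUnit hΓ hs₀ hs).mul B.isUnit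
      have h0 : (Y s * (B : Matrix (Fin n) (Fin n) ℝ)).mulVec c = 0 := by
        funext i
        have := congrArg (he.coframe i s) hc
        simp only [map_sum, map_smul, map_zero, hB s hs, he.coframe_sum_smul hs,
          smul_eq_mul] at this
        rw [Matrix.mulVec, dotProduct]
        simp_rw [mul_comm _ (c _)]
        simpa [he.coframe_sum_smul hs] using this
      have := Matrix.mulVec_injective_iff_isUnit.2 hu (a₁ := c) (a₂ := 0) (by simp [h0])
      exact congrFun this
    · rw [D.vec_eq_zero_iff he (hcl j) hs, hcoef s hs j]
      refine (hY.mulVec_hasDerivWithinAt _ hs).congr (fun t ht => ?_) ?_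
      · exact hcoef t ht j
      · exact hcoef s hs j

end

end FixedPath

/-! ### A local diffeomorphism with prescribed differential along a curve -/

section Straightening

variable {E F : Type*} [NormedAddCommGroup E] [NormedSpace ℝ E] [NormedAddCommGroup F]
  [NormedSpace ℝ F] [CompleteSpace E] {m : ℕ∞ω}

/-- The inverse function theorem, with the class of differentiability on the whole domain. -/
theorem exists_openPartialHomeomorph_of_contDiffOn (hm : m ≠ 0) {f : E → F} {U : Set E}
    (hU : IsOpen U) (hf : ContDiffOn ℝ m f U) {a : E} (ha : a ∈ U) {f' : E ≃L[ℝ] F}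
    (hf' : HasFDerivAt f (f' : E →L[ℝ] F) a) :
    ∃ φ : OpenPartialHomeomorph E F, a ∈ φ.source ∧ φ.source ⊆ U ∧ (φ : E → F) = f ∧
      ContDiffOn ℝ m φ φ.source ∧ ContDiffOn ℝ m φ.symm φ.target := by
  have hfa := hf.contDiffAt (hU.mem_nhds ha)
  let φ₀ := hfa.toOpenPartialHomeomorph f hf' hm
  have h1 : ContinuousOn (fderiv ℝ f) U :=
    hf.continuousOn_fderiv_of_isOpen hU (ENat.one_le_iff_ne_zero_withTop.2 hm)
  have hR : IsOpen (range ((↑) : (E ≃L[ℝ] F) → E →L[ℝ] F)) := ContinuousLinearEquiv.isOpen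
  -- Shrinking the domain to points with invertible differential makes the inverse of class `C^m` on
  -- its whole domain, not only near the image of `a`.
  let U' := U ∩ fderiv ℝ f ⁻¹' range ((↑) : (E ≃L[ℝ] F) → E →L[ℝ] F)
  have hU' : IsOpen U' := h1.isOpen_inter_preimage hU hR
  let φ := φ₀.restrOpen U' hU'
  have hφs : φ.source = φ₀.source ∩ U' := φ₀.restrOpen_source U' hU'
  have hφf : (φ : E → F) = f := rfl
  have hsub : φ.source ⊆ U := by rw [hφs]; exact fun y hy => hy.2.1
  refine ⟨φ, ?_, hsub, hφf, hφf ▸ hf.mono hsub, fun y hy => ?_⟩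
  · rw [hφs]
    exact ⟨hfa.mem_toOpenPartialHomeomorph_source hf' hm, ha, f', hf'.fderiv.symm⟩
  · have hys := φ.map_target hy
    have hyU' : φ.symm y ∈ U' := by rw [hφs] at hys; exact hys.2
    obtain ⟨g, hg⟩ := hyU'.2
    have hc := hf.contDiffAt (hU.mem_nhds hyU'.1)
    refine (φ.contDiffAt_symm hy (f₀' := g) ?_ (hφf ▸ hc)).contDiffWithinAt
    rw [hφf, hg]
    exact (hc.differentiableAt hm).hasFDerivAt

theorem exists_primitive {g : ℝ → F} [CompleteSpace F] {s₀ ε : ℝ}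
    (hg : ContinuousOn g (Metric.ball s₀ ε)) :
    ∃ c : ℝ → F, ∀ s ∈ Metric.ball s₀ ε, HasDerivAt c (g s) s := by
  refine ⟨fun s => ∫ t in s₀..s, g t, fun s hs => ?_⟩
  have hε : 0 < ε := dist_nonneg.trans_lt hs
  have hord : (Metric.ball s₀ ε).OrdConnected := by
    rw [Real.ball_eq_Ioo]; exact ordConnected_Ioo
  have hsub : uIcc s₀ s ⊆ Metric.ball s₀ ε :=
    hord.uIcc_subset (Metric.mem_ball_self hε) hs
  exact intervalIntegral.integral_hasDerivAt_right (hg.mono hsub).intervalIntegrable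
    (hg.stronglyMeasurableAtFilter Metric.isOpen_ball s hs)
    (hg.continuousAt (Metric.isOpen_ball.mem_nhds hs))

end Straightening

section Straightening

variable {E : Type*} [NormedAddCommGroup E] [InnerProductSpace ℝ E] [CompleteSpace E]

/-- The map is `f(y) = c(r(y)) + A(r(y))(y - x(r(y)))` with `c' = A x'` and `r(x(s)) = s`. At `x(s)`
the derivative of `A` meets the factor `0`, and `c' dr` cancels `A x' dr`, leaving `A(s)`. The
primitive `c` has class `C^(k+1)` because `A x'` has class `C^k`, so no derivative is lost. -/
theorem exists_openPartialHomeomorph_along_curve {k : ℕ∞} {x : ℝ → E} {A : ℝ → E →L[ℝ] E}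
    {U : Set ℝ} (hU : IsOpen U) {s₀ : ℝ} (hs₀ : s₀ ∈ U) (hx : ContDiffOn ℝ ((k : ℕ∞ω) + 1) x U)
    (hA : ContDiffOn ℝ ((k : ℕ∞ω) + 1) A U) (hx' : deriv x s₀ ≠ 0) {A₀ : E ≃L[ℝ] E}
    (hA₀ : A s₀ = A₀) :
    ∃ φ : OpenPartialHomeomorph E E, ContDiffOn ℝ ((k : ℕ∞ω) + 1) φ φ.source ∧
      ContDiffOn ℝ ((k : ℕ∞ω) + 1) φ.symm φ.target ∧
      ∀ᶠ s in 𝓝 s₀, x s ∈ φ.source ∧ HasFDerivAt φ (A s) (x s) := by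
  have hm : ((k : ℕ∞ω) + 1) ≠ 0 := by simp
  obtain ⟨ε, hε, hεU⟩ := Metric.isOpen_iff.1 hU s₀ hs₀
  set B := Metric.ball s₀ ε
  have hBo : IsOpen B := Metric.isOpen_ball
  have hsB : s₀ ∈ B := Metric.mem_ball_self hε
  have hxB := hx.mono hεU
  have hAB := hA.mono hεU
  have hxd : ∀ s ∈ B, HasDerivAt x (deriv x s) s := fun s hs =>
    ((hxB.contDiffAt (hBo.mem_nhds hs)).differentiableAt hm).hasDerivAt
  have hAd : ∀ s ∈ B, HasDerivAt A (deriv A s) s := fun s hs =>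
    ((hAB.contDiffAt (hBo.mem_nhds hs)).differentiableAt hm).hasDerivAt
  have hdx : ContDiffOn ℝ (k : ℕ∞ω) (deriv x) B :=
    ((contDiffOn_succ_iff_deriv_of_isOpen hBo).1 hxB).2.2
  have hg : ContDiffOn ℝ (k : ℕ∞ω) (fun s => A s (deriv x s)) B :=
    (hAB.of_le le_self_add).clm_apply hdx
  obtain ⟨c, hc⟩ := exists_primitive hg.continuousOn
  have hcB : ContDiffOn ℝ ((k : ℕ∞ω) + 1) c B := by
    refine (contDiffOn_succ_iff_deriv_of_isOpen hBo).2
      ⟨fun s hs => (hc s hs).differentiableAt.differentiableWithinAt, by simp, ?_⟩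
    exact hg.congr fun s hs => (hc s hs).deriv
  -- The projection onto the initial velocity is strictly monotone along the curve near `s₀`;
  -- inverting it there recovers the parameter, which gives `r`.
  set ℓ : E →L[ℝ] ℝ := innerSL ℝ (deriv x s₀)
  have hh : ContDiffOn ℝ ((k : ℕ∞ω) + 1) (fun s => ℓ (x s)) B :=
    ℓ.contDiff.comp_contDiffOn hxB
  have hl0 : ℓ (deriv x s₀) ≠ 0 := by simpa [ℓ] using hx'
  have hh' : HasFDerivAt (fun s => ℓ (x s))
      ((ContinuousLinearEquiv.unitsEquivAut ℝ (Units.mk0 _ hl0) : ℝ ≃L[ℝ] ℝ) : ℝ →L[ℝ] ℝ) s₀ := by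
    refine (ℓ.hasFDerivAt.comp_hasDerivAt s₀ (hxd s₀ hsB)).hasFDerivAt.congr_fderiv ?_
    ext
    simp
  obtain ⟨σ, hσ₀, hσB, hσf, -, hσ⟩ :=
    exists_openPartialHomeomorph_of_contDiffOn hm hBo hh hsB hh'
  set r : E → ℝ := fun y => σ.symm (ℓ y)
  set V : Set E := ℓ ⁻¹' σ.target
  have hV : IsOpen V := σ.open_target.preimage ℓ.continuous
  have hr : ContDiffOn ℝ ((k : ℕ∞ω) + 1) r V :=
    hσ.comp ℓ.contDiff.contDiffOn fun y hy => hy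
  have hrB : MapsTo r V B := fun y hy => hσB (σ.map_target hy)
  have hxV : ∀ s ∈ σ.source, x s ∈ V := fun s hs => by
    have := σ.map_source hs
    rwa [hσf] at this
  have hrx : ∀ s ∈ σ.source, r (x s) = s := fun s hs => by
    have := σ.left_inv hs
    rwa [hσf] at this
  let f : E → E := fun y => c (r y) + A (r y) (y - x (r y))
  have hf : ContDiffOn ℝ ((k : ℕ∞ω) + 1) f V :=
    (hcB.comp hr hrB).add ((hAB.comp hr hrB).clm_apply
      (contDiffOn_id.sub (hxB.comp hr hrB)))
  have hf' : ∀ s ∈ σ.source, HasFDerivAt f (A s) (x s) := by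
    intro s hs
    have hsB' := hσB hs
    have hr' := ((hr.contDiffAt (hV.mem_nhds (hxV s hs))).differentiableAt hm).hasFDerivAt
    have hrs := hrx s hs
    have h1 := (show HasDerivAt c _ (r (x s)) from hrs.symm ▸ hc s hsB').hasFDerivAt.comp (x s) hr'
    have h2 := (show HasDerivAt A _ (r (x s)) from hrs.symm ▸ hAd s hsB').hasFDerivAt.comp (x s) hr'
    have h3 := (show HasDerivAt x _ (r (x s)) from hrs.symm ▸ hxd s hsB').hasFDerivAt.comp (x s) hr'
    refine (h1.add (h2.clm_apply ((hasFDerivAt_id (x s)).sub h3))).congr_fderiv ?_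
    ext y
    simp [hrs]
  obtain ⟨φ, hφ₀, -, hφf, hφ, hφs⟩ := exists_openPartialHomeomorph_of_contDiffOn hm hV hf
    (hxV s₀ hσ₀) (hA₀ ▸ hf' s₀ hσ₀)
  refine ⟨φ, hφ, hφs, ?_⟩
  filter_upwards [(hxd s₀ hsB).continuousAt (φ.open_source.mem_nhds hφ₀),
    σ.open_source.mem_nhds hσ₀] with s h1 h2
  exact ⟨h1, hφf ▸ hf' s h2⟩

end Straightening

/-! ### Charts adapted to a frame along a path -/

theorem mem_maximalAtlas_trans {E N : Type*} [NormedAddCommGroup E] [NormedSpace ℝ E]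
    [TopologicalSpace N] [ChartedSpace E N] {m : ℕ∞ω} [IsManifold 𝓘(ℝ, E) m N]
    (x₀ : N) {φ : OpenPartialHomeomorph E E}
    (hφ : ContDiffOn ℝ m φ φ.source) (hφs : ContDiffOn ℝ m φ.symm φ.target) :
    chartAt E x₀ ≫ₕ φ ∈ IsManifold.maximalAtlas 𝓘(ℝ, E) m N := by
  have hG : φ ∈ contDiffGroupoid m 𝓘(ℝ, E) := by
    rw [contDiffGroupoid, mem_groupoid_of_pregroupoid]
    simpa [contDiffPregroupoid] using And.intro hφ hφs
  refine IsManifold.mem_maximalAtlas_iff.2 (mem_maximalAtlas_iff.2 fun e' he' => ⟨?_, ?_⟩)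
  · rw [OpenPartialHomeomorph.trans_symm_eq_symm_trans_symm, OpenPartialHomeomorph.trans_assoc]
    exact StructureGroupoid.trans _ (StructureGroupoid.symm _ hG)
      (HasGroupoid.compatible (chart_mem_atlas E x₀) he')
  · rw [← OpenPartialHomeomorph.trans_assoc]
    exact StructureGroupoid.trans _ (HasGroupoid.compatible he' (chart_mem_atlas E x₀)) hG

section Charts

variable {n : ℕ} {k : ℕ∞} {M : Type*} [TopologicalSpace M]
  [ChartedSpace (EuclideanSpace ℝ (Fin n)) M]

theorem CPath.mdifferentiableWithinAt (γ : CPath n k M) {s : ℝ} (hs : s ∈ γ.J) :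
    MDifferentiableWithinAt 𝓘(ℝ, ℝ) (𝓡 n) γ.toFun γ.J s :=
  (γ.contMDiffOn s hs).mdifferentiableWithinAt (by simp)

theorem CPath.uniqueMDiffWithinAt (γ : CPath n k M) {s : ℝ} (hs : s ∈ γ.J) :
    UniqueMDiffWithinAt 𝓘(ℝ, ℝ) γ.J s :=
  (γ.uniqueDiffOn s hs).uniqueMDiffWithinAt

variable [IsManifold (𝓡 n) 1 M] {γ : CPath n k M}

theorem toModel_eq_mfderiv {x₀ y : M}
    (hy : y ∈ (chartAt (EuclideanSpace ℝ (Fin n)) x₀).source) :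
    toModel x₀ y = mfderiv (𝓡 n) (𝓡 n) (chartAt (EuclideanSpace ℝ (Fin n)) x₀) y := by
  have h := TangentBundle.continuousLinearMapAt_trivializationAt (I := 𝓡 n) hy
  simpa [toModel, extChartAt] using! h

theorem mdifferentiableAt_chartAt {x₀ y : M}
    (hy : y ∈ (chartAt (EuclideanSpace ℝ (Fin n)) x₀).source) :
    MDifferentiableAt (𝓡 n) (𝓡 n) (chartAt (EuclideanSpace ℝ (Fin n)) x₀) y :=
  mdifferentiableAt_atlas (chart_mem_atlas _ x₀) hy

/-- The components of the velocity are the derivatives of the coordinates along the path. -/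
theorem toModel_velocity {s : ℝ} (hs : s ∈ γ.J) {x₀ : M}
    (h : γ.toFun s ∈ (chartAt (EuclideanSpace ℝ (Fin n)) x₀).source) :
    toModel x₀ (γ.toFun s) (γ.velocity s) =
      derivWithin (fun t => chartAt (EuclideanSpace ℝ (Fin n)) x₀ (γ.toFun t)) γ.J s := by
  have h1 := mfderiv_comp_mfderivWithin (x := s) (mdifferentiableAt_chartAt h)
    (γ.mdifferentiableWithinAt hs) (γ.uniqueMDiffWithinAt hs)
  rw [toModel_eq_mfderiv h, ← fderivWithin_derivWithin, ← mfderivWithin_eq_fderivWithin]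
  exact (congrArg (fun L => L (1 : ℝ)) h1).symm

theorem toModel_injective {x₀ y : M}
    (hy : y ∈ (chartAt (EuclideanSpace ℝ (Fin n)) x₀).source) :
    Function.Injective (toModel (n := n) x₀ y) := fun a b hab => by
  rw [← ofModel_toModel hy a, hab, ofModel_toModel hy]

variable [IsManifold (𝓡 n) ((k : ℕ∞ω) + 2) M]

/-- The holonomic extension of a frame along a path, near a parameter where the velocity does not
vanish. -/
theorem exists_chart_of_isFrameAlong {e : Fin n → VectorField γ} (he : IsFrameAlong γ e)
    {s₀ : ℝ} (hs₀ : s₀ ∈ γ.J) (hv : γ.velocity s₀ ≠ 0) :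
    ∃ φ ∈ IsManifold.maximalAtlas (𝓡 n) ((k : ℕ∞ω) + 1) M,
      ∀ᶠ s in 𝓝[γ.J] s₀, γ.toFun s ∈ φ.source ∧
        ∀ i, mfderiv (𝓡 n) (𝓡 n) φ (γ.toFun s) (e i s) = EuclideanSpace.single i (1 : ℝ) := by
  have : IsManifold (𝓡 n) ((k : ℕ∞ω) + 1) M :=
    IsManifold.of_le (n := (k : ℕ∞ω) + 2) (by gcongr; norm_num)
  set x₀ := γ.toFun s₀
  have hx₀ := mem_chart_source (EuclideanSpace ℝ (Fin n)) x₀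
  set ψ := chartAt (EuclideanSpace ℝ (Fin n)) x₀
  have hψ := γ.eventually_mem_source hs₀ hx₀
  obtain ⟨ε, hε, hεJ⟩ := Metric.nhdsWithin_basis_ball.eventually_iff.1 hψ
  set J' := Metric.ball s₀ ε ∩ γ.J
  have hJ' : J'.OrdConnected :=
    (show (Metric.ball s₀ ε).OrdConnected by
      rw [Real.ball_eq_Ioo]; exact ordConnected_Ioo).inter γ.ordConnected
  -- On `J'` the path stays in one chart; `J'` must again be a nondegenerate interval for the
  -- extension across an endpoint.
  have hs₀' : s₀ ∈ J' := ⟨Metric.mem_ball_self hε, hs₀⟩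
  have hnt : J'.Nontrivial := by
    obtain ⟨y, hy, hne⟩ := accPt_iff_nhds.1
      (uniqueDiffWithinAt_iff_accPt.1 (γ.uniqueDiffOn s₀ hs₀)) _ (Metric.ball_mem_nhds s₀ hε)
    exact ⟨y, hy, s₀, hs₀', hne⟩
  have hJJ : 𝓝[J'] s₀ = 𝓝[γ.J] s₀ := nhdsWithin_inter_of_mem
    (mem_nhdsWithin_of_mem_nhds (Metric.ball_mem_nhds s₀ hε))
  have hx : ContDiffOn ℝ ((k + 1 : ℕ∞) : ℕ∞ω) (fun t => ψ (γ.toFun t)) J' := by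
    intro t ht
    rw [← contMDiffWithinAt_iff_contDiffWithinAt]
    exact (contMDiffAt_of_mem_maximalAtlas (n := (k : ℕ∞ω) + 1)
      (IsManifold.chart_mem_maximalAtlas x₀) (hεJ ht)).comp_contMDiffWithinAt t ((γ.contMDiffOn t ht.2).mono inter_subset_right)
  have hw : ContDiffOn ℝ ((k + 1 : ℕ∞) : ℕ∞ω)
      (fun t i => toModel x₀ (γ.toFun t) (e i t)) J' :=
    contDiffOn_pi.2 fun i t ht => ((isClassVecAt_iff le_rfl ht.2 (hεJ ht)).1
      ((he.isClass i).at ht.2)).mono inter_subset_right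
  obtain ⟨X, ⟨U₁, hsU₁, hU₁, hX⟩, hXx⟩ := exists_contDiffAt_extension hJ' hnt hs₀' hx
  obtain ⟨W, ⟨U₂, hsU₂, hU₂, hW⟩, hWw⟩ := exists_contDiffAt_extension hJ' hnt hs₀' hw
  rw [hJJ] at hXx hWw
  have hcW : ContDiffOn ℝ ((k : ℕ∞ω) + 1) (fun t => combination (W t)) U₂ :=
    contDiff_combination.comp_contDiffOn hW
  have hli : LinearIndependent ℝ (W s₀) := by
    rw [hWw.self_of_nhdsWithin hs₀]
    exact (he.linearIndependent s₀ hs₀).map' (toModel x₀ (γ.toFun s₀)).toLinearMap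
      (LinearMap.ker_eq_bot.2 (toModel_injective hx₀))
  obtain ⟨A₀, hA₀⟩ := exists_equiv_combination hli
  let R := range ((↑) : (EuclideanSpace ℝ (Fin n) ≃L[ℝ] EuclideanSpace ℝ (Fin n)) →
    EuclideanSpace ℝ (Fin n) →L[ℝ] EuclideanSpace ℝ (Fin n))
  let U₃ := U₂ ∩ (fun t => combination (W t)) ⁻¹' R
  have hU₃ : IsOpen U₃ := hcW.continuousOn.isOpen_inter_preimage hU₂ ContinuousLinearEquiv.isOpen
  have hsU₃ : s₀ ∈ U₃ := ⟨mem_of_mem_nhds hsU₂, A₀, hA₀⟩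
  -- The differential required of the new coordinates: it sends the components of the frame vectors
  -- to the standard basis.
  let A : ℝ → EuclideanSpace ℝ (Fin n) →L[ℝ] EuclideanSpace ℝ (Fin n) :=
    fun t => (combination (W t)).inverse
  have hA : ContDiffOn ℝ ((k : ℕ∞ω) + 1) A U₃ := by
    rintro t ⟨ht, B, hB⟩
    have hinv : ContDiffAt ℝ ((k : ℕ∞ω) + 1) ContinuousLinearMap.inverse (combination (W t)) := by
      beta_reduce at hB
      rw [← hB]
      exact contDiffAt_map_inverse B
    exact hinv.comp_contDiffWithinAt t ((hcW t ht).mono inter_subset_left)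
  have hX' : deriv X s₀ ≠ 0 := by
    have hd : DifferentiableAt ℝ X s₀ := (hX.contDiffAt hsU₁).differentiableAt (by simp)
    -- The derivative of the extension at `s₀` is already fixed by its values on `J`, hence
    -- represents the velocity of the path even at an endpoint.
    rw [← hd.derivWithin (γ.uniqueDiffOn s₀ hs₀),
      EventuallyEq.derivWithin_eq hXx (hXx.self_of_nhdsWithin hs₀), ← toModel_velocity hs₀ hx₀]
    exact fun h => hv (toModel_injective hx₀ (by rw [h, map_zero]))
  obtain ⟨φ, hφ, hφs, hφA⟩ := exists_openPartialHomeomorph_along_curve (k := k)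
    (hU₁.inter hU₃) ⟨mem_of_mem_nhds hsU₁, hsU₃⟩ (hX.mono inter_subset_left)
    (hA.mono inter_subset_right) hX' (A₀ := A₀.symm) (by
      change (combination (W s₀)).inverse = _
      rw [← hA₀, ContinuousLinearMap.inverse_equiv])
  refine ⟨_, mem_maximalAtlas_trans x₀ hφ hφs, ?_⟩
  filter_upwards [hXx, hWw, hψ, mem_nhdsWithin_of_mem_nhds hφA,
    mem_nhdsWithin_of_mem_nhds (hU₃.mem_nhds hsU₃)] with s hs1 hs2 hs3 hs4 hs5
  obtain ⟨B, hB⟩ := hs5.2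
  rw [hs1] at hs4
  refine ⟨?_, fun i => ?_⟩
  · rw [OpenPartialHomeomorph.trans_source]
    exact ⟨hs3, hs4.1⟩
  · have h1 := mfderiv_comp (γ.toFun s) (I := 𝓡 n) (I' := 𝓡 n) (I'' := 𝓡 n)
      hs4.2.differentiableAt.mdifferentiableAt (mdifferentiableAt_chartAt hs3)
    have h2 : mfderiv (𝓡 n) (𝓡 n) (ψ ≫ₕ φ) (γ.toFun s) (e i s) =
        A s (toModel x₀ (γ.toFun s) (e i s)) := by
      rw [OpenPartialHomeomorph.coe_trans, h1, toModel_eq_mfderiv hs3, mfderiv_eq_fderiv,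
        hs4.2.fderiv]
      rfl
    have h3 : toModel x₀ (γ.toFun s) (e i s) =
        combination (W s) (EuclideanSpace.single i 1) := by
      simp [combination_apply, hs2]
    rw [h2, h3]
    change (combination (W s)).inverse _ = _
    beta_reduce at hB
    rw [← hB, ContinuousLinearMap.inverse_equiv]
    simp

end Charts

/-! ### Vector fields on the manifold and their coefficients in a frame -/

section Sections

variable {n : ℕ} {k : ℕ∞} {M : Type*} [TopologicalSpace M]
  [ChartedSpace (EuclideanSpace ℝ (Fin n)) M]
  {m : ℕ∞ω} {Z : ∀ y : M, TangentSpace (𝓡 n) y} {x : M}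

theorem eventually_mem_chart_source {x₀ : M}
    (hx : x ∈ (chartAt (EuclideanSpace ℝ (Fin n)) x₀).source) :
    ∀ᶠ y in 𝓝 x, y ∈ (chartAt (EuclideanSpace ℝ (Fin n)) x₀).source :=
  (chartAt _ x₀).open_source.mem_nhds hx

variable [IsManifold (𝓡 n) 1 M]

variable (m Z x) in
/-- The vector field `Z` is of class `C^m` at `x`. -/
abbrev IsFieldAt : Prop :=
  ContMDiffAt (𝓡 n) ((𝓡 n).prod 𝓘(ℝ, EuclideanSpace ℝ (Fin n))) m
    (fun y => TotalSpace.mk' (EuclideanSpace ℝ (Fin n)) y (Z y)) x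

variable (Z x) in
/-- The vector field `Z` is differentiable at `x`. -/
abbrev IsDifferentiableFieldAt : Prop :=
  MDifferentiableAt (𝓡 n) ((𝓡 n).prod 𝓘(ℝ, EuclideanSpace ℝ (Fin n)))
    (fun y => TotalSpace.mk' (EuclideanSpace ℝ (Fin n)) y (Z y)) x

/-- The extension of a tangent vector with constant components in the preferred chart. -/
theorem extend_eq_ofModel (v : Tan n x) {y : M}
    (hy : y ∈ (chartAt (EuclideanSpace ℝ (Fin n)) x).source) :
    FiberBundle.extend (EuclideanSpace ℝ (Fin n)) v y = ofModel x y (toModel x x v) := by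
  rw [toModel_eq_snd (mem_chart_source _ x), ofModel, Trivialization.symmL_apply _ hy]
  rfl

theorem coextend_apply (α : Cotan n x) (y : M) (v : Tan n y) :
    coextend α y v = α (ofModel x x (toModel x y v)) := rfl

/-- Both extensions have constant components in the same chart, so their pairing is constant. This
removes the derivative term when `covariantAlong` is evaluated on such fields. -/
theorem coextend_extend (α : Cotan n x) (v : Tan n x) {y : M}
    (hy : y ∈ (chartAt (EuclideanSpace ℝ (Fin n)) x).source) :
    coextend α y (FiberBundle.extend (EuclideanSpace ℝ (Fin n)) v y) = α v := by
  rw [coextend_apply, extend_eq_ofModel v hy, toModel_ofModel hy, ofModel_toModel (mem_chart_source _ x)]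

variable {e : Fin n → ∀ y : M, TangentSpace (𝓡 n) y} {W : Set M}

theorem linearIndependent_toModel
    (he : IsLocalFrameOn (𝓡 n) (EuclideanSpace ℝ (Fin n)) ((k : ℕ∞ω) + 1) e W) (hx : x ∈ W) :
    LinearIndependent ℝ fun j => toModel x x (e j x) :=
  (he.linearIndependent hx).map' (toModel x x).toLinearMap
    (LinearMap.ker_eq_bot.2 (toModel_injective (mem_chart_source _ x)))

theorem eventually_toModel_eq_sum (hW : IsOpen W)
    (he : IsLocalFrameOn (𝓡 n) (EuclideanSpace ℝ (Fin n)) ((k : ℕ∞ω) + 1) e W) (hx : x ∈ W) :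
    ∀ᶠ y in 𝓝 x, toModel x y (Z y) =
      ∑ i, (WithLp.toLp 2 fun i => he.coeff i y (Z y) : EuclideanSpace ℝ (Fin n)) i •
        toModel x y (e i y) := by
  filter_upwards [he.eventually_eq_sum_coeff_smul Z (hW.mem_nhds hx)] with y hy
  conv_lhs => rw [hy]
  simp

section

variable [IsManifold (𝓡 n) ((k : ℕ∞ω) + 2) M]

theorem contMDiffAt_field_iff (hm : m ≤ (k : ℕ∞ω) + 1) {x₀ : M}
    (hx : x ∈ (chartAt (EuclideanSpace ℝ (Fin n)) x₀).source) :
    IsFieldAt m Z x ↔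
      ContMDiffAt (𝓡 n) 𝓘(ℝ, EuclideanSpace ℝ (Fin n)) m (fun y => toModel x₀ y (Z y)) x := by
  have := contMDiffVectorBundle_tangent (M := M) (n := n) hm
  refine (Trivialization.contMDiffAt_section_iff
    (trivializationAt (EuclideanSpace ℝ (Fin n)) (TangentSpace (𝓡 n)) x₀) hx).trans ?_
  refine EventuallyEq.contMDiffAt_iff ?_
  filter_upwards [eventually_mem_chart_source hx] with y hy
  exact (toModel_eq_snd hy _).symm

theorem mdifferentiableAt_field_iff (k : ℕ∞) [IsManifold (𝓡 n) ((k : ℕ∞ω) + 2) M] {x₀ : M}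
    (hx : x ∈ (chartAt (EuclideanSpace ℝ (Fin n)) x₀).source) :
    IsDifferentiableFieldAt Z x ↔
      MDifferentiableAt (𝓡 n) 𝓘(ℝ, EuclideanSpace ℝ (Fin n)) (fun y => toModel x₀ y (Z y)) x := by
  have := contMDiffVectorBundle_tangent (M := M) (n := n) (k := k) (m := 1) le_add_self
  refine (Trivialization.mdifferentiableAt_section_iff (𝓡 n)
    (trivializationAt (EuclideanSpace ℝ (Fin n)) (TangentSpace (𝓡 n)) x₀) _ hx).trans ?_
  refine EventuallyEq.mdifferentiableAt_iff ?_
  filter_upwards [eventually_mem_chart_source hx] with y hy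
  exact (toModel_eq_snd hy _).symm

variable (k) in
theorem contMDiffAt_extend_field (v : Tan n x) {y : M}
    (hy : y ∈ (chartAt (EuclideanSpace ℝ (Fin n)) x).source) :
    IsFieldAt ((k : ℕ∞ω) + 1) (FiberBundle.extend (EuclideanSpace ℝ (Fin n)) v) y := by
  rw [contMDiffAt_field_iff le_rfl hy]
  refine contMDiffAt_const (c := toModel x x v) |>.congr_of_eventuallyEq ?_
  filter_upwards [eventually_mem_chart_source hy] with z hz
  rw [extend_eq_ofModel v hz, toModel_ofModel hz]

theorem contMDiffAt_coeff (hm : m ≤ (k : ℕ∞ω) + 1) (hW : IsOpen W)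
    (he : IsLocalFrameOn (𝓡 n) (EuclideanSpace ℝ (Fin n)) ((k : ℕ∞ω) + 1) e W) (hx : x ∈ W)
    (hZ : IsFieldAt m Z x) (i : Fin n) :
    ContMDiffAt (𝓡 n) 𝓘(ℝ, ℝ) m (fun y => he.coeff i y (Z y)) x := by
  have hxs := mem_chart_source (EuclideanSpace ℝ (Fin n)) x
  have h := contMDiffWithinAt_coefficients (I := 𝓡 n) (S := univ) (m := m)
    (w := fun y j => toModel x y (e j y))
    (c := fun y => WithLp.toLp 2 fun i => he.coeff i y (Z y))
    (fun j => ((contMDiffAt_field_iff hm hxs).1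
      ((he.contMDiffAt hW hx j).of_le hm)).contMDiffWithinAt)
    ((contMDiffAt_field_iff hm hxs).1 hZ).contMDiffWithinAt (mem_univ x)
    (linearIndependent_toModel he hx)
    (by rw [nhdsWithin_univ]; exact eventually_toModel_eq_sum hW he hx)
  rw [contMDiffWithinAt_univ] at h
  exact (EuclideanSpace.proj (𝕜 := ℝ) i : EuclideanSpace ℝ (Fin n) →L[ℝ] ℝ).contMDiff.contMDiffAt.comp
    x h

theorem mdifferentiableAt_coeff (hW : IsOpen W)
    (he : IsLocalFrameOn (𝓡 n) (EuclideanSpace ℝ (Fin n)) ((k : ℕ∞ω) + 1) e W) (hx : x ∈ W)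
    (hZ : IsDifferentiableFieldAt Z x) (i : Fin n) :
    MDifferentiableAt (𝓡 n) 𝓘(ℝ, ℝ) (fun y => he.coeff i y (Z y)) x := by
  have hxs := mem_chart_source (EuclideanSpace ℝ (Fin n)) x
  have h := mdifferentiableAt_coefficients (I := 𝓡 n)
    (w := fun y j => toModel x y (e j y))
    (c := fun y => WithLp.toLp 2 fun i => he.coeff i y (Z y))
    (fun j => (mdifferentiableAt_field_iff k hxs).1
      ((he.contMDiffAt hW hx j).mdifferentiableAt (by simp)))
    ((mdifferentiableAt_field_iff k hxs).1 hZ)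
    (linearIndependent_toModel he hx) (eventually_toModel_eq_sum hW he hx)
  exact (EuclideanSpace.proj (𝕜 := ℝ) i : EuclideanSpace ℝ (Fin n) →L[ℝ] ℝ)
    |>.mdifferentiableAt.comp x h

variable (k) in
/-- The coordinate frame of the preferred chart. -/
theorem isLocalFrameOn_extend (x : M) :
    IsLocalFrameOn (𝓡 n) (EuclideanSpace ℝ (Fin n)) ((k : ℕ∞ω) + 1)
      (fun a => FiberBundle.extend (EuclideanSpace ℝ (Fin n)) (coordBasis (n := n) x a))
      (chartAt (EuclideanSpace ℝ (Fin n)) x).source := by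
  have hli : ∀ y ∈ (chartAt (EuclideanSpace ℝ (Fin n)) x).source, LinearIndependent ℝ fun a =>
      (FiberBundle.extend (EuclideanSpace ℝ (Fin n)) (coordBasis x a) y : Tan n y) := by
    intro y hy
    have h1 : LinearIndependent ℝ fun a => toModel x x (coordBasis (n := n) x a) :=
      (coordBasis x).linearIndependent.map' (toModel x x).toLinearMap
        (LinearMap.ker_eq_bot.2 (toModel_injective (mem_chart_source _ x)))
    have h2 : LinearIndependent ℝ fun a => ofModel x y (toModel x x (coordBasis (n := n) x a)) :=
      h1.map' (ofModel x y).toLinearMap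
        (LinearMap.ker_eq_bot.2
          (Function.LeftInverse.injective (g := toModel (n := n) x y) (toModel_ofModel hy)))
    simpa only [extend_eq_ofModel _ hy] using h2
  refine ⟨fun hy => hli _ hy, fun {y} hy => ?_, fun a y hy =>
    (contMDiffAt_extend_field k (coordBasis x a) hy).contMDiffWithinAt⟩
  exact ((hli y hy).span_eq_top_of_card_eq_finrank' (by simp [finrank_tan])).ge

end

end Sections

/-! ### The flat connection of a frame -/

section Flat

variable {n : ℕ} {k : ℕ∞} {M : Type*} [TopologicalSpace M]
  [ChartedSpace (EuclideanSpace ℝ (Fin n)) M] [IsManifold (𝓡 n) 1 M]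
  {e : Fin n → ∀ y : M, TangentSpace (𝓡 n) y} {W : Set M}

/-- The connection for which a frame is parallel. -/
def flatConnection
    (he : IsLocalFrameOn (𝓡 n) (EuclideanSpace ℝ (Fin n)) ((k : ℕ∞ω) + 1) e W)
    (σ : ∀ x : M, Tan n x) (x : M) : Tan n x →L[ℝ] Tan n x :=
  ∑ i, (mvfderiv (𝓡 n) (fun y => he.coeff i y (σ y)) x).smulRight (e i x)

variable (he : IsLocalFrameOn (𝓡 n) (EuclideanSpace ℝ (Fin n)) ((k : ℕ∞ω) + 1) e W)

/-- The coefficients of a frame field in its own frame are the constants `0` and `1` near `x`. -/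
theorem flatConnection_frame (hW : IsOpen W) {x : M} (hx : x ∈ W) (j : Fin n) :
    flatConnection he (e j) x = 0 := by
  refine Finset.sum_eq_zero fun i _ => ?_
  have h : (fun y => he.coeff i y (e j y)) =ᶠ[𝓝 x] fun _ => if j = i then (1 : ℝ) else 0 := by
    filter_upwards [hW.mem_nhds hx] with y hy
    rw [he.coeff_apply_of_mem hy, ← he.toBasisAt_coe hy, Basis.repr_self, Finsupp.single_apply]
  have h2 : mvfderiv (𝓡 n) (fun y => he.coeff i y (e j y)) x = 0 := by
    rw [mvfderiv, h.mfderiv_eq]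
    rw [mfderiv_const]
    exact ContinuousLinearMap.comp_zero _
  rw [h2]
  ext v
  simp

variable [IsManifold (𝓡 n) ((k : ℕ∞ω) + 2) M]

theorem isCovariantDerivativeOn_flatConnection (hW : IsOpen W) :
    IsCovariantDerivativeOn (EuclideanSpace ℝ (Fin n)) (flatConnection he) W where
  add {σ σ' x} hσ hσ' hx := by
    simp only [flatConnection, Pi.add_apply, map_add]
    rw [← Finset.sum_add_distrib]
    refine Finset.sum_congr rfl fun i _ => ?_
    have h := mvfderiv_fun_add (mdifferentiableAt_coeff hW he hx hσ i)
      (mdifferentiableAt_coeff hW he hx hσ' i)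
    rw [h]
    ext v
    simp [add_smul]
  leibniz {σ g x} hσ hg hx := by
    simp only [flatConnection, Pi.smul_apply', map_smul]
    have h := fun i => mvfderiv_fun_smul hg (mdifferentiableAt_coeff hW he hx hσ i)
    simp only [h]
    ext v
    conv_rhs => rw [he.coeff_sum_eq σ hx]
    simp [Finset.sum_add_distrib, add_smul, Finset.smul_sum, mul_smul]

/-- One derivative is lost: fields of class `C^(k+1)` have coefficients of class `C^(k+1)`, and the
connection uses the differentials of these. -/
theorem isConnectionOn_flatConnection (hW : IsOpen W) :
    IsConnectionOn k (flatConnection he) W where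
  isOpen := hW
  isCovariantDerivativeOn := isCovariantDerivativeOn_flatConnection he hW
  contMDiff := ⟨fun {σ} hσ x₀ hx₀ => by
    have := contMDiffVectorBundle_tangent (M := M) (n := n) (k := k) (m := k) le_self_add
    have hσ' := (hσ x₀ hx₀).contMDiffAt (hW.mem_nhds hx₀)
    have hc := fun i => contMDiffAt_coeff le_rfl hW he hx₀ hσ' i
    refine ContMDiffAt.contMDiffWithinAt ?_
    rw [contMDiffAt_hom_bundle]
    refine ⟨contMDiffAt_id, ?_⟩
    have hs := mem_chart_source (EuclideanSpace ℝ (Fin n)) x₀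
    have h1 : ∀ i, ContMDiffAt (𝓡 n) 𝓘(ℝ, EuclideanSpace ℝ (Fin n)) (k : ℕ∞ω)
        (fun y => toModel x₀ y (e i y)) x₀ := fun i =>
      ((contMDiffAt_field_iff le_rfl hs).1 (he.contMDiffAt hW hx₀ i)).of_le le_self_add
    have h2 := fun i => (hc i).mfderiv_const (m := (k : ℕ∞ω)) le_rfl
    -- In the chart at `x₀` the derivative of `σ` is a sum of rank-one maps, each the differential
    -- of a coefficient times the components of a frame field.
    have h3 : ContMDiffAt (𝓡 n) 𝓘(ℝ, EuclideanSpace ℝ (Fin n) →L[ℝ] EuclideanSpace ℝ (Fin n))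
        (k : ℕ∞ω) (fun y => ∑ i, ((inTangentCoordinates (𝓡 n) 𝓘(ℝ, ℝ) id
          (fun y => he.coeff i y (σ y))
          (mfderiv (𝓡 n) 𝓘(ℝ, ℝ) fun y => he.coeff i y (σ y)) x₀ y).smulRight
            (toModel x₀ y (e i y)))) x₀ := by
      refine ContMDiffAt.sum fun i _ => ?_
      have hS : ContDiff ℝ (k : ℕ∞ω) fun p : (EuclideanSpace ℝ (Fin n) →L[ℝ] ℝ) ×
          EuclideanSpace ℝ (Fin n) => p.1.smulRight p.2 := contDiff_fst.smulRight contDiff_snd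
      exact hS.contMDiff.contMDiffAt.comp x₀ ((h2 i).prodMk_space (h1 i))
    refine h3.congr_of_eventuallyEq ?_
    filter_upwards [eventually_mem_chart_source hs] with y hy
    ext1 w
    have h4 : ∀ i, inTangentCoordinates (𝓡 n) 𝓘(ℝ, ℝ) id (fun y => he.coeff i y (σ y))
        (mfderiv (𝓡 n) 𝓘(ℝ, ℝ) fun y => he.coeff i y (σ y)) x₀ y w =
        mvfderiv (𝓡 n) (fun y => he.coeff i y (σ y)) y (ofModel x₀ y w) := by
      intro i
      simp only [inTangentCoordinates, ContinuousLinearMap.inCoordinates,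
        TangentBundle.continuousLinearMapAt_model_space]
      rfl
    rw [sum_apply]
    simp only [ContinuousLinearMap.smulRight_apply, h4]
    change toModel x₀ y (flatConnection he σ y (ofModel x₀ y w)) = _
    simp only [flatConnection, sum_apply, map_sum,
      ContinuousLinearMap.smulRight_apply, map_smul]⟩

end Flat

/-! ### Derivations along paths and connections on fields of the manifold -/

section Compare

variable {n : ℕ} {k : ℕ∞} {M : Type*} [TopologicalSpace M]
  [ChartedSpace (EuclideanSpace ℝ (Fin n)) M] {γ : CPath n k M} {s : ℝ}

theorem derivWithin_comp_path (hs : s ∈ γ.J) {f : M → ℝ}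
    (hf : MDifferentiableAt (𝓡 n) 𝓘(ℝ, ℝ) f (γ.toFun s)) :
    derivWithin (fun t => f (γ.toFun t)) γ.J s =
      mvfderiv (𝓡 n) f (γ.toFun s) (γ.velocity s) := by
  have h1 := mfderiv_comp_mfderivWithin (x := s) hf (γ.mdifferentiableWithinAt hs)
    (γ.uniqueMDiffWithinAt hs)
  rw [← fderivWithin_derivWithin, ← mfderivWithin_eq_fderivWithin]
  exact congrArg (fun L => L (1 : ℝ)) h1

theorem contDiffWithinAt_comp_path (hs : s ∈ γ.J) {f : M → ℝ}
    (hf : ContMDiffAt (𝓡 n) 𝓘(ℝ, ℝ) ((k : ℕ∞ω) + 1) f (γ.toFun s)) :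
    ContDiffWithinAt ℝ ((k : ℕ∞ω) + 1) (fun t => f (γ.toFun t)) γ.J s :=
  contMDiffWithinAt_iff_contDiffWithinAt.1 (hf.comp_contMDiffWithinAt s (γ.contMDiffOn s hs))

variable [IsManifold (𝓡 n) 1 M]

open Classical in
/-- The value at a parameter of a derivation along a path on a vector field that is defined on the
manifold near the point of the path. -/
def DerivationAlong.onField (D : DerivationAlong γ) (Z : ∀ y : M, TangentSpace (𝓡 n) y) (s : ℝ) :
    Tan n (γ.toFun s) :=
  if h : ∃ X : VectorField γ, IsClassVec ((k : ℕ∞ω) + 1) X ∧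
    ∀ᶠ t in 𝓝[γ.J] s, X t = Z (γ.toFun t) then D.vec h.choose s else 0

theorem DerivationAlong.onField_eq (D : DerivationAlong γ) {Z : ∀ y : M, TangentSpace (𝓡 n) y}
    (hs : s ∈ γ.J) {X : VectorField γ} (hX : IsClassVec ((k : ℕ∞ω) + 1) X)
    (h : ∀ᶠ t in 𝓝[γ.J] s, X t = Z (γ.toFun t)) : D.onField Z s = D.vec X s := by
  have hex : ∃ X : VectorField γ, IsClassVec ((k : ℕ∞ω) + 1) X ∧
    ∀ᶠ t in 𝓝[γ.J] s, X t = Z (γ.toFun t) := ⟨X, hX, h⟩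
  rw [onField, dif_pos hex]
  refine D.vec_congr hex.choose_spec.1 hX hs ?_
  filter_upwards [hex.choose_spec.2, h] with t h1 h2
  rw [h1, h2]

variable [IsManifold (𝓡 n) ((k : ℕ∞ω) + 2) M] {Z : ∀ y : M, TangentSpace (𝓡 n) y}

theorem exists_isClassVec_of_field (hs : s ∈ γ.J)
    (hZ : ∀ᶠ y in 𝓝 (γ.toFun s), IsFieldAt ((k : ℕ∞ω) + 1) Z y) :
    ∃ X : VectorField γ, IsClassVec ((k : ℕ∞ω) + 1) X ∧
      ∀ᶠ t in 𝓝[γ.J] s, X t = Z (γ.toFun t) := by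
  refine exists_isClassVec_eventuallyEq (X := fun t => Z (γ.toFun t)) le_rfl ?_
  filter_upwards [γ.eventually_mem hs hZ, self_mem_nhdsWithin] with t ht htJ
  exact ContMDiffAt.comp_contMDiffWithinAt (x := t) (g := fun y =>
    TotalSpace.mk' (EuclideanSpace ℝ (Fin n)) y (Z y)) ht (γ.contMDiffOn t htJ)

variable {ι : Type*} [Fintype ι] {f : ι → M → ℝ} {e : ι → ∀ y : M, TangentSpace (𝓡 n) y}

/-- Together with `IsConnectionOn.sum_smul` this shows that derivations and connections treat
combinations of fields alike: the chain rule turns `d/ds` into the differential applied to the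
velocity. -/
theorem DerivationAlong.onField_sum_smul (D : DerivationAlong γ) (hs : s ∈ γ.J)
    (hf : ∀ i, ∀ᶠ y in 𝓝 (γ.toFun s), ContMDiffAt (𝓡 n) 𝓘(ℝ, ℝ) ((k : ℕ∞ω) + 1) (f i) y)
    (he : ∀ i, ∀ᶠ y in 𝓝 (γ.toFun s), IsFieldAt ((k : ℕ∞ω) + 1) (e i) y)
    (hZ : ∀ᶠ y in 𝓝 (γ.toFun s), Z y = ∑ i, f i y • e i y) :
    D.onField Z s = ∑ i, (mvfderiv (𝓡 n) (f i) (γ.toFun s) (γ.velocity s) • e i (γ.toFun s) +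
      f i (γ.toFun s) • D.onField (e i) s) := by
  choose X hX hXe using fun i => exists_isClassVec_of_field hs (he i)
  -- The coefficients are of class `C^(k+1)` only near `γ(s)`, whereas the Leibniz rule needs
  -- functions of this class on all of `J`.
  obtain ⟨χ, hχ, hχ1, hχf⟩ := exists_bump_nhdsWithin (γ.eventually_mem hs (eventually_all.2 hf))
  have hF : ∀ i, ContDiffOn ℝ ((k : ℕ∞ω) + 1) (fun t => χ t * f i (γ.toFun t)) γ.J := fun i =>
    contDiffOn_mul_of_tsupport (add_one_le_infty k) hχ fun t ht htχ =>
      contDiffWithinAt_comp_path ht (hχf t ht htχ i)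
  have hχ1' : ∀ᶠ t in 𝓝[γ.J] s, χ t = 1 := mem_nhdsWithin_of_mem_nhds hχ1
  rw [D.onField_eq (X := fun t => ∑ i, (χ t * f i (γ.toFun t)) • X i t) hs
    (IsClassVec.sum le_rfl _ fun i _ => (hX i).smul le_rfl (hF i)), D.vec_sum_smul hF hX hs]
  · refine Finset.sum_congr rfl fun i _ => ?_
    have h1 : (fun t => χ t * f i (γ.toFun t)) =ᶠ[𝓝[γ.J] s] fun t => f i (γ.toFun t) := by
      filter_upwards [hχ1'] with t ht
      rw [ht, one_mul]
    rw [D.onField_eq hs (hX i) (hXe i), h1.derivWithin_eq (h1.self_of_nhdsWithin hs),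
      derivWithin_comp_path hs ((hf i).self_of_nhds.mdifferentiableAt (by simp)),
      hχ1.self_of_nhds, one_mul, (hXe i).self_of_nhdsWithin hs]
  · filter_upwards [hχ1', γ.eventually_mem hs hZ, eventually_all.2 hXe] with t h1 h2 h3
    rw [h2]
    exact Finset.sum_congr rfl fun i _ => by rw [h1, one_mul, h3]

variable {cov : (∀ x : M, Tan n x) → ∀ x : M, Tan n x →L[ℝ] Tan n x} {V : Set M} {x : M}

theorem IsConnectionOn.sum_smul (hcov : IsConnectionOn k cov V) (hx : x ∈ V)
    (hf : ∀ i, MDifferentiableAt (𝓡 n) 𝓘(ℝ, ℝ) (f i) x)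
    (he : ∀ i, IsDifferentiableFieldAt (e i) x) (hZ : ∀ᶠ y in 𝓝 x, Z y = ∑ i, f i y • e i y) :
    cov Z x = ∑ i, ((mvfderiv (𝓡 n) (f i) x).smulRight (e i x) + f i x • cov (e i) x) := by
  classical
  have := contMDiffVectorBundle_tangent (M := M) (n := n) (k := k) (m := 1) le_add_self
  have h1 : ∀ i, IsDifferentiableFieldAt (f i • e i) x := fun i => (hf i).smul_section (he i)
  have h2 : ∀ S : Finset ι, IsDifferentiableFieldAt (∑ i ∈ S, f i • e i) x ∧
      cov (∑ i ∈ S, f i • e i) x =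
        ∑ i ∈ S, ((mvfderiv (𝓡 n) (f i) x).smulRight (e i x) + f i x • cov (e i) x) := by
    intro S
    induction S using Finset.induction_on with
    | empty =>
      simp only [Finset.sum_empty]
      exact ⟨mdifferentiableAt_zeroSection .., hcov.isCovariantDerivativeOn.zero hx⟩
    | insert i S hi ih =>
      simp only [Finset.sum_insert hi]
      refine ⟨mdifferentiableAt_add_section (h1 i) ih.1, ?_⟩
      rw [hcov.isCovariantDerivativeOn.add (h1 i) ih.1 hx, ih.2,
        hcov.isCovariantDerivativeOn.leibniz (he i) (hf i) hx, add_comm (f i x • _)]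
  have h3 : ∀ᶠ y in 𝓝 x, (∑ i, f i • e i) y = Z y := by
    filter_upwards [hZ] with y hy
    rw [hy]
    simp
  rw [← (h2 Finset.univ).2]
  refine (hcov.isCovariantDerivativeOn.congr_of_eventuallyEq (h2 Finset.univ).1 ?_
    (hcov.isOpen.mem_nhds hx) h3).symm
  refine (h2 Finset.univ).1.congr_of_eventuallyEq ?_
  filter_upwards [h3] with y hy
  rw [hy]

/-- A derivation along a path agrees with a connection on all vector fields if it does on a
frame. -/
theorem DerivationAlong.onField_eq_of_frame (D : DerivationAlong γ) (hs : s ∈ γ.J)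
    (hcov : IsConnectionOn k cov V) (hx : γ.toFun s ∈ V)
    {e : Fin n → ∀ y : M, TangentSpace (𝓡 n) y} {W : Set M} (hW : IsOpen W)
    (he : IsLocalFrameOn (𝓡 n) (EuclideanSpace ℝ (Fin n)) ((k : ℕ∞ω) + 1) e W)
    (hxW : γ.toFun s ∈ W)
    (h : ∀ i, D.onField (e i) s = cov (e i) (γ.toFun s) (γ.velocity s))
    (hZ : ∀ᶠ y in 𝓝 (γ.toFun s), IsFieldAt ((k : ℕ∞ω) + 1) Z y) :
    D.onField Z s = cov Z (γ.toFun s) (γ.velocity s) := by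
  have hf : ∀ i, ∀ᶠ y in 𝓝 (γ.toFun s), ContMDiffAt (𝓡 n) 𝓘(ℝ, ℝ) ((k : ℕ∞ω) + 1)
      (fun y => he.coeff i y (Z y)) y := by
    intro i
    filter_upwards [hZ, hW.mem_nhds hxW] with y hy hyW
    exact contMDiffAt_coeff le_rfl hW he hyW hy i
  have he' : ∀ i, ∀ᶠ y in 𝓝 (γ.toFun s), IsFieldAt ((k : ℕ∞ω) + 1) (e i) y := fun i => by
    filter_upwards [hW.mem_nhds hxW] with y hy
    exact he.contMDiffAt hW hy i
  -- Expanded in the frame, both sides are the same expression in the coefficients, their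
  -- differentials and the derivatives of the frame fields, and the latter agree by `h`.
  have hZe := he.eventually_eq_sum_coeff_smul Z (hW.mem_nhds hxW)
  rw [D.onField_sum_smul hs hf he' hZe, hcov.sum_smul hx
    (fun i => (hf i).self_of_nhds.mdifferentiableAt (by simp))
    (fun i => (he' i).self_of_nhds.mdifferentiableAt (by simp)) hZe]
  simp [h]

end Compare

/-! ### Derivations along paths that are induced by a connection -/

section Induced

variable {n : ℕ} {k : ℕ∞} {M : Type*} [TopologicalSpace M]
  [ChartedSpace (EuclideanSpace ℝ (Fin n)) M] {γ : CPath n k M} {s : ℝ}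

theorem eventually_mem_chartAt (hs : s ∈ γ.J) : ∀ᶠ t in 𝓝[γ.J] s,
    γ.toFun t ∈ (chartAt (EuclideanSpace ℝ (Fin n)) (γ.toFun s)).source :=
  γ.eventually_mem_source hs (mem_chart_source _ _)

theorem derivWithin_eq_zero_of_eventually_eq {f : ℝ → ℝ} {c : ℝ} (hs : s ∈ γ.J)
    (h : ∀ᶠ t in 𝓝[γ.J] s, f t = c) : derivWithin f γ.J s = 0 := by
  rw [EventuallyEq.derivWithin_eq (f := fun _ => c) h (h.self_of_nhdsWithin hs)]
  simp

variable [IsManifold (𝓡 n) 1 M]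
  {cov : (∀ x : M, Tan n x) → ∀ x : M, Tan n x →L[ℝ] Tan n x}

theorem connectionMap_coordBasis (a : Fin n) :
    connectionMap cov γ s (coordBasis (γ.toFun s) a) =
      cov (FiberBundle.extend (EuclideanSpace ℝ (Fin n)) (coordBasis (γ.toFun s) a))
        (γ.toFun s) (γ.velocity s) := by
  rw [connectionMap, Basis.constr_basis]

/-- All covariant derivatives of the fields of a normal frame vanish. -/
theorem IsNormalForConnection.apply_eq_zero {U W : Set M} {e : Fin n → ∀ x : M, Tan n x}
    (he : IsFrameNear k U W e) (h : IsNormalForConnection cov e U) {x : M} (hx : x ∈ U)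
    (j : Fin n) : cov (e j) x = 0 := by
  let b := he.isLocalFrameOn.toBasisAt (he.subset hx)
  have h1 : (cov (e j) x).toLinearMap = 0 := b.ext fun i => by
    rw [he.isLocalFrameOn.toBasisAt_coe]
    exact h x hx i j
  ext1 v
  exact congrArg (fun L => L v) h1

variable [IsManifold (𝓡 n) ((k : ℕ∞ω) + 2) M]

theorem exists_isClassVec_extend (hs : s ∈ γ.J) (v : Tan n (γ.toFun s)) :
    ∃ X : VectorField γ, IsClassVec ((k : ℕ∞ω) + 1) X ∧ ∀ᶠ t in 𝓝[γ.J] s,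
      X t = FiberBundle.extend (EuclideanSpace ℝ (Fin n)) v (γ.toFun t) :=
  exists_isClassVec_of_field (Z := FiberBundle.extend (EuclideanSpace ℝ (Fin n)) v) hs
    ((eventually_mem_chart_source (mem_chart_source _ _)).mono fun _ hy =>
      contMDiffAt_extend_field k v hy)

theorem exists_isClassCovec_coextend (hs : s ∈ γ.J) (α : Cotan n (γ.toFun s)) :
    ∃ θ : CovectorField γ, IsClassCovec ((k : ℕ∞ω) + 1) θ ∧ ∀ᶠ t in 𝓝[γ.J] s,
      θ t = coextend α (γ.toFun t) := by
  obtain ⟨-, θ, -, hθ, O, hO, -, -, -, h⟩ := exists_local_frame γ hs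
  let c : Fin n → ℝ := fun j =>
    α (ofModel (γ.toFun s) (γ.toFun s) (EuclideanSpace.single j 1))
  refine ⟨fun t => ∑ j, c j • θ j t, fun X hX => ?_, ?_⟩
  · have h1 : ContDiffOn ℝ ((k : ℕ∞ω) + 1) (fun t => ∑ j, c j * θ j t (X t)) γ.J :=
      ContDiffOn.sum fun j _ => contDiffOn_const.mul (hθ _ le_rfl j X hX)
    exact h1.congr fun t _ => by simp
  · filter_upwards [mem_nhdsWithin_of_mem_nhds hO, self_mem_nhdsWithin] with t ht htJ
    ext v
    have h2 : toModel (γ.toFun s) (γ.toFun t) v =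
        ∑ j, toModel (γ.toFun s) (γ.toFun t) v j • EuclideanSpace.single j (1 : ℝ) := by
      ext i
      simp [Finset.sum_apply, Pi.single_apply]
    rw [coextend_apply, h2]
    simp [c, h t ⟨ht, htJ⟩, mul_comm]

variable {D : DerivationAlong γ}

/-- On a field with constant components the coordinate formula reduces to its connection term. -/
theorem DerivationAlong.onField_extend_of_forall (hs : s ∈ γ.J)
    (h : ∀ T : TensorField γ 1 0, IsClassTensor ((k : ℕ∞ω) + 1) T →
      ∀ α v, D.toFun T s α v = covariantAlong cov γ T s α v) (v : Tan n (γ.toFun s)) :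
    D.onField (FiberBundle.extend (EuclideanSpace ℝ (Fin n)) v) s = connectionMap cov γ s v := by
  obtain ⟨X, hX, hXv⟩ := exists_isClassVec_extend hs v
  rw [D.onField_eq hs hX hXv, D.vec_eq_iff]
  ext α w
  rw [onVec, h _ hX.tensor, covariantAlong, derivWithin_eq_zero_of_eventually_eq (c := α 0 v) hs]
  · simp [hXv.self_of_nhdsWithin hs]
  · filter_upwards [hXv, eventually_mem_chartAt hs] with t h1 h2
    rw [vectorTensor_apply, h1, coextend_extend _ _ h2]

theorem DerivationAlong.onField_extend_of_coordBasis (hs : s ∈ γ.J)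
    (h : ∀ a, D.onField (FiberBundle.extend (EuclideanSpace ℝ (Fin n))
      (coordBasis (γ.toFun s) a)) s = connectionMap cov γ s (coordBasis (γ.toFun s) a))
    (v : Tan n (γ.toFun s)) :
    D.onField (FiberBundle.extend (EuclideanSpace ℝ (Fin n)) v) s = connectionMap cov γ s v := by
  set b := coordBasis (n := n) (γ.toFun s)
  have hs' := eventually_mem_chart_source (mem_chart_source (EuclideanSpace ℝ (Fin n)) (γ.toFun s))
  rw [D.onField_sum_smul (f := fun a _ => b.repr v a)
    (e := fun a => FiberBundle.extend (EuclideanSpace ℝ (Fin n)) (b a)) hs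
    (fun a => Eventually.of_forall fun y => contMDiffAt_const)
    (fun a => hs'.mono fun y hy => contMDiffAt_extend_field k (b a) hy)]
  · have hv := congrArg (connectionMap cov γ s) (b.sum_repr v)
    rw [map_sum] at hv
    simpa [mvfderiv_const, h] using hv
  · filter_upwards [hs'] with y hy
    conv_lhs => rw [← b.sum_repr v]
    simp only [extend_eq_ofModel _ hy, map_sum, map_smul]

/-- Differentiating the constant pairing of a coextended covector with an extended vector gives `0`,
which forces minus the transpose of the action on vectors. -/
theorem DerivationAlong.covec_of_forall_extend (hs : s ∈ γ.J)
    (h : ∀ v : Tan n (γ.toFun s),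
      D.onField (FiberBundle.extend (EuclideanSpace ℝ (Fin n)) v) s = connectionMap cov γ s v)
    {α : Cotan n (γ.toFun s)} {θ : CovectorField γ} (hθ : IsClassCovec ((k : ℕ∞ω) + 1) θ)
    (hθα : ∀ᶠ t in 𝓝[γ.J] s, θ t = coextend α (γ.toFun t)) :
    D.covec θ s = -(α.comp (connectionMap cov γ s)) := by
  ext v
  obtain ⟨X, hX, hXv⟩ := exists_isClassVec_extend hs v
  have hv : X s = v := by simpa using hXv.self_of_nhdsWithin hs
  have hα : θ s = α := by
    rw [hθα.self_of_nhdsWithin hs]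
    ext w
    rw [coextend_apply, ofModel_toModel (mem_chart_source _ _)]
  have h1 := D.covec_apply hθ hX hs
  rw [hv, hα, ← D.onField_eq hs hX hXv, h,
    derivWithin_eq_zero_of_eventually_eq (c := α v) hs] at h1
  · simpa using h1
  · filter_upwards [hXv, hθα, eventually_mem_chartAt hs] with t h2 h3 h4
    rw [h2, h3, coextend_extend _ _ h4]

/-- Agreement on vectors propagates to every type by evaluating the slotwise Leibniz formula on
arguments with constant components. The minus sign on covectors accounts for the plus sign of the
contravariant terms. -/
theorem DerivationAlong.toFun_eq_covariantAlong (hs : s ∈ γ.J)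
    (h : ∀ v : Tan n (γ.toFun s),
      D.onField (FiberBundle.extend (EuclideanSpace ℝ (Fin n)) v) s = connectionMap cov γ s v)
    {p q : ℕ} {T : TensorField γ p q} (hT : IsClassTensor ((k : ℕ∞ω) + 1) T)
    (α : Fin p → Cotan n (γ.toFun s)) (v : Fin q → Tan n (γ.toFun s)) :
    D.toFun T s α v = covariantAlong cov γ T s α v := by
  choose X hX hXv using fun b => exists_isClassVec_extend hs (v b)
  choose θ hθ hθα using fun a => exists_isClassCovec_coextend hs (α a)
  have hv : (fun b => X b s) = v := funext fun b => by
    simpa using (hXv b).self_of_nhdsWithin hs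
  have hα : (fun a => θ a s) = α := funext fun a => by
    rw [(hθα a).self_of_nhdsWithin hs]
    ext w
    rw [coextend_apply, ofModel_toModel (mem_chart_source _ _)]
  have h1 := D.toFun_apply hT hθ hX hs
  have h2 : (fun t => T t (fun a => θ a t) (fun b => X b t)) =ᶠ[𝓝[γ.J] s] fun t =>
      T t (fun a => coextend (α a) (γ.toFun t))
        (fun b => FiberBundle.extend (EuclideanSpace ℝ (Fin n)) (v b) (γ.toFun t)) := by
    filter_upwards [eventually_all.2 hXv, eventually_all.2 hθα] with t h3 h4
    simp only [h3, h4]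
  rw [hv, hα, h2.derivWithin_eq (h2.self_of_nhdsWithin hs)] at h1
  have h3 : ∀ b, D.vec (X b) s = connectionMap cov γ s (v b) := fun b => by
    rw [← h, D.onField_eq hs (hX b) (hXv b)]
  have h4 : ∀ a, D.covec (θ a) s = -((α a).comp (connectionMap cov γ s)) := fun a =>
    D.covec_of_forall_extend hs h (hθ a) (hθα a)
  rw [h1, covariantAlong]
  simp only [h3, h4, MultilinearMap.map_update_neg, neg_apply, Finset.sum_neg_distrib,
    sub_neg_eq_add]

/-- A derivation along paths is induced by a connection if and only if they agree on the coordinate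
vector fields. -/
theorem isInducedBy_iff {D : DerivationAlongPaths n k M} {A : Set (CPath n k M × ℝ)}
    (hA : ∀ γ s, (γ, s) ∈ A → s ∈ γ.J) :
    IsInducedBy D cov A ↔ ∀ γ s, (γ, s) ∈ A → ∀ a,
      (D γ).onField (FiberBundle.extend (EuclideanSpace ℝ (Fin n)) (coordBasis (γ.toFun s) a)) s =
        cov (FiberBundle.extend (EuclideanSpace ℝ (Fin n)) (coordBasis (γ.toFun s) a))
          (γ.toFun s) (γ.velocity s) := by
  refine ⟨fun h γ s hγ a => ?_, fun h γ s hγ p q T hT α v => ?_⟩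
  · rw [← connectionMap_coordBasis]
    exact (D γ).onField_extend_of_forall (hA γ s hγ) (h γ s hγ 1 0) _
  · refine (D γ).toFun_eq_covariantAlong (hA γ s hγ)
      ((D γ).onField_extend_of_coordBasis (hA γ s hγ) fun a => ?_) hT α v
    rw [h γ s hγ, connectionMap_coordBasis]

/-- A derivation along paths is induced by a connection if and only if they agree on a frame. -/
theorem isInducedBy_iff_frame {D : DerivationAlongPaths n k M} {A : Set (CPath n k M × ℝ)}
    {U V W : Set M} {e : Fin n → ∀ x : M, Tan n x} (hA : ∀ γ s, (γ, s) ∈ A → s ∈ γ.J)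
    (hAU : ∀ γ s, (γ, s) ∈ A → γ.toFun s ∈ U) (hUV : U ⊆ V) (hcov : IsConnectionOn k cov V)
    (he : IsFrameNear k U W e) :
    IsInducedBy D cov A ↔ ∀ γ s, (γ, s) ∈ A → ∀ i,
      (D γ).onField (e i) s = cov (e i) (γ.toFun s) (γ.velocity s) := by
  rw [isInducedBy_iff hA]
  refine ⟨fun h γ s hγ i => ?_, fun h γ s hγ a => ?_⟩
  · refine (D γ).onField_eq_of_frame (hA γ s hγ) hcov (hUV (hAU γ s hγ))
      (chartAt (EuclideanSpace ℝ (Fin n)) (γ.toFun s)).open_source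
      (isLocalFrameOn_extend k (γ.toFun s)) (mem_chart_source _ _) (h γ s hγ) ?_
    filter_upwards [he.isOpen.mem_nhds (he.subset (hAU γ s hγ))] with y hy
    exact he.isLocalFrameOn.contMDiffAt he.isOpen hy i
  · refine (D γ).onField_eq_of_frame (hA γ s hγ) hcov (hUV (hAU γ s hγ)) he.isOpen
      he.isLocalFrameOn (he.subset (hAU γ s hγ)) (h γ s hγ) ?_
    exact (eventually_mem_chart_source (mem_chart_source _ _)).mono fun y hy =>
      contMDiffAt_extend_field k _ hy

/-- Locality makes the choice of the field representing `e_i ∘ γ` near `s` irrelevant, and a cut-off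
provides one. -/
theorem isNormalFor_iff {D : DerivationAlongPaths n k M} {A : Set (CPath n k M × ℝ)}
    {U W : Set M} {e : Fin n → ∀ x : M, Tan n x} (hA : ∀ γ s, (γ, s) ∈ A → s ∈ γ.J)
    (hAU : ∀ γ s, (γ, s) ∈ A → γ.toFun s ∈ U) (he : IsFrameNear k U W e) :
    IsNormalFor D e A ↔ ∀ γ s, (γ, s) ∈ A → ∀ i, (D γ).onField (e i) s = 0 := by
  have h0 : ∀ (γ : CPath n k M) (D : DerivationAlong γ) (X : VectorField γ) (s : ℝ),
      D.onVec X s = 0 ↔ D.vec X s = 0 := fun γ D X s => by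
    rw [D.vec_eq_iff, show vectorTensor (0 : Tan n (γ.toFun s)) = 0 from by ext; simp]
  refine ⟨fun h γ s hγ i => ?_, fun h γ s hγ i X hX hXe => ?_⟩
  · obtain ⟨X, hX, hXe⟩ := exists_isClassVec_of_field (Z := e i) (hA γ s hγ) (by
      filter_upwards [he.isOpen.mem_nhds (he.subset (hAU γ s hγ))] with y hy
      exact he.isLocalFrameOn.contMDiffAt he.isOpen hy i)
    rw [(D γ).onField_eq (hA γ s hγ) hX hXe, ← h0]
    exact h γ s hγ i X hX hXe
  · rw [h0, ← (D γ).onField_eq (hA γ s hγ) hX hXe]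
    exact h γ s hγ i

theorem isNormalFor_of_isNormalForConnection {D : DerivationAlongPaths n k M}
    {A : Set (CPath n k M × ℝ)} {U V W : Set M} {e : Fin n → ∀ x : M, Tan n x}
    (hA : ∀ γ s, (γ, s) ∈ A → s ∈ γ.J) (hAU : ∀ γ s, (γ, s) ∈ A → γ.toFun s ∈ U) (hUV : U ⊆ V)
    (hcov : IsConnectionOn k cov V) (hD : IsInducedBy D cov A) (he : IsFrameNear k U W e)
    (h : IsNormalForConnection cov e U) : IsNormalFor D e A := by
  rw [isNormalFor_iff hA hAU he]
  intro γ s hγ i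
  rw [(isInducedBy_iff_frame hA hAU hUV hcov he).1 hD γ s hγ i,
    h.apply_eq_zero he (hAU γ s hγ) i]
  rfl

/-- The paths in `A` see `∇` only in the directions of their velocities, so `hpath` asks that every
direction occur. Velocities are compared in the chart at `x` because `γ(s)` and `x` are equal but
not definitionally so. -/
theorem isNormalForConnection_of_isNormalFor {D : DerivationAlongPaths n k M}
    {A : Set (CPath n k M × ℝ)} {U V W : Set M} {e : Fin n → ∀ x : M, Tan n x}
    (hA : ∀ γ s, (γ, s) ∈ A → s ∈ γ.J) (hAU : ∀ γ s, (γ, s) ∈ A → γ.toFun s ∈ U) (hUV : U ⊆ V)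
    (hcov : IsConnectionOn k cov V) (hD : IsInducedBy D cov A) (he : IsFrameNear k U W e)
    (hpath : ∀ x ∈ U, ∀ w : EuclideanSpace ℝ (Fin n), ∃ γ s, (γ, s) ∈ A ∧ γ.toFun s = x ∧
      toModel x (γ.toFun s) (γ.velocity s) = w)
    (h : IsNormalFor D e A) : IsNormalForConnection cov e U := by
  intro x hx i j
  obtain ⟨γ, s, hγ, rfl, hw⟩ := hpath x hx (toModel x x (e i x))
  rw [← toModel_injective (mem_chart_source _ _) hw,
    ← (isInducedBy_iff_frame hA hAU hUV hcov he).1 hD γ s hγ j]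
  exact (isNormalFor_iff hA hAU he).1 h γ s hγ j

/-- The required connection is the flat one of the normal frame: for it and for `D` all derivatives
of the frame fields vanish, so they agree on a frame. The argument uses only that the parameters lie
in the interval and the points in `U`, hence serves both families of paths. -/
theorem admitsNormalFrame_iff {D : DerivationAlongPaths n k M}
    {A : Set (CPath n k M × ℝ)} {U : Set M} (hA : ∀ γ s, (γ, s) ∈ A → s ∈ γ.J)
    (hAU : ∀ γ s, (γ, s) ∈ A → γ.toFun s ∈ U) :
    AdmitsNormalFrame D U A ↔ ∃ V cov, U ⊆ V ∧ IsConnectionOn k cov V ∧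
      ConnectionAdmitsNormalFrame k cov U ∧ IsInducedBy D cov A := by
  constructor
  · rintro ⟨W, e, he, h⟩
    have hcov := isConnectionOn_flatConnection he.isLocalFrameOn he.isOpen
    have h0 : ∀ x ∈ U, ∀ j, flatConnection he.isLocalFrameOn (e j) x = 0 := fun x hx j =>
      flatConnection_frame _ he.isOpen (he.subset hx) j
    refine ⟨W, _, he.subset, hcov, ⟨W, e, he, fun x hx i j => ?_⟩, ?_⟩
    · rw [h0 x hx j]
      rfl
    · rw [isInducedBy_iff_frame hA hAU he.subset hcov he]
      intro γ s hγ i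
      rw [h0 _ (hAU γ s hγ) i, (isNormalFor_iff hA hAU he).1 h γ s hγ i]
      rfl
  · rintro ⟨V, cov, hUV, hcov, ⟨W, e, he, h⟩, hD⟩
    exact ⟨W, e, he, isNormalFor_of_isNormalForConnection hA hAU hUV hcov hD he h⟩

/-- A path with given velocity which stays in a given open set. -/
theorem exists_path_velocity (k : ℕ∞) [IsManifold (𝓡 n) ((k : ℕ∞ω) + 2) M] (x : M) {O : Set M}
    (hO : O ∈ 𝓝 x) (w : EuclideanSpace ℝ (Fin n)) :
    ∃ (γ : CPath n k M) (s : ℝ), s ∈ γ.J ∧ (∀ t ∈ γ.J, γ.toFun t ∈ O) ∧ γ.toFun s = x ∧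
      toModel x (γ.toFun s) (γ.velocity s) = w := by
  have : IsManifold (𝓡 n) ((k : ℕ∞ω) + 1) M :=
    IsManifold.of_le (n := (k : ℕ∞ω) + 2) (by gcongr; norm_num)
  set ψ := chartAt (EuclideanSpace ℝ (Fin n)) x
  have hx := mem_chart_source (EuclideanSpace ℝ (Fin n)) x
  -- A straight segment in the chart, short enough to remain in `O`.
  let c : ℝ → EuclideanSpace ℝ (Fin n) := fun t => ψ x + t • w
  have hc : ContDiff ℝ ((k : ℕ∞ω) + 1) c := contDiff_const.add (contDiff_id.smul contDiff_const)
  have hc0 : c 0 = ψ x := by simp [c]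
  have h1 : ∀ᶠ t in 𝓝 (0 : ℝ), c t ∈ ψ.target ∧ ψ.symm (c t) ∈ O := by
    refine hc.continuous.continuousAt.eventually
      (p := fun y => y ∈ ψ.target ∧ ψ.symm y ∈ O) ?_
    rw [hc0]
    refine inter_mem (ψ.open_target.mem_nhds (ψ.map_source hx)) ?_
    refine ψ.symm.continuousAt (ψ.map_source hx) ?_
    rwa [ψ.left_inv hx]
  obtain ⟨ε, hε, hball⟩ := Metric.eventually_nhds_iff_ball.1 h1
  let γ : CPath n k M :=
    { J := Metric.ball 0 ε
      ordConnected := by rw [Real.ball_eq_Ioo]; exact ordConnected_Ioo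
      nontrivial := by
        refine ⟨0, Metric.mem_ball_self hε, ε / 2, ?_, by positivity⟩
        simp [abs_of_pos hε, hε]
      toFun := fun t => ψ.symm (c t)
      contMDiffOn := (contMDiffOn_chart_symm (I := 𝓡 n) (n := (k : ℕ∞ω) + 1)).comp
        hc.contMDiff.contMDiffOn fun t ht => (hball t ht).1 }
  have h0 : (0 : ℝ) ∈ γ.J := Metric.mem_ball_self hε
  have hγ0 : γ.toFun 0 = x := by
    change ψ.symm (c 0) = x
    rw [hc0, ψ.left_inv hx]
  refine ⟨γ, 0, h0, fun t ht => (hball t ht).2, hγ0, ?_⟩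
  rw [toModel_velocity h0 (hγ0.symm ▸ hx)]
  have h2 : EqOn (fun t => ψ (γ.toFun t)) c γ.J := fun t ht => ψ.right_inv (hball t ht).1
  have h3 : HasDerivAt c ((1 : ℝ) • w) 0 :=
    ((hasDerivAt_id' (0 : ℝ)).smul_const w).const_add (ψ x)
  rw [one_smul] at h3
  rw [derivWithin_congr h2 (h2 h0)]
  exact h3.hasDerivWithinAt.derivWithin (γ.uniqueDiffOn 0 h0)

theorem pathsThrough_velocity (U : Set M) (x : M) (hx : x ∈ U) (w : EuclideanSpace ℝ (Fin n)) :
    ∃ γ s, (γ, s) ∈ pathsThrough (n := n) k U ∧ γ.toFun s = x ∧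
      toModel x (γ.toFun s) (γ.velocity s) = w := by
  obtain ⟨γ, s, hs, -, h1, h2⟩ := exists_path_velocity k x univ_mem w
  exact ⟨γ, s, ⟨hs, by rwa [h1]⟩, h1, h2⟩

theorem pathsInside_velocity {U : Set M} (hU : IsOpen U) (x : M) (hx : x ∈ U)
    (w : EuclideanSpace ℝ (Fin n)) :
    ∃ γ s, (γ, s) ∈ pathsInside (n := n) k U ∧ γ.toFun s = x ∧
      toModel x (γ.toFun s) (γ.velocity s) = w := by
  obtain ⟨γ, s, hs, hU', h1, h2⟩ := exists_path_velocity k x (hU.mem_nhds hx) w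
  exact ⟨γ, s, ⟨hs, hU'⟩, h1, h2⟩

end Induced

end NormalFrames

end

/-! ### Assembly of the four statements -/

open NormalFrames in
theorem mainTheorem6 (n : ℕ) (k : ℕ∞) (M : Type*) [TopologicalSpace M] [T2Space M]
    [ChartedSpace (EuclideanSpace ℝ (Fin n)) M]
    [IsManifold (𝓡 n) 1 M] [IsManifold (𝓡 n) ((k : ℕ∞ω) + 2) M] :
    -- a derivation along a fixed path: existence and general form of the normal frames
    (∀ (γ : CPath n k M) (D : DerivationAlong γ),
      (∃ e, IsFrameAlong γ e ∧ IsNormalAlong D e) ∧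
      ∀ e, IsFrameAlong γ e →
        ∃ Γ : ℝ → Matrix (Fin n) (Fin n) ℝ,
          IsComponents D e Γ ∧
          (∀ i j, ContDiffOn ℝ (k : ℕ∞ω) (fun s => Γ s i j) γ.J) ∧
          ∀ s₀ ∈ γ.J, ∃ Y : ℝ → Matrix (Fin n) (Fin n) ℝ,
            IsFundamentalSolution γ Γ s₀ Y ∧
            (∀ Y', IsFundamentalSolution γ Γ s₀ Y' → ∀ s ∈ γ.J, Y' s = Y s) ∧
            (∀ s ∈ γ.J, IsUnit (Y s)) ∧
            ∀ e' : Fin n → VectorField γ,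
              (IsFrameAlong γ e' ∧ IsNormalAlong D e') ↔
                ∃ B : GL (Fin n) ℝ, ∀ s ∈ γ.J, ∀ j,
                  e' j s = ∑ i, (Y s * (B : Matrix (Fin n) (Fin n) ℝ)) i j • e i s) ∧
    -- local holonomic extension of a frame along a path
    (∀ (γ : CPath n k M) (e : Fin n → VectorField γ), IsFrameAlong γ e →
      ∀ s₀ ∈ γ.J, γ.velocity s₀ ≠ 0 →
        ∃ φ ∈ IsManifold.maximalAtlas (𝓡 n) ((k : ℕ∞ω) + 1) M,
          ∀ᶠ s in 𝓝[γ.J] s₀, γ.toFun s ∈ φ.source ∧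
            ∀ i, mfderiv (𝓡 n) (𝓡 n) φ (γ.toFun s) (e i s) = EuclideanSpace.single i (1 : ℝ)) ∧
    -- derivations along arbitrary paths, all paths being considered when they are in `U`
    (∀ (D : DerivationAlongPaths n k M) (U : Set M),
      (AdmitsNormalFrame D U (pathsThrough k U) ↔
        ∃ V cov, U ⊆ V ∧ IsConnectionOn k cov V ∧ ConnectionAdmitsNormalFrame k cov U ∧
          IsInducedBy D cov (pathsThrough k U)) ∧
      ∀ V cov, U ⊆ V → IsConnectionOn k cov V → IsInducedBy D cov (pathsThrough k U) →
        ∀ W e, IsFrameNear k U W e →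
          (IsNormalFor D e (pathsThrough k U) ↔ IsNormalForConnection cov e U)) ∧
    -- derivations along arbitrary paths, only the paths lying in `U` being considered
    (∀ (D : DerivationAlongPaths n k M) (U : Set M),
      (AdmitsNormalFrame D U (pathsInside k U) ↔
        ∃ V cov, U ⊆ V ∧ IsConnectionOn k cov V ∧ ConnectionAdmitsNormalFrame k cov U ∧
          IsInducedBy D cov (pathsInside k U)) ∧
      ∀ V cov, U ⊆ V → IsConnectionOn k cov V → IsInducedBy D cov (pathsInside k U) →
        ∀ W e, IsFrameNear k U W e →
          (IsNormalForConnection cov e U → IsNormalFor D e (pathsInside k U)) ∧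
          (IsOpen U → IsNormalFor D e (pathsInside k U) → IsNormalForConnection cov e U)) := by
  refine ⟨fun γ D => ⟨D.exists_isNormalAlong, fun e he => ?_⟩,
    fun γ e he s₀ hs₀ hv => exists_chart_of_isFrameAlong he hs₀ hv,
    fun D U => ⟨?_, fun V cov hUV hcov hD W e he => ?_⟩,
    fun D U => ⟨?_, fun V cov hUV hcov hD W e he => ?_⟩⟩
  · refine ⟨D.components he, D.isComponents_components he, D.contDiffOn_components he,
      fun s₀ hs₀ => ?_⟩
    have hΓ := D.contDiffOn_components he
    obtain ⟨Y, hY⟩ := exists_isFundamentalSolution hΓ hs₀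
    exact ⟨Y, hY, fun Y' hY' s hs => hY.unique hΓ hs₀ hY' hs,
      fun s hs => hY.isUnit hΓ hs₀ hs, fun e' => D.isNormalAlong_iff_exists he hs₀ hY e'⟩
  · exact admitsNormalFrame_iff (fun _ _ h => h.1) fun _ _ h => h.2
  · exact ⟨isNormalForConnection_of_isNormalFor (fun _ _ h => h.1) (fun _ _ h => h.2) hUV hcov hD he
      (pathsThrough_velocity U), isNormalFor_of_isNormalForConnection (fun _ _ h => h.1)
        (fun _ _ h => h.2) hUV hcov hD he⟩
  · exact admitsNormalFrame_iff (fun _ _ h => h.1) fun _ _ h => h.2 _ h.1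
  · exact ⟨isNormalFor_of_isNormalForConnection (fun _ _ h => h.1)
        (fun _ _ h => h.2 _ h.1) hUV hcov hD he,
      fun hU => isNormalForConnection_of_isNormalFor (fun _ _ h => h.1) (fun _ _ h => h.2 _ h.1)
        hUV hcov hD he (pathsInside_velocity hU)⟩
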